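/- For every $\varepsilon>0$ there is a bounded, connected open set $\Omega_\varepsilon\subset\mathbb{R}^3$ that is $C^\infty$-diffeomorphic to the open unit ball and has $C^{1,1}$ boundary (near each boundary point, after a rigid motion, $\Omega_\varepsilon$ is the subgraph of a $C^1$ function with Lipschitz gradient), such that $$\|H\|_{L^\infty(\partial\Omega_\varepsilon)}\le 1,\qquad |S(\Omega_\varepsilon)-8\pi|\le\varepsilon,\qquad V(\Omega_\varepsilon)\le\varepsilon .$$ Here $V(\Omega)$ is the volume (Lebesgue measure) of $\Omega$, and $S(\Omega)=\mathcal{H}^2(\partial\Omega)<\infty$ is the surface area of its boundary, where $\mathcal{H}^2$ is the two-dimensional Hausdorff measure normalized to agree with area on planes. $H$ is the mean curvature of $\partial\Omega$: the arithmetic mean of the two principal curvatures, i.e. half the trace, on the tangent plane, of the derivative along $\partial\Omega$ of the outer unit normal (so $H=1/R$ on the boundary of a ball of radius $R$). It is defined at $\mathcal{H}^2$-almost every point of $\partial\Omega_\varepsilon$, and the $L^\infty$ norm is taken with respect to $\mathcal{H}^2$ on $\partial\Omega_\varepsilon$. -/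

import Mathlib

open MeasureTheory Metric
open scoped ContDiff

/-- Euclidean three-dimensional space. -/
abbrev E3 : Type := EuclideanSpace ℝ (Fin 3)

/-- Two (open) subsets of `ℝ³` are diffeomorphic: there are mutually inverse `C^∞` maps
between them. -/
def AreDiffeomorphic (U V : Set E3) : Prop :=
  ∃ f g : E3 → E3,
    ContDiffOn ℝ ∞ f U ∧ ContDiffOn ℝ ∞ g V ∧ Set.MapsTo f U V ∧ Set.MapsTo g V U ∧
      Set.InvOn g f U V

/-- `Ω` has `C^{1,1}` boundary: near each boundary point `p`, after a rigid motion `e` of `ℝ³`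
taking `p` to the origin, `Ω` is the strict subgraph of a `C¹` function of the first two
coordinates whose derivative is Lipschitz. -/
def HasC11Boundary (Ω : Set E3) : Prop :=
  ∀ p ∈ frontier Ω, ∃ (e : E3 ≃ᵃⁱ[ℝ] E3) (r : ℝ) (u : EuclideanSpace ℝ (Fin 2) → ℝ),
    0 < r ∧ e p = 0 ∧
    ContDiffOn ℝ 1 u (ball 0 r) ∧
    (∃ K : NNReal, LipschitzOnWith K (fderiv ℝ u) (ball 0 r)) ∧
    ∀ x ∈ ball p r, x ∈ Ω ↔ e x 2 < u !₂[e x 0, e x 1]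

/-- `n` is the outer unit normal of `Ω` at the boundary point `p`: it has length one, and for each
`δ > 0` and all `x` close to `p`, the points with `⟪x - p, n⟫ < -δ ‖x - p‖` are in `Ω` and those
with `⟪x - p, n⟫ > δ ‖x - p‖` are outside the closure of `Ω`. Such an `n` is unique. -/
def IsOuterUnitNormal (Ω : Set E3) (p n : E3) : Prop :=
  ‖n‖ = 1 ∧ ∀ δ : ℝ, 0 < δ → ∀ᶠ x in nhds p,
    (inner ℝ (x - p) n < -(δ * ‖x - p‖) → x ∈ Ω) ∧
    (δ * ‖x - p‖ < inner ℝ (x - p) n → x ∉ closure Ω)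

/-- `H` is the mean curvature (arithmetic mean of the two principal curvatures, with respect to
the outer normal) of `∂Ω` at `p`: the outer unit normal field `ν` of `∂Ω` is differentiable along
`∂Ω` at `p`, with derivative `A`, and `H` is half the trace of `A` on the tangent plane `ν(p)^⊥`.
The sphere of radius `R` bounding a ball has `H = 1 / R`. -/
def HasMeanCurvatureAt (Ω : Set E3) (H : ℝ) (p : E3) : Prop :=
  ∃ (ν : E3 → E3) (A : E3 →L[ℝ] E3),
    (∀ q ∈ frontier Ω, IsOuterUnitNormal Ω q (ν q)) ∧
    HasFDerivWithinAt ν A (frontier Ω) p ∧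
    H = (LinearMap.trace ℝ E3 (A : E3 →ₗ[ℝ] E3) - inner ℝ (A (ν p)) (ν p)) / 2

/-- Surface measure on `∂Ω`: the two-dimensional Hausdorff measure, normalized so as to agree
with the area on planes. -/
noncomputable def surfaceMeasure (Ω : Set E3) : Measure E3 :=
  (Measure.euclideanHausdorffMeasure 2 : Measure E3).restrict (frontier Ω)

/-! ### Area formula for injective immersions that do not contract -/

section AreaFormula

open Set Filter Topology
open scoped ENNReal NNReal MeasureTheory

/-! Take the unit sphere about the origin and a sphere of radius `R`, slightly larger than 1, about
`(0, 0, h)`, and join them near the north pole by a small catenoidal neck around the vertical axis.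
The domain is the shell between the spheres minus the tube inside the neck. Its boundary has area
close to `8 * π`, its volume is at most that of the shell, and a shell with a hole drilled through
it is a ball.

The point is `|H| ≤ 1`. Put `s = x² + y²`. If the unit normal of a surface of revolution has
horizontal part `m s / s • (x, y)`, its mean curvature is `m' s` up to sign
(`hasMeanCurvatureAt_of_graph`). Constant `m` gives catenoids and `m s = s / R` gives spheres, so
the bound on `H` becomes a bound on the slope of `m`. On the lower graph, `mb` passes from `c` to
`s`. On the upper graph, `mt` passes from `-c` to `s - 2 * c` and then, near `s = σ`, to `s / R`;
running at slope `1 > 1 / R` makes up the deficit `2 * c`. All slopes stay in `[0, 1]`, and the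
transitions are `C¹`, so the surface is `C²` (`exists_neckSlopes`, `exists_isDefiningAt`).

It remains to close up the heights. With `ℓ = log (1 / c)`, the vertical gap of the two graphs at
the end of the neck lies between roughly `c * ℓ` and `3 * c * ℓ` (`graph_gap_mem`). For `R - 1 = 2 *
c * ℓ` the mismatch with concentric spheres is absorbed by a shift `h` with `|h| < R - 1`, which
keeps the spheres disjoint (`abs_center_lt`). As `c` tends to 0, both `R - 1` and the neck size `s₁
= 2 * R / ℓ` tend to 0.

For the diffeomorphism, the domain meets each ray from the origin in an interval
(`ordConnected_ray`), and the rays that it meets form a disc in stereographic coordinates. An open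
set with nonempty interval fibres over a vector space is a product with `ℝ`
(`exists_fiberwise_diffeo`). Areas come from the area formula, which for radial graphs reduces to a
one-variable integral in `s` (`area_radial_graph`). -/

theorem hausdorffMeasure_image_le_of_dist_le {α X Y : Type*} [MetricSpace X] [MeasurableSpace X]
    [BorelSpace X] [MetricSpace Y] [MeasurableSpace Y] [BorelSpace Y]
    {f : α → X} {g : α → Y} {S : Set α} {K : ℝ≥0} {d : ℕ}
    (h : ∀ x ∈ S, ∀ y ∈ S, dist (f x) (f y) ≤ K * dist (g x) (g y)) :
    (μHE[d] : Measure X) (f '' S) ≤ (K : ℝ≥0∞) ^ d * (μHE[d] : Measure Y) (g '' S) := by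
  rcases S.eq_empty_or_nonempty with rfl | ⟨x₀, hx₀⟩
  · simp
  have : Nonempty α := ⟨x₀⟩
  -- Points of `S` with the same `g` have the same `f`, so `f` factors through `g`, and the factor
  -- is `K`-Lipschitz.
  have key : ∀ x ∈ S, f (Function.invFunOn g S (g x)) = f x := by
    intro x hx
    have hm : g x ∈ g '' S := mem_image_of_mem g hx
    have h1 := Function.invFunOn_mem hm
    have h2 := Function.invFunOn_eq hm
    have := h _ h1 _ hx
    rw [h2, dist_self, mul_zero] at this
    exact dist_le_zero.1 this
  have hL : LipschitzOnWith K (fun y => f (Function.invFunOn g S y)) (g '' S) := by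
    apply LipschitzOnWith.of_dist_le_mul
    rintro _ ⟨x, hx, rfl⟩ _ ⟨y, hy, rfl⟩
    rw [key x hx, key y hy]
    exact h x hx y hy
  have him : (fun y => f (Function.invFunOn g S y)) '' (g '' S) = f '' S := by
    rw [image_image]
    exact image_congr key
  have := hL.hausdorffMeasure_image_le (d := (d : ℝ)) (by positivity)
  rw [him] at this
  simp only [Measure.euclideanHausdorffMeasure_def, Measure.smul_apply, Measure.nnreal_smul_coe_apply]
  rw [ENNReal.rpow_natCast] at this
  calc _ ≤ _ := mul_le_mul_right this _
    _ = _ := by ring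

variable {V W : Type*} [NormedAddCommGroup V] [InnerProductSpace ℝ V] [FiniteDimensional ℝ V]
  [MeasurableSpace V] [BorelSpace V]
  [NormedAddCommGroup W] [InnerProductSpace ℝ W] [MeasurableSpace W] [BorelSpace W]

/-- Since `A` does not contract, the error `r * ‖x - y‖` is at most `r * ‖A (x - y)‖`. Distances in
the images under `f` and under `A` thus agree up to factors `1 ± r`, and the measure of the linear
image is known. -/
theorem euclideanHausdorffMeasure_image_bounds_of_approximatesLinearOn {f : V → W} {A : V →L[ℝ] W}
    {S : Set V} {r : ℝ≥0} (hr : r < 1) (hA : ∀ v, ‖v‖ ≤ ‖A v‖) (hf : ApproximatesLinearOn f A S r) :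
    (μHE[Module.finrank ℝ V] : Measure W) (f '' S) ≤
        ((1 + r : ℝ≥0) : ℝ≥0∞) ^ (Module.finrank ℝ V) *
        (ENNReal.ofReal (A : V →ₗ[ℝ] W).normDet * volume S) ∧
      ((1 - r : ℝ≥0) : ℝ≥0∞) ^ (Module.finrank ℝ V) *
        (ENNReal.ofReal (A : V →ₗ[ℝ] W).normDet * volume S) ≤
        (μHE[Module.finrank ℝ V] : Measure W) (f '' S) := by
  have hvol := LinearMap.euclideanHausdorffMeasure_image_eq_normDet_mul_volume (A : V →ₗ[ℝ] W) S
  rw [← hvol]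
  have key : ∀ x ∈ S, ∀ y ∈ S, ‖f x - f y - A (x - y)‖ ≤ r * ‖A (x - y)‖ := by
    intro x hx y hy
    exact (hf x hx y hy).trans (mul_le_mul_of_nonneg_left (hA _) r.2)
  constructor
  · apply hausdorffMeasure_image_le_of_dist_le
    intro x hx y hy
    have h1 := key x hx y hy
    have h2 : ‖f x - f y‖ ≤ ‖f x - f y - A (x - y)‖ + ‖A (x - y)‖ := by
      simpa using norm_add_le (f x - f y - A (x - y)) (A (x - y))
    rw [dist_eq_norm, dist_eq_norm]
    simp only [ContinuousLinearMap.coe_coe, ← map_sub, NNReal.coe_add, NNReal.coe_one]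
    linarith
  · have h0 : (μHE[Module.finrank ℝ V] : Measure W) ((A : V →ₗ[ℝ] W) '' S) ≤
        (((1 - r)⁻¹ : ℝ≥0) : ℝ≥0∞) ^ (Module.finrank ℝ V) *
        (μHE[Module.finrank ℝ V] : Measure W) (f '' S) := by
      apply hausdorffMeasure_image_le_of_dist_le
      intro x hx y hy
      have h1 := key x hx y hy
      have h2 : ‖A (x - y)‖ ≤ ‖f x - f y - A (x - y)‖ + ‖f x - f y‖ := by
        have := norm_sub_le (f x - f y) (f x - f y - A (x - y))
        rw [sub_sub_cancel] at this
        linarith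
      rw [dist_eq_norm, dist_eq_norm]
      have hr' : (0 : ℝ) < 1 - r := by simpa using hr
      simp only [ContinuousLinearMap.coe_coe, ← map_sub, NNReal.coe_inv, NNReal.coe_sub hr.le,
        NNReal.coe_one]
      rw [← div_eq_inv_mul, le_div_iff₀ hr']
      nlinarith
    have hne : ((1 - r : ℝ≥0) : ℝ≥0∞) ≠ 0 := by
      have : (1 - r : ℝ≥0) ≠ 0 := (tsub_pos_of_lt hr).ne'
      exact_mod_cast this
    have hr2 : (1 - r : ℝ≥0) ≠ 0 := (tsub_pos_of_lt hr).ne'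
    calc _ ≤ ((1 - r : ℝ≥0) : ℝ≥0∞) ^ (Module.finrank ℝ V) * _ := mul_le_mul_right h0 _
      _ = _ := by
        rw [← mul_assoc, ← mul_pow, ENNReal.coe_inv hr2,
          ENNReal.mul_inv_cancel hne ENNReal.coe_ne_top, one_pow, one_mul]

/-- On a small ball `f'` is close to `f' x` and `J` is relatively close to `J x`. The two
inequalities avoid division so that they can be summed over a countable partition before `r` tends
to 0. -/
theorem exists_ball_image_bounds [CompleteSpace W] {f : V → W} {f' : V → V →L[ℝ] W} {J : V → ℝ}
    {U : Set V} (hU : IsOpen U) (hf : ∀ x ∈ U, HasFDerivAt f (f' x) x) (hf' : ContinuousOn f' U)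
    (hA : ∀ x ∈ U, ∀ v, ‖v‖ ≤ ‖f' x v‖) (hJ : ContinuousOn J U)
    (hJ' : ∀ x ∈ U, (f' x : V →ₗ[ℝ] W).normDet = J x) (hJ0 : ∀ x ∈ U, 0 < J x)
    {r : ℝ≥0} (hr0 : 0 < r) (hr : r < 1) {x : V} (hx : x ∈ U) :
    ∃ O : Set V, IsOpen O ∧ x ∈ O ∧ ∀ S ⊆ O ∩ U, MeasurableSet S →
      ((1 - r : ℝ≥0) : ℝ≥0∞) ^ (Module.finrank ℝ V) * ∫⁻ y in S, ENNReal.ofReal (J y) ≤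
        ((1 + r : ℝ≥0) : ℝ≥0∞) * (μHE[Module.finrank ℝ V] : Measure W) (f '' S) ∧
      ((1 - r : ℝ≥0) : ℝ≥0∞) * (μHE[Module.finrank ℝ V] : Measure W) (f '' S) ≤
        ((1 + r : ℝ≥0) : ℝ≥0∞) ^ (Module.finrank ℝ V) * ∫⁻ y in S, ENNReal.ofReal (J y) := by
  have hUx : U ∈ 𝓝 x := hU.mem_nhds hx
  have e1 : ∀ᶠ y in 𝓝 x, ‖f' y - f' x‖ ≤ r := by
    have := (hf'.continuousAt hUx)
    have h2 := Metric.continuousAt_iff'.1 this r hr0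
    filter_upwards [h2] with y hy
    rw [← dist_eq_norm]; exact hy.le
  have hJx := hJ0 x hx
  have e2 : ∀ᶠ y in 𝓝 x, |J y - J x| < r * J x := by
    have := (hJ.continuousAt hUx)
    have h2 := Metric.continuousAt_iff'.1 this (r * J x) (by positivity)
    filter_upwards [h2] with y hy
    rwa [← Real.dist_eq]
  obtain ⟨η, hη, hball⟩ := Metric.eventually_nhds_iff_ball.1 ((e1.and e2).and hUx)
  refine ⟨ball x η, isOpen_ball, mem_ball_self hη, fun S hS hSm => ?_⟩
  have hSb : S ⊆ ball x η := fun y hy => (hS hy).1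
  have happ : ApproximatesLinearOn f (f' x) S r := by
    intro a ha b hb
    have := (convex_ball x η).norm_image_sub_le_of_norm_hasFDerivWithin_le
      (f := fun y => f y - f' x y) (f' := fun y => f' y - f' x) (C := r)
      (fun y hy => (((hf y (hball y hy).2).sub (f' x).hasFDerivAt)).hasFDerivWithinAt)
      (fun y hy => (hball y hy).1.1) (hSb hb) (hSb ha)
    rw [map_sub]
    convert this using 2
    abel
  obtain ⟨b1, b2⟩ := euclideanHausdorffMeasure_image_bounds_of_approximatesLinearOn hr (hA x hx) happ
  rw [hJ' x hx] at b1 b2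
  set d := Module.finrank ℝ V
  have rr : ((1 + r : ℝ≥0) : ℝ≥0∞) = ENNReal.ofReal (1 + r) := by
    rw [← ENNReal.ofReal_coe_nnreal, NNReal.coe_add, NNReal.coe_one]
  have rr' : ((1 - r : ℝ≥0) : ℝ≥0∞) = ENNReal.ofReal (1 - r) := by
    rw [← ENNReal.ofReal_coe_nnreal, NNReal.coe_sub hr.le, NNReal.coe_one]
  have hr' : (0 : ℝ) ≤ 1 - r := by
    have : (r : ℝ) < 1 := by exact_mod_cast hr
    linarith
  have i1 : ∫⁻ y in S, ENNReal.ofReal (J y) ≤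
      ((1 + r : ℝ≥0) : ℝ≥0∞) * (ENNReal.ofReal (J x) * volume S) := by
    rw [rr, ← mul_assoc, ← ENNReal.ofReal_mul (by positivity)]
    refine (setLIntegral_mono measurable_const (g := fun _ => ENNReal.ofReal ((1 + r) * J x))
      fun y hy => ?_).trans (by rw [setLIntegral_const])
    apply ENNReal.ofReal_le_ofReal
    have := (abs_lt.1 (hball y (hSb hy)).1.2).2
    linarith
  have i2 : ((1 - r : ℝ≥0) : ℝ≥0∞) * (ENNReal.ofReal (J x) * volume S) ≤
      ∫⁻ y in S, ENNReal.ofReal (J y) := by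
    rw [rr', ← mul_assoc, ← ENNReal.ofReal_mul hr', ← setLIntegral_const]
    apply setLIntegral_mono' hSm
    intro y hy
    apply ENNReal.ofReal_le_ofReal
    have := (abs_lt.1 (hball y (hSb hy)).1.2).1
    linarith
  constructor
  · calc _ ≤ _ := mul_le_mul_right i1 _
      _ = ((1 + r : ℝ≥0) : ℝ≥0∞) * (((1 - r : ℝ≥0) : ℝ≥0∞) ^ d *
          (ENNReal.ofReal (J x) * volume S)) := by ring
      _ ≤ _ := mul_le_mul_right b2 _
  · calc _ ≤ _ := mul_le_mul_right b1 _
      _ = ((1 + r : ℝ≥0) : ℝ≥0∞) ^ d * (((1 - r : ℝ≥0) : ℝ≥0∞) *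
          (ENNReal.ofReal (J x) * volume S)) := by ring
      _ ≤ _ := mul_le_mul_right i2 _

/-- Area formula for an injective `C¹` immersion that does not contract tangent vectors. -/
theorem euclideanHausdorffMeasure_image_eq_lintegral [CompleteSpace W] {f : V → W}
    {f' : V → V →L[ℝ] W} {J : V → ℝ}
    {U : Set V} (hU : IsOpen U) (hf : ∀ x ∈ U, HasFDerivAt f (f' x) x) (hf' : ContinuousOn f' U)
    (hA : ∀ x ∈ U, ∀ v, ‖v‖ ≤ ‖f' x v‖) (hJ : ContinuousOn J U)
    (hJ' : ∀ x ∈ U, (f' x : V →ₗ[ℝ] W).normDet = J x) (hJ0 : ∀ x ∈ U, 0 < J x)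
    (hinj : InjOn f U) {B : Set V} (hBU : B ⊆ U) (hB : MeasurableSet B) :
    (μHE[Module.finrank ℝ V] : Measure W) (f '' B) = ∫⁻ y in B, ENNReal.ofReal (J y) := by
  have hcont : ContinuousOn f U := fun x hx => (hf x hx).continuousAt.continuousWithinAt
  set d := Module.finrank ℝ V
  have bounds : ∀ r : ℝ≥0, 0 < r → r < 1 →
      ((1 - r : ℝ≥0) : ℝ≥0∞) ^ d * ∫⁻ y in B, ENNReal.ofReal (J y) ≤
        ((1 + r : ℝ≥0) : ℝ≥0∞) * (μHE[d] : Measure W) (f '' B) ∧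
      ((1 - r : ℝ≥0) : ℝ≥0∞) * (μHE[d] : Measure W) (f '' B) ≤
        ((1 + r : ℝ≥0) : ℝ≥0∞) ^ d * ∫⁻ y in B, ENNReal.ofReal (J y) := by
    intro r hr0 hr
    have hex := fun x : U => exists_ball_image_bounds hU hf hf' hA hJ hJ' hJ0 hr0 hr x.2
    choose O hO hxO hprop using hex
    obtain ⟨T, hTc, hT⟩ := TopologicalSpace.isOpen_iUnion_countable O hO
    rcases B.eq_empty_or_nonempty with rfl | ⟨b, hb⟩
    · simp
    have hTne : T.Nonempty := by
      have : b ∈ ⋃ i, O i := mem_iUnion.2 ⟨⟨b, hBU hb⟩, hxO _⟩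
      rw [← hT] at this
      obtain ⟨i, hi, -⟩ := mem_iUnion₂.1 this
      exact ⟨i, hi⟩
    obtain ⟨e, he⟩ := hTc.exists_eq_range hTne
    -- Countably many of the good neighbourhoods cover `B`; making them disjoint gives a measurable
    -- partition.
    let P : ℕ → Set V := fun n => B ∩ disjointed (fun n => O (e n)) n
    have hPm : ∀ n, MeasurableSet (P n) := fun n =>
      hB.inter (MeasurableSet.disjointed (fun n => (hO _).measurableSet) n)
    have hPd : Pairwise (Function.onFun Disjoint P) := fun i j hij =>
      ((disjoint_disjointed (fun n => O (e n))) hij).mono inter_subset_right inter_subset_right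
    have hPU : ⋃ n, P n = B := by
      rw [← inter_iUnion, iUnion_disjointed]
      apply inter_eq_left.2
      intro x hx
      have : x ∈ ⋃ i, O i := mem_iUnion.2 ⟨⟨x, hBU hx⟩, hxO _⟩
      rw [← hT, he] at this
      simpa using this
    have hPb : ∀ n, P n ⊆ B := fun n => inter_subset_left
    have hPO : ∀ n, P n ⊆ O (e n) ∩ U := fun n x hx =>
      ⟨disjointed_subset (fun n => O (e n)) n hx.2, hBU hx.1⟩
    have s1 : (μHE[d] : Measure W) (f '' B) = ∑' n, (μHE[d] : Measure W) (f '' P n) := by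
      conv_lhs => rw [← hPU, image_iUnion]
      rw [measure_iUnion]
      · intro i j hij
        exact Set.disjoint_image_image fun a ha b hb hab => (hPd hij).le_bot
          ⟨ha, by rwa [hinj (hBU (hPb i ha)) (hBU (hPb j hb)) hab]⟩
      · intro n
        exact (hPm n).image_of_continuousOn_injOn (hcont.mono ((hPb n).trans hBU))
          (hinj.mono ((hPb n).trans hBU))
    have s2 : ∫⁻ y in B, ENNReal.ofReal (J y) = ∑' n, ∫⁻ y in P n, ENNReal.ofReal (J y) := by
      conv_lhs => rw [← hPU]
      rw [lintegral_iUnion hPm hPd]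
    rw [s1, s2]
    simp only [← ENNReal.tsum_mul_left]
    exact ⟨ENNReal.tsum_le_tsum fun n => (hprop (e n) (P n) (hPO n) (hPm n)).1,
      ENNReal.tsum_le_tsum fun n => (hprop (e n) (P n) (hPO n) (hPm n)).2⟩
  have lim : ∀ (X : ℝ≥0∞) (g : ℝ≥0 → ℝ≥0), Continuous g → g 0 = 1 →
      Tendsto (fun r : ℝ≥0 => (g r : ℝ≥0∞) * X) (𝓝[>] 0) (𝓝 X) := by
    intro X g hg h0
    have h1 : Tendsto (fun r : ℝ≥0 => (g r : ℝ≥0∞)) (𝓝[>] 0) (𝓝 1) := by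
      have := (ENNReal.continuous_coe.comp hg).tendsto 0
      simp only [Function.comp, h0, ENNReal.coe_one] at this
      exact this.mono_left nhdsWithin_le_nhds
    simpa using ENNReal.Tendsto.mul_const h1 (Or.inl one_ne_zero)
  have ev : ∀ᶠ r : ℝ≥0 in 𝓝[>] 0, 0 < r ∧ r < 1 := by
    apply Filter.Eventually.and self_mem_nhdsWithin
    exact nhdsWithin_le_nhds (Iio_mem_nhds one_pos)
  have : (𝓝[>] (0 : ℝ≥0)).NeBot := inferInstance
  have c1 : Continuous fun r : ℝ≥0 => 1 + r := by fun_prop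
  have c2 : Continuous fun r : ℝ≥0 => 1 - r := by fun_prop
  apply le_antisymm
  · apply le_of_tendsto_of_tendsto (lim _ (fun r => 1 - r) c2 (by simp))
      (lim _ (fun r => (1 + r) ^ d) (c1.pow d) (by simp))
    filter_upwards [ev] with r hr
    have := (bounds r hr.1 hr.2).2
    rw [ENNReal.coe_pow]
    exact this
  · apply le_of_tendsto_of_tendsto (lim _ (fun r => (1 - r) ^ d) (c2.pow d) (by simp))
      (lim _ (fun r => (1 + r)) c1 (by simp))
    filter_upwards [ev] with r hr
    have := (bounds r hr.1 hr.2).1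
    rw [ENNReal.coe_pow]
    exact this

end AreaFormula

/-! ### Area of graphs of radial functions -/

section RadialGraphArea

open Set Filter Topology
open scoped ENNReal NNReal MeasureTheory

/-- The graph embedding of the plane into space over the height function `u`. -/
noncomputable def graphMap (u : EuclideanSpace ℝ (Fin 2) → ℝ) (y : EuclideanSpace ℝ (Fin 2)) : E3 :=
  !₂[y 0, y 1, u y]

/-- The linear graph embedding of the plane, as a continuous linear map. -/
noncomputable def graphCLM (L : EuclideanSpace ℝ (Fin 2) →L[ℝ] ℝ) :
    EuclideanSpace ℝ (Fin 2) →L[ℝ] E3 :=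
  (PiLp.continuousLinearEquiv 2 ℝ (fun _ : Fin 3 => ℝ)).symm.toContinuousLinearMap ∘L
    ContinuousLinearMap.pi ![EuclideanSpace.proj 0, EuclideanSpace.proj 1, L]

theorem graphCLM_apply (L : EuclideanSpace ℝ (Fin 2) →L[ℝ] ℝ) (v : EuclideanSpace ℝ (Fin 2)) :
    graphCLM L v = !₂[v 0, v 1, L v] := by
  ext i
  fin_cases i <;> simp [graphCLM]

theorem hasFDerivAt_graphMap {u : EuclideanSpace ℝ (Fin 2) → ℝ}
    {L : EuclideanSpace ℝ (Fin 2) →L[ℝ] ℝ} {y : EuclideanSpace ℝ (Fin 2)}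
    (h : HasFDerivAt u L y) : HasFDerivAt (graphMap u) (graphCLM L) y := by
  rw [← hasFDerivWithinAt_univ, hasFDerivWithinAt_euclidean]
  intro i
  rw [hasFDerivWithinAt_univ]
  fin_cases i
  · refine ((EuclideanSpace.proj 0 : EuclideanSpace ℝ (Fin 2) →L[ℝ] ℝ).hasFDerivAt).congr_fderiv ?_
    ext v; simp [graphCLM_apply]
  · refine ((EuclideanSpace.proj 1 : EuclideanSpace ℝ (Fin 2) →L[ℝ] ℝ).hasFDerivAt).congr_fderiv ?_
    ext v; simp [graphCLM_apply]
  · refine h.congr_fderiv ?_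
    ext v; simp [graphCLM_apply]

theorem continuous_graphCLM : Continuous graphCLM := by
  rw [continuous_clm_apply]
  intro v
  simp only [graphCLM_apply]
  apply (PiLp.continuous_toLp 2 _).comp
  rw [continuous_pi_iff]
  intro i
  fin_cases i
  · exact continuous_const
  · exact continuous_const
  · exact continuous_eval_const v

theorem norm_le_norm_graphCLM (L : EuclideanSpace ℝ (Fin 2) →L[ℝ] ℝ)
    (v : EuclideanSpace ℝ (Fin 2)) : ‖v‖ ≤ ‖graphCLM L v‖ := by
  rw [EuclideanSpace.norm_eq, EuclideanSpace.norm_eq]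
  apply Real.sqrt_le_sqrt
  simp only [graphCLM_apply, Fin.sum_univ_two, Fin.sum_univ_three]
  simp
  positivity

theorem normDet_graphCLM (L : EuclideanSpace ℝ (Fin 2) →L[ℝ] ℝ) :
    (graphCLM L : EuclideanSpace ℝ (Fin 2) →ₗ[ℝ] E3).normDet =
      √(1 + L (EuclideanSpace.single 0 1) ^ 2 + L (EuclideanSpace.single 1 1) ^ 2) := by
  have h := LinearMap.normDet_sq_eq_det_gram
    (graphCLM L : EuclideanSpace ℝ (Fin 2) →ₗ[ℝ] E3) (EuclideanSpace.basisFun (Fin 2) ℝ)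
  rw [eq_comm, Real.sqrt_eq_iff_eq_sq (by positivity) (LinearMap.normDet_nonneg _)]
  rw [Matrix.det_fin_two] at h
  simp only [Matrix.gram_apply, EuclideanSpace.basisFun_apply, ContinuousLinearMap.coe_coe,
    graphCLM_apply, PiLp.inner_apply, Fin.sum_univ_three] at h
  simp at h
  rw [h]; ring

/-- A disc of squared radius `t` has area `π * t`, so planar area is `π ds` in the variable `s = ‖y‖
^ 2`. This is why all profiles are functions of the squared radius. -/
theorem map_norm_sq_volume :
    Measure.map (fun y : EuclideanSpace ℝ (Fin 2) => ‖y‖ ^ 2) volume =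
      ENNReal.ofReal Real.pi • volume.restrict (Ioi 0) := by
  have hm : Measurable (fun y : EuclideanSpace ℝ (Fin 2) => ‖y‖ ^ 2) := by fun_prop
  have vol : ∀ t : ℝ, volume ((fun y : EuclideanSpace ℝ (Fin 2) => ‖y‖ ^ 2) ⁻¹' Iic t) =
      ENNReal.ofReal (Real.pi * max t 0) := by
    intro t
    rcases lt_or_ge t 0 with ht | ht
    · have : (fun y : EuclideanSpace ℝ (Fin 2) => ‖y‖ ^ 2) ⁻¹' Iic t = ∅ := by
        ext y; simp only [mem_preimage, mem_Iic, mem_empty_iff_false, iff_false, not_le]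
        exact ht.trans_le (by positivity)
      rw [this, max_eq_right ht.le]; simp
    · have : (fun y : EuclideanSpace ℝ (Fin 2) => ‖y‖ ^ 2) ⁻¹' Iic t = closedBall 0 (√t) := by
        ext y; simp only [mem_preimage, mem_Iic, mem_closedBall, dist_zero_right]
        exact (Real.le_sqrt (norm_nonneg _) ht).symm
      rw [this, EuclideanSpace.volume_closedBall_fin_two, max_eq_left ht,
        ← ENNReal.ofReal_pow (Real.sqrt_nonneg _), Real.sq_sqrt ht, mul_comm Real.pi,
        ENNReal.ofReal_mul ht, ← NNReal.coe_real_pi, ENNReal.ofReal_coe_nnreal]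
  have key : ∀ a b : ℝ, a < b → Measure.map (fun y : EuclideanSpace ℝ (Fin 2) => ‖y‖ ^ 2) volume
      (Ioc a b) = (ENNReal.ofReal Real.pi • volume.restrict (Ioi (0 : ℝ))) (Ioc a b) := by
    intro a b hab
    rw [Measure.map_apply hm measurableSet_Ioc, show Ioc a b = Iic b \ Iic a by ext; simp [and_comm], preimage_sdiff, measure_sdiff
      (preimage_mono (Iic_subset_Iic.2 hab.le)) (hm measurableSet_Iic).nullMeasurableSet
      (by rw [vol]; exact ENNReal.ofReal_ne_top), vol, vol, Measure.smul_apply,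
      Measure.restrict_apply (measurableSet_Iic.diff measurableSet_Iic), show Iic b \ Iic a = Ioc a b by ext; simp [and_comm], Ioc_inter_Ioi, Real.volume_Ioc,
      smul_eq_mul, ← ENNReal.ofReal_sub _ (by positivity), ← ENNReal.ofReal_mul Real.pi_pos.le,
      ← mul_sub]
    rcases le_total b 0 with hb | hb
    · rw [max_eq_right hb, max_eq_right (hab.le.trans hb)]
      symm
      rw [ENNReal.ofReal_of_nonpos, sub_self, mul_zero, ENNReal.ofReal_zero]
      exact mul_nonpos_of_nonneg_of_nonpos Real.pi_pos.le
        (sub_nonpos.2 hb)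
    · rw [max_eq_left hb]
  apply Measure.ext_of_Ioc' _ _ _ key
  intro a b hab
  rw [key a b hab, Measure.smul_apply]
  apply ENNReal.mul_ne_top ENNReal.ofReal_ne_top
  exact (lt_of_le_of_lt (Measure.restrict_apply_le _ _) (by simp)).ne

/-- The gradient of `g (‖y‖ ^ 2)` has squared length `4 * s * g' s ^ 2`. Differentiability is asked
only on the open interval, so profiles that become vertical at an end are covered. -/
theorem area_radial_graph {g g' : ℝ → ℝ} {a b : ℝ} (ha : 0 ≤ a)
    (hg : ∀ s ∈ Ioo a b, HasDerivAt g (g' s) s) (hg' : ContinuousOn g' (Ioo a b)) :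
    (μHE[2] : Measure E3) (graphMap (fun y => g (‖y‖ ^ 2)) '' {y | ‖y‖ ^ 2 ∈ Ioo a b}) =
      ENNReal.ofReal Real.pi * ∫⁻ s in Ioo a b, ENNReal.ofReal √(1 + 4 * s * g' s ^ 2) := by
  have hm : Measurable (fun y : EuclideanSpace ℝ (Fin 2) => ‖y‖ ^ 2) := by fun_prop
  have hc : Continuous (fun y : EuclideanSpace ℝ (Fin 2) => ‖y‖ ^ 2) := by fun_prop
  set U : Set (EuclideanSpace ℝ (Fin 2)) := {y | ‖y‖ ^ 2 ∈ Ioo a b} with hUdef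
  have hU : IsOpen U := isOpen_Ioo.preimage hc
  let L : EuclideanSpace ℝ (Fin 2) → EuclideanSpace ℝ (Fin 2) →L[ℝ] ℝ :=
    fun y => g' (‖y‖ ^ 2) • (2 • innerSL ℝ y)
  have hL : ∀ y ∈ U, HasFDerivAt (fun y => g (‖y‖ ^ 2)) (L y) y := by
    intro y hy
    exact (hg _ hy).comp_hasFDerivAt y (hasStrictFDerivAt_norm_sq y).hasFDerivAt
  have hg'c : ContinuousOn (fun y : EuclideanSpace ℝ (Fin 2) => g' (‖y‖ ^ 2)) U :=
    hg'.comp hc.continuousOn fun y hy => hy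
  have hLc : ContinuousOn L U := by
    apply hg'c.smul
    exact ((innerSL ℝ).continuous.const_smul 2).continuousOn
  have hJ : ∀ y ∈ U, (graphCLM (L y) : EuclideanSpace ℝ (Fin 2) →ₗ[ℝ] E3).normDet =
      √(1 + 4 * ‖y‖ ^ 2 * g' (‖y‖ ^ 2) ^ 2) := by
    intro y _
    rw [normDet_graphCLM]
    congr 1
    simp only [L, EuclideanSpace.norm_sq_eq, Fin.sum_univ_two]
    simp [EuclideanSpace.inner_single_right]
    ring
  have hfin : Module.finrank ℝ (EuclideanSpace ℝ (Fin 2)) = 2 := by simp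
  have main := euclideanHausdorffMeasure_image_eq_lintegral (V := EuclideanSpace ℝ (Fin 2))
    (W := E3) (f := graphMap (fun y => g (‖y‖ ^ 2))) (f' := fun y => graphCLM (L y))
    (J := fun y => √(1 + 4 * ‖y‖ ^ 2 * g' (‖y‖ ^ 2) ^ 2)) hU
    (fun y hy => hasFDerivAt_graphMap (hL y hy)) (continuous_graphCLM.comp_continuousOn hLc)
    (fun y _ v => norm_le_norm_graphCLM _ v)
    (by
      apply Real.continuous_sqrt.comp_continuousOn
      exact (continuousOn_const.add ((continuousOn_const.mul hc.continuousOn).mul (hg'c.pow 2))))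
    hJ (fun y _ => by positivity)
    (by
      intro y _ z _ hyz
      ext i
      fin_cases i
      · simpa [graphMap] using congrArg (fun p : E3 => p 0) hyz
      · simpa [graphMap] using congrArg (fun p : E3 => p 1) hyz) subset_rfl hU.measurableSet
  rw [hfin] at main
  rw [main]
  have hpre : U = (fun y : EuclideanSpace ℝ (Fin 2) => ‖y‖ ^ 2) ⁻¹' Ioo a b := rfl
  have hmeas : Measurable ((Ioo a b).indicator fun s => ENNReal.ofReal √(1 + 4 * s * g' s ^ 2)) := by
    have hcont : ContinuousOn (fun s => ENNReal.ofReal √(1 + 4 * s * g' s ^ 2)) (Ioo a b) := by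
      apply ENNReal.continuous_ofReal.comp_continuousOn
      apply Real.continuous_sqrt.comp_continuousOn
      exact continuousOn_const.add ((continuousOn_const.mul continuousOn_id).mul (hg'.pow 2))
    rw [← piecewise_eq_indicator]
    exact hcont.measurable_piecewise continuousOn_const measurableSet_Ioo
  calc ∫⁻ y in U, ENNReal.ofReal √(1 + 4 * ‖y‖ ^ 2 * g' (‖y‖ ^ 2) ^ 2)
      = ∫⁻ y, (Ioo a b).indicator (fun s => ENNReal.ofReal √(1 + 4 * s * g' s ^ 2)) (‖y‖ ^ 2) := by
        rw [← lintegral_indicator hU.measurableSet]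
        rfl
    _ = ∫⁻ s, (Ioo a b).indicator (fun s => ENNReal.ofReal √(1 + 4 * s * g' s ^ 2)) s
          ∂(Measure.map (fun y : EuclideanSpace ℝ (Fin 2) => ‖y‖ ^ 2) volume) :=
        (lintegral_map hmeas hm).symm
    _ = _ := by
        rw [map_norm_sq_volume, lintegral_smul_measure, smul_eq_mul,
          lintegral_indicator measurableSet_Ioo, Measure.restrict_restrict measurableSet_Ioo]
        congr 3
        apply inter_eq_left.2
        exact fun s hs => ha.trans_lt hs.1

/-- Nonnegativity makes a possibly unbounded derivative integrable, as is needed where a profile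
becomes vertical. -/
theorem lintegral_ofReal_deriv_eq_sub {Q q : ℝ → ℝ} {a b : ℝ} (hab : a ≤ b)
    (hc : ContinuousOn Q (Icc a b)) (hQ : ∀ s ∈ Ioo a b, HasDerivAt Q (q s) s)
    (hq : ∀ s ∈ Ioo a b, 0 ≤ q s) :
    ∫⁻ s in Ioo a b, ENNReal.ofReal (q s) = ENNReal.ofReal (Q b - Q a) := by
  have hint := intervalIntegral.integrableOn_deriv_of_nonneg hc hQ hq
  have h1 := intervalIntegral.integral_eq_sub_of_hasDerivAt_of_le hab hc hQ
    ((intervalIntegrable_iff_integrableOn_Ioc_of_le hab).2 hint)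
  rw [intervalIntegral.integral_of_le hab, integral_Ioc_eq_integral_Ioo] at h1
  rw [← h1, ofReal_integral_eq_lintegral_ofReal (hint.mono_set Ioo_subset_Ioc_self)]
  exact (ae_restrict_mem measurableSet_Ioo).mono hq

/-- The graph over an annulus of a branch of the sphere of radius `R`. -/
theorem area_sphere_zone {g : ℝ → ℝ} {R h τ a : ℝ} (hR : 0 < R) (ha : 0 ≤ a) (haR : a ≤ R ^ 2)
    (hτ : τ ^ 2 = 1) (hg : ∀ s ∈ Ioo a (R ^ 2), g s = h + τ * √(R ^ 2 - s)) :
    (μHE[2] : Measure E3) (graphMap (fun y => g (‖y‖ ^ 2)) '' {y | ‖y‖ ^ 2 ∈ Ioo a (R ^ 2)}) =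
      ENNReal.ofReal (2 * Real.pi * R * √(R ^ 2 - a)) := by
  have hd : ∀ s ∈ Ioo a (R ^ 2), HasDerivAt (fun s => √(R ^ 2 - s)) (-1 / (2 * √(R ^ 2 - s))) s := by
    intro s hs
    have h1 : R ^ 2 - s ≠ 0 := (sub_pos.2 hs.2).ne'
    exact (((hasDerivAt_id s).const_sub (R ^ 2))).sqrt h1
  have hgd : ∀ s ∈ Ioo a (R ^ 2), HasDerivAt g (τ * (-1 / (2 * √(R ^ 2 - s)))) s := by
    intro s hs
    have h1 := ((hd s hs).const_mul τ).const_add h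
    apply h1.congr_of_eventuallyEq
    filter_upwards [isOpen_Ioo.mem_nhds hs] with t ht using hg t ht
  have hc : ContinuousOn (fun s => √(R ^ 2 - s)) (Ioo a (R ^ 2)) := by fun_prop
  rw [area_radial_graph ha hgd]
  -- The integrand is `R / √(R ^ 2 - s)`, with antiderivative `-2 * R * √(R ^ 2 - s)`: this is
  -- Archimedes' formula for spherical zones.
  · have e : ∀ s ∈ Ioo a (R ^ 2), √(1 + 4 * s * (τ * (-1 / (2 * √(R ^ 2 - s)))) ^ 2) =
        (-2 * R) * (-1 / (2 * √(R ^ 2 - s))) := by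
      intro s hs
      have h1 : 0 < R ^ 2 - s := sub_pos.2 hs.2
      have h2 := Real.sqrt_pos.2 h1
      have h3 := Real.sq_sqrt h1.le
      rw [Real.sqrt_eq_iff_eq_sq]
      · have : (τ * (-1 / (2 * √(R ^ 2 - s)))) ^ 2 = 1 / (4 * (R ^ 2 - s)) := by
          rw [mul_pow, hτ, div_pow, mul_pow, h3]; ring
        rw [this]
        have h4 : (-2 * R * (-1 / (2 * √(R ^ 2 - s)))) ^ 2 = R ^ 2 / (R ^ 2 - s) := by
          rw [mul_pow, div_pow, mul_pow, mul_pow, h3]; field_simp; try ring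
        rw [h4]; field_simp; ring
      · have := (ha.trans_lt hs.1)
        positivity
      · have : (-2 * R) * (-1 / (2 * √(R ^ 2 - s))) = R / √(R ^ 2 - s) := by field_simp
        rw [this]; positivity
    rw [setLIntegral_congr_fun measurableSet_Ioo (fun s hs => by rw [e s hs]),
      lintegral_ofReal_deriv_eq_sub haR (Q := fun s => (-2 * R) * √(R ^ 2 - s)) (by fun_prop)
        (fun s hs => (hd s hs).const_mul (-2 * R)) (fun s hs => by
          rw [← e s hs]; positivity), ← ENNReal.ofReal_mul Real.pi_pos.le]
    congr 1
    simp
    ring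
  · apply ContinuousOn.mul continuousOn_const
    apply ContinuousOn.div continuousOn_const (continuousOn_const.mul hc)
    intro s hs
    have := Real.sqrt_pos.2 (sub_pos.2 hs.2)
    exact (mul_pos two_pos this).ne'

theorem area_radial_graph_le {g g' : ℝ → ℝ} {a b : ℝ} (ha : 0 ≤ a) (hab : a ≤ b)
    (hg : ∀ s ∈ Ioo a b, HasDerivAt g (g' s) s) (hg' : ContinuousOn g' (Ioo a b))
    {Q q : ℝ → ℝ} (hc : ContinuousOn Q (Icc a b)) (hQ : ∀ s ∈ Ioo a b, HasDerivAt Q (q s) s)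
    (hq : ∀ s ∈ Ioo a b, √(1 + 4 * s * g' s ^ 2) ≤ q s) :
    (μHE[2] : Measure E3) (graphMap (fun y => g (‖y‖ ^ 2)) '' {y | ‖y‖ ^ 2 ∈ Ioo a b}) ≤
      ENNReal.ofReal (Real.pi * (Q b - Q a)) := by
  rw [area_radial_graph ha hg hg', ENNReal.ofReal_mul Real.pi_pos.le]
  gcongr
  rw [← lintegral_ofReal_deriv_eq_sub hab hc hQ fun s hs => (Real.sqrt_nonneg _).trans (hq s hs)]
  exact setLIntegral_mono' measurableSet_Ioo fun s hs => ENNReal.ofReal_le_ofReal (hq s hs)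

end RadialGraphArea

/-! ### Sublevel sets: local graphs, normals and mean curvature -/

section BoundaryRegularity

open Set Filter Topology
open scoped NNReal

/-- `ℝ² × ℝ → ℝ³`, appending a last coordinate. -/
noncomputable def appendCoord : EuclideanSpace ℝ (Fin 2) × ℝ →L[ℝ] E3 :=
  (PiLp.continuousLinearEquiv 2 ℝ (fun _ : Fin 3 => ℝ)).symm.toContinuousLinearMap ∘L
    ContinuousLinearMap.pi ![EuclideanSpace.proj 0 ∘L ContinuousLinearMap.fst ℝ _ ℝ,
      EuclideanSpace.proj 1 ∘L ContinuousLinearMap.fst ℝ _ ℝ,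
      ContinuousLinearMap.snd ℝ (EuclideanSpace ℝ (Fin 2)) ℝ]

theorem appendCoord_apply (v : EuclideanSpace ℝ (Fin 2) × ℝ) :
    appendCoord v = !₂[v.1 0, v.1 1, v.2] := by
  ext i
  fin_cases i <;> simp [appendCoord]

/-- The implicit function theorem gives the zero set as a graph. The sign on either side follows
because `Φ` is strictly increasing in the last variable near the origin. -/
theorem exists_implicit_graph {Φ : EuclideanSpace ℝ (Fin 2) × ℝ → ℝ} (hΦ : ContDiffAt ℝ 2 Φ (0, 0))
    (h0 : Φ (0, 0) = 0) (hpos : 0 < fderiv ℝ Φ (0, 0) (0, 1)) :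
    ∃ u : EuclideanSpace ℝ (Fin 2) → ℝ, ContDiffAt ℝ 2 u 0 ∧
      ∀ᶠ v : EuclideanSpace ℝ (Fin 2) × ℝ in 𝓝 (0, 0), Φ v < 0 ↔ v.2 < u v.1 := by
  have if₂ : (fderiv ℝ Φ (0, 0) ∘L .inr ℝ (EuclideanSpace ℝ (Fin 2)) ℝ).IsInvertible := by
    set k := fderiv ℝ Φ (0, 0) (0, 1) with hk
    refine ContinuousLinearMap.IsInvertible.of_inverse (g := k⁻¹ • ContinuousLinearMap.id ℝ ℝ) ?_ ?_
    · ext; simp [← hk, hpos.ne']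
    · ext; simp [← hk, hpos.ne']
  let u := hΦ.implicitFunction two_ne_zero if₂
  have hu : ContDiffAt ℝ 2 u 0 := hΦ.contDiffAt_implicitFunction two_ne_zero if₂
  have hu0 : u 0 = 0 := hΦ.implicitFunction_apply_self two_ne_zero if₂
  have hzero : ∀ᶠ y in 𝓝 (0 : EuclideanSpace ℝ (Fin 2)), Φ (y, u y) = 0 := by
    have := hΦ.eventually_apply_implicitFunction two_ne_zero if₂
    simpa [h0] using this
  refine ⟨u, hu, ?_⟩
  have e1 : ∀ᶠ v in 𝓝 ((0, 0) : EuclideanSpace ℝ (Fin 2) × ℝ), DifferentiableAt ℝ Φ v := by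
    filter_upwards [hΦ.eventually (by simp)] with v hv using hv.differentiableAt two_ne_zero
  have e2 : ∀ᶠ v in 𝓝 ((0, 0) : EuclideanSpace ℝ (Fin 2) × ℝ), 0 < fderiv ℝ Φ v (0, 1) := by
    have hc : ContinuousAt (fun v => fderiv ℝ Φ v (0, 1)) ((0, 0) : EuclideanSpace ℝ (Fin 2) × ℝ) :=
      ((hΦ.fderiv_right (m := 1) (by norm_num)).continuousAt).clm_apply continuousAt_const
    exact hc.eventually (lt_mem_nhds hpos)
  obtain ⟨η, hη, hball⟩ := Metric.eventually_nhds_iff_ball.1 (e1.and e2)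
  rw [← ball_prod_same] at hball
  have hmono : ∀ y ∈ ball (0 : EuclideanSpace ℝ (Fin 2)) η,
      StrictMonoOn (fun t => Φ (y, t)) (ball (0 : ℝ) η) := by
    intro y hy
    have hd : ∀ t ∈ ball (0 : ℝ) η, HasDerivAt (fun t => Φ (y, t)) (fderiv ℝ Φ (y, t) (0, 1)) t := by
      intro t ht
      have h1 := (hball (y, t) ⟨hy, ht⟩).1.hasFDerivAt
      have h2 : HasDerivAt (fun t : ℝ => (y, t)) ((0 : EuclideanSpace ℝ (Fin 2)), (1 : ℝ)) t :=
        (hasDerivAt_const t y).prodMk (hasDerivAt_id t)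
      exact h1.comp_hasDerivAt t h2
    apply strictMonoOn_of_deriv_pos (convex_ball 0 η)
    · exact fun t ht => (hd t ht).continuousAt.continuousWithinAt
    · intro t ht
      rw [isOpen_ball.interior_eq] at ht
      rw [(hd t ht).deriv]
      exact (hball (y, t) ⟨hy, ht⟩).2
  have e3 : ∀ᶠ y in 𝓝 (0 : EuclideanSpace ℝ (Fin 2)),
      Φ (y, u y) = 0 ∧ y ∈ ball 0 η ∧ u y ∈ ball (0 : ℝ) η := by
    have h1 : ∀ᶠ y in 𝓝 (0 : EuclideanSpace ℝ (Fin 2)), y ∈ ball 0 η := ball_mem_nhds _ hη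
    have h2 : ∀ᶠ y in 𝓝 (0 : EuclideanSpace ℝ (Fin 2)), u y ∈ ball (0 : ℝ) η := by
      apply hu.continuousAt.eventually
      rw [hu0]
      exact ball_mem_nhds _ hη
    exact hzero.and (h1.and h2)
  have e4 : ∀ᶠ v in 𝓝 ((0, 0) : EuclideanSpace ℝ (Fin 2) × ℝ),
      (Φ (v.1, u v.1) = 0 ∧ v.1 ∈ ball 0 η ∧ u v.1 ∈ ball (0 : ℝ) η) ∧ v.2 ∈ ball (0 : ℝ) η :=
    (continuous_fst.tendsto' _ _ rfl |>.eventually e3).and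
      (continuous_snd.tendsto' ((0, 0) : EuclideanSpace ℝ (Fin 2) × ℝ) (0 : ℝ) rfl |>.eventually
        (ball_mem_nhds _ hη))
  filter_upwards [e4] with v hv
  obtain ⟨⟨hz, hy, hu'⟩, ht⟩ := hv
  have := (hmono v.1 hy).lt_iff_lt ht hu'
  simp only [hz] at this
  exact this

/-- A domain that is locally a regular sublevel set of a `C²` function is locally, after a rigid
motion, the subgraph of a function with Lipschitz derivative. -/
theorem exists_subgraph_chart {Ω : Set E3} {p : E3} {F : E3 → ℝ} (hF : ContDiffAt ℝ 2 F p)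
    (h0 : F p = 0) {k : ℝ} {n : E3} (hk : 0 < k) (hn : ‖n‖ = 1)
    (hd : HasFDerivAt F (k • innerSL ℝ n) p) (hΩ : ∀ᶠ x in 𝓝 p, x ∈ Ω ↔ F x < 0) :
    ∃ (e : E3 ≃ᵃⁱ[ℝ] E3) (r : ℝ) (u : EuclideanSpace ℝ (Fin 2) → ℝ),
    0 < r ∧ e p = 0 ∧
    ContDiffOn ℝ 1 u (ball 0 r) ∧
    (∃ K : NNReal, LipschitzOnWith K (fderiv ℝ u) (ball 0 r)) ∧
    ∀ x ∈ ball p r, x ∈ Ω ↔ e x 2 < u !₂[e x 0, e x 1] := by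
  let w : E3 := EuclideanSpace.single 2 1
  -- A reflection that exchanges the normal with the vertical unit vector; it is the linear part of
  -- the rigid motion.
  let T : E3 ≃ₗᵢ[ℝ] E3 := (ℝ ∙ (n - w))ᗮ.reflection
  have hT : T n = w := Submodule.reflection_sub (by simp [hn, w])
  let e : E3 ≃ᵃⁱ[ℝ] E3 := (AffineIsometryEquiv.vaddConst ℝ p).symm.trans T.toAffineIsometryEquiv
  have he : ∀ x, e x = T (x - p) := fun x => by simp [e]
  let ψ : EuclideanSpace ℝ (Fin 2) × ℝ → E3 := fun v => p + T.symm (appendCoord v)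
  have hψ0 : ψ (0, 0) = p := by
    have : ((0, 0) : EuclideanSpace ℝ (Fin 2) × ℝ) = 0 := rfl
    simp [ψ, this]
  have hψd : ∀ v, HasFDerivAt ψ ((T.symm.toContinuousLinearEquiv : E3 →L[ℝ] E3) ∘L appendCoord) v := by
    intro v
    have := ((T.symm.toContinuousLinearEquiv : E3 →L[ℝ] E3) ∘L appendCoord).hasFDerivAt (x := v)
    exact this.const_add p
  have hψc : ContDiff ℝ 2 ψ := by
    have := ((T.symm.toContinuousLinearEquiv : E3 →L[ℝ] E3) ∘L appendCoord).contDiff (n := 2)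
    exact contDiff_const.add this
  have hΦ : ContDiffAt ℝ 2 (F ∘ ψ) (0, 0) := by
    apply ContDiffAt.comp _ _ hψc.contDiffAt
    rwa [hψ0]
  have hΦd : fderiv ℝ (F ∘ ψ) (0, 0) (0, 1) = k := by
    have h1 : HasFDerivAt F (k • innerSL ℝ n) (ψ (0, 0)) := by rwa [hψ0]
    rw [(h1.comp (0, 0) (hψd (0, 0))).fderiv]
    have h2 : appendCoord (0, 1) = w := by
      rw [appendCoord_apply]; ext i; fin_cases i <;> simp [w]
    have h3 : T.symm w = n := by rw [← hT, T.symm_apply_apply]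
    simp [h2, h3, hn]
  obtain ⟨u, hu, hloc⟩ := exists_implicit_graph hΦ (by simp [hψ0, h0]) (by rw [hΦd]; exact hk)
  have hcoord : ∀ x, ψ (!₂[e x 0, e x 1], e x 2) = x := by
    intro x
    have : appendCoord (!₂[e x 0, e x 1], e x 2) = e x := by
      rw [appendCoord_apply]; ext i; fin_cases i <;> simp
    simp only [ψ, this]
    rw [he, T.symm_apply_apply, add_sub_cancel]
  have htend : Tendsto (fun x => ((!₂[e x 0, e x 1] : EuclideanSpace ℝ (Fin 2)), e x 2)) (𝓝 p)
      (𝓝 (0, 0)) := by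
    have hc : Continuous (fun x => ((!₂[e x 0, e x 1] : EuclideanSpace ℝ (Fin 2)), e x 2)) := by
      have := e.continuous
      fun_prop
    convert hc.tendsto p using 2
    have : e p = 0 := by simp [he]
    ext i
    · fin_cases i <;> simp [this]
    · simp [this]
  have e1 : ∀ᶠ x in 𝓝 p, x ∈ Ω ↔ e x 2 < u !₂[e x 0, e x 1] := by
    filter_upwards [htend.eventually hloc, hΩ] with x hx hx'
    rw [hx', ← hx, Function.comp, hcoord]
  obtain ⟨r₁, hr₁, hb₁⟩ := Metric.eventually_nhds_iff_ball.1 e1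
  have e2 : ∀ᶠ y in 𝓝 (0 : EuclideanSpace ℝ (Fin 2)), ContDiffAt ℝ 1 u y := by
    filter_upwards [hu.eventually (by simp)] with y hy using hy.of_le (by norm_num)
  obtain ⟨r₂, hr₂, hb₂⟩ := Metric.eventually_nhds_iff_ball.1 e2
  -- The derivative of the `C²` function `u` is `C¹`, hence Lipschitz near the origin.
  obtain ⟨K, t, ht, hK⟩ := (hu.fderiv_right (m := 1) (by norm_num)).exists_lipschitzOnWith
  obtain ⟨r₃, hr₃, hb₃⟩ := Metric.mem_nhds_iff.1 ht
  refine ⟨e, min r₁ (min r₂ r₃), u, by positivity, by simp [he], ?_, ⟨K, ?_⟩, ?_⟩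
  · exact fun y hy => (hb₂ y (ball_subset_ball
      ((min_le_right _ _).trans (min_le_left _ _)) hy)).contDiffWithinAt
  · exact hK.mono ((ball_subset_ball
      ((min_le_right _ _).trans (min_le_right _ _))).trans hb₃)
  · exact fun x hx => hb₁ x (ball_subset_ball (min_le_left _ _) hx)

/-- To first order `F x` is `k * ⟪n, x - p⟫`, so inside each of the two cones the inner product
determines the sign of `F`. Where `F` is positive, continuity keeps the point out of the closure. -/
theorem isOuterUnitNormal_of_sublevel {Ω : Set E3} {p : E3} {F : E3 → ℝ}
    (hF : ∀ᶠ x in 𝓝 p, ContinuousAt F x)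
    (h0 : F p = 0) {k : ℝ} {n : E3} (hk : 0 < k) (hn : ‖n‖ = 1)
    (hd : HasFDerivAt F (k • innerSL ℝ n) p) (hΩ : ∀ᶠ x in 𝓝 p, x ∈ Ω ↔ F x < 0) :
    IsOuterUnitNormal Ω p n := by
  refine ⟨hn, fun δ hδ => ?_⟩
  have h1 := hd.isLittleO.def (show 0 < k * δ by positivity)
  filter_upwards [h1, hΩ, hF, eventually_eventually_nhds.2 hΩ] with x hx hxΩ hxc hxΩ'
  rw [h0, sub_zero] at hx
  simp only [smul_apply, innerSL_apply_apply, smul_eq_mul, Real.norm_eq_abs]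
    at hx
  rw [abs_le] at hx
  rw [real_inner_comm]
  constructor
  · intro h
    rw [hxΩ]
    nlinarith
  · intro h hcl
    have hpos : 0 < F x := by nlinarith
    obtain ⟨y, ⟨hy1, hy2⟩, hy3⟩ := mem_closure_iff_nhds.1 hcl _
      (inter_mem (hxc.eventually (lt_mem_nhds hpos)) hxΩ')
    have : F y < 0 := (show y ∈ Ω ↔ F y < 0 from hy2).1 hy3
    exact lt_asymm this hy1

theorem eq_zero_of_mem_frontier_of_sublevel {Ω : Set E3} {p : E3} {F : E3 → ℝ}
    (hF : ContinuousAt F p) (hp : p ∈ frontier Ω) (hΩ : ∀ᶠ x in 𝓝 p, x ∈ Ω ↔ F x < 0) :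
    F p = 0 := by
  by_contra hne
  rcases lt_or_gt_of_ne hne with h | h
  · apply hp.2
    rw [mem_interior_iff_mem_nhds]
    filter_upwards [hΩ, hF.eventually (gt_mem_nhds h)] with x hx hx' using hx.2 hx'
  · obtain ⟨y, ⟨hy1, hy2⟩, hy3⟩ := mem_closure_iff_nhds.1 hp.1 _
      (inter_mem (hF.eventually (lt_mem_nhds h)) hΩ)
    have : F y < 0 := (show y ∈ Ω ↔ F y < 0 from hy2).1 hy3
    exact lt_asymm this hy1

theorem IsOuterUnitNormal.mem_closure {Ω : Set E3} {p n : E3} (h : IsOuterUnitNormal Ω p n) :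
    p ∈ closure Ω := by
  obtain ⟨hn, h⟩ := h
  have h1 := h (1 / 2) (by norm_num)
  have h2 : Tendsto (fun t : ℝ => p - t • n) (𝓝[>] 0) (𝓝 p) := by
    have hc : Continuous (fun t : ℝ => p - t • n) := by fun_prop
    have := hc.tendsto 0
    simp only [zero_smul, sub_zero] at this
    exact this.mono_left nhdsWithin_le_nhds
  apply mem_closure_of_tendsto h2
  filter_upwards [h2.eventually h1, self_mem_nhdsWithin] with t ht ht0
  have ht0 : 0 < t := ht0
  apply ht.1
  simp only [sub_sub_cancel_left, norm_neg, norm_smul, hn, Real.norm_eq_abs, abs_of_pos ht0,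
    inner_neg_left, inner_smul_left, real_inner_self_eq_norm_sq]
  simp
  linarith

/-- The definition asks for a normal field on the whole boundary, while explicit formulas for it are
only local. -/
theorem hasMeanCurvatureAt_of_local_normal {Ω : Set E3} {p : E3} {N : E3 → E3} {A : E3 →L[ℝ] E3}
    (hex : ∀ q ∈ frontier Ω, ∃ n, IsOuterUnitNormal Ω q n)
    (hN : ∀ᶠ q in 𝓝 p, q ∈ frontier Ω → IsOuterUnitNormal Ω q (N q)) (hA : HasFDerivAt N A p) :
    HasMeanCurvatureAt Ω
      ((LinearMap.trace ℝ E3 (A : E3 →ₗ[ℝ] E3) - inner ℝ (A (N p)) (N p)) / 2) p := by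
  classical
  -- Preferring `N q` whenever it is an outer normal makes the global field agree with `N` near `p`
  -- without an appeal to uniqueness of the normal. The last default covers `p` itself if it is not
  -- a boundary point.
  let ν : E3 → E3 := fun q => if IsOuterUnitNormal Ω q (N q) then N q else
    if h : q ∈ frontier Ω then (hex q h).choose else N q
  have hν : ∀ q ∈ frontier Ω, IsOuterUnitNormal Ω q (ν q) := by
    intro q hq
    by_cases h : IsOuterUnitNormal Ω q (N q)
    · simp [ν, h]
    · simpa [ν, h, hq] using (hex q hq).choose_spec
  have hνN : ∀ᶠ q in 𝓝 p, q ∈ insert p (frontier Ω) → ν q = N q := by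
    filter_upwards [hN] with q hq hq'
    by_cases h : q ∈ frontier Ω
    · simp [ν, hq h]
    · simp [ν, h]
  refine ⟨ν, A, hν, ?_, ?_⟩
  · have h1 : HasFDerivWithinAt N A (frontier Ω) p := hA.hasFDerivWithinAt
    apply h1.congr_of_eventuallyEq
    · filter_upwards [nhdsWithin_le_nhds hνN, self_mem_nhdsWithin] with q hq hq'
      exact hq (mem_insert_of_mem _ hq')
    · exact hνN.self_of_nhds (mem_insert _ _)
  · rw [hνN.self_of_nhds (mem_insert _ _)]

theorem inner_derivative_unit_field_eq_zero {p : E3} {N : E3 → E3} {A : E3 →L[ℝ] E3}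
    (hN : ∀ᶠ q in 𝓝 p, ‖N q‖ = 1) (hA : HasFDerivAt N A p) (v : E3) : inner ℝ (A v) (N p) = 0 := by
  have h1 := hA.inner ℝ hA
  have h2 : (fun q => inner ℝ (N q) (N q)) =ᶠ[𝓝 p] fun _ => (1 : ℝ) := by
    filter_upwards [hN] with q hq
    rw [real_inner_self_eq_norm_sq, hq]; norm_num
  have h3 := (h1.congr_of_eventuallyEq h2.symm).unique (hasFDerivAt_const (1 : ℝ) p)
  have h4 := congrArg (fun L : E3 →L[ℝ] ℝ => L v) h3
  simp only [ContinuousLinearMap.comp_apply, ContinuousLinearMap.prod_apply,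
    fderivInnerCLM_apply, zero_apply] at h4
  rw [real_inner_comm] at h4
  linarith

theorem trace_eq_sum_coord (A : E3 →ₗ[ℝ] E3) :
    LinearMap.trace ℝ E3 A = A (EuclideanSpace.single 0 1) 0 + A (EuclideanSpace.single 1 1) 1 +
      A (EuclideanSpace.single 2 1) 2 := by
  rw [LinearMap.trace_eq_sum_inner A (EuclideanSpace.basisFun (Fin 3) ℝ), Fin.sum_univ_three]
  simp [EuclideanSpace.basisFun_apply, EuclideanSpace.inner_single_left]

end BoundaryRegularity

/-! ### Open sets with interval fibres -/

section FiberwiseDiffeomorphism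

open Set Filter Topology
open scoped Manifold Pointwise

variable {E : Type} [NormedAddCommGroup E] [NormedSpace ℝ E] [FiniteDimensional ℝ E]

/-- Local constant sections exist because `W` is open; convexity of the fibres lets a partition of
unity glue them. -/
theorem exists_smooth_section {W : Set (E × ℝ)} (hW : IsOpen W)
    (hne : ∀ ξ, ∃ v, (ξ, v) ∈ W) (hconv : ∀ ξ, OrdConnected {v | (ξ, v) ∈ W}) :
    ∃ b : E → ℝ, ContDiff ℝ ∞ b ∧ ∀ ξ, (ξ, b ξ) ∈ W := by
  obtain ⟨g, hg⟩ := exists_contMDiffMap_forall_mem_convex_of_local_const (n := (⊤ : ℕ∞)) 𝓘(ℝ, E)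
    (t := fun ξ => {v : ℝ | (ξ, v) ∈ W}) (fun ξ => (hconv ξ).convex) (fun ξ => by
      obtain ⟨v, hv⟩ := hne ξ
      refine ⟨v, ?_⟩
      have hc : Continuous fun ξ : E => (ξ, v) := by fun_prop
      exact hc.continuousAt.eventually (hW.mem_nhds hv))
  exact ⟨g, g.contMDiff.contDiff, hg⟩

/-- The part of `U` above both `b` and `K` is again open with interval fibres. These are nonempty:
the largest point of the fibre of `K` together with `b ξ` lies in the open set `U`, so points just
above it do too. -/
theorem exists_smooth_section_above {U K : Set (E × ℝ)} (hU : IsOpen U)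
    (hconv : ∀ ξ, OrdConnected {v | (ξ, v) ∈ U}) (hK : IsCompact K) (hKU : K ⊆ U)
    {b : E → ℝ} (hb : Continuous b) (hbU : ∀ ξ, (ξ, b ξ) ∈ U) :
    ∃ b' : E → ℝ, ContDiff ℝ ∞ b' ∧ (∀ ξ, (ξ, b' ξ) ∈ U) ∧ (∀ ξ, b ξ < b' ξ) ∧
      ∀ ξ η, (ξ, η) ∈ K → η < b' ξ := by
  -- The points weakly below `K`; closed, being the sum of a compact set and a closed half-line.
  let C : Set (E × ℝ) := {p | ∃ η, (p.1, η) ∈ K ∧ p.2 ≤ η}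
  have hC : IsClosed C := by
    have h1 : IsClosed (K + ({0} ×ˢ Iic 0 : Set (E × ℝ))) :=
      (isClosed_singleton.prod isClosed_Iic).add_left_of_isCompact hK
    convert h1 using 1
    ext ⟨ξ, v⟩
    constructor
    · rintro ⟨η, hη, hv⟩
      exact ⟨(ξ, η), hη, (0, v - η), ⟨rfl, sub_nonpos.2 hv⟩, by simp⟩
    · rintro ⟨⟨ξ', η⟩, hη, ⟨z, w⟩, ⟨hz, hw⟩, heq⟩
      have hz : z = 0 := hz
      have hw : w ≤ 0 := hw
      simp only [Prod.mk_add_mk, Prod.mk.injEq] at heq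
      refine ⟨η, ?_, ?_⟩
      · simpa [← heq.1, hz] using hη
      · simp only [← heq.2]; linarith
  let W : Set (E × ℝ) := (U ∩ {p | b p.1 < p.2}) ∩ Cᶜ
  have hW : IsOpen W := (hU.inter (isOpen_lt (hb.comp continuous_fst) continuous_snd)).inter
    hC.isOpen_compl
  obtain ⟨b', hb', hbW⟩ := exists_smooth_section hW (fun ξ => by
    have hex : ∃ m, (ξ, m) ∈ U ∧ b ξ ≤ m ∧ ∀ η, (ξ, η) ∈ K → η ≤ m := by
      let S : Set ℝ := {η | (ξ, η) ∈ K}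
      have hSc : IsCompact (insert (b ξ) S) := by
        apply IsCompact.insert
        have : S = Prod.snd '' (K ∩ ({ξ} ×ˢ univ)) := by
          ext η
          constructor
          · intro h; exact ⟨(ξ, η), ⟨h, rfl, trivial⟩, rfl⟩
          · rintro ⟨⟨ξ', η'⟩, ⟨h, h', -⟩, rfl⟩
            have h' : ξ' = ξ := h'
            subst h'; exact h
        rw [this]
        exact (hK.inter_right (isClosed_singleton.prod isClosed_univ)).image continuous_snd
      obtain ⟨m, hm, hmax⟩ := hSc.exists_isGreatest (insert_nonempty _ _)
      refine ⟨m, ?_, hmax (mem_insert _ _), fun η h => hmax (mem_insert_of_mem _ h)⟩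
      rcases hm with rfl | hm
      · exact hbU ξ
      · exact hKU hm
    obtain ⟨m, hmU, hbm, hKm⟩ := hex
    have hc : Continuous fun v : ℝ => (ξ, v) := by fun_prop
    have h1 : ∀ᶠ v in 𝓝[>] m, (ξ, v) ∈ U :=
      nhdsWithin_le_nhds (hc.continuousAt.eventually (hU.mem_nhds hmU))
    obtain ⟨v, hvU, hvm⟩ := (h1.and self_mem_nhdsWithin).exists
    have hvm : m < v := hvm
    refine ⟨v, ⟨hvU, lt_of_le_of_lt hbm hvm⟩, ?_⟩
    rintro ⟨η, hη, hle⟩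
    exact absurd (hKm η hη) (not_le.2 (hvm.trans_le hle)))
    (fun ξ => ⟨fun x hx y hy z hz => ⟨⟨(hconv ξ).out hx.1.1 hy.1.1 hz, lt_of_lt_of_le hx.1.2 hz.1⟩,
      fun ⟨η, hη, hle⟩ => hx.2 ⟨η, hη, hz.1.trans hle⟩⟩⟩)
  exact ⟨b', hb', fun ξ => (hbW ξ).1.1, fun ξ => (hbW ξ).1.2, fun ξ η hη => by
    by_contra h
    exact (hbW ξ).2 ⟨η, hη, not_lt.1 h⟩⟩

theorem exists_compact_exhaustion_of_isOpen {X : Type*} [NormedAddCommGroup X] [NormedSpace ℝ X]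
    [FiniteDimensional ℝ X] {U : Set X} (hU : IsOpen U) :
    ∃ K : ℕ → Set X, (∀ n, IsCompact (K n)) ∧ (∀ n, K n ⊆ U) ∧ Monotone K ∧
      ∀ x ∈ U, ∃ n, K n ∈ 𝓝 x := by
  obtain ⟨f, hfs, hf, hr⟩ := hU.exists_contDiff_support_eq (n := 0)
  have hf0 : ∀ x, 0 ≤ f x := fun x => (hr ⟨x, rfl⟩).1
  refine ⟨fun n => closedBall (0 : X) n ∩ {x | 1 / ((n : ℝ) + 1) ≤ f x}, fun n => ?_, fun n x hx => ?_,
    fun m n hmn x hx => ⟨closedBall_subset_closedBall (by exact_mod_cast hmn) hx.1, ?_⟩,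
    fun x hx => ?_⟩
  · exact (isCompact_closedBall _ _).inter_right (isClosed_le continuous_const hf.continuous)
  · rw [← hfs]
    have h1 : 1 / ((n : ℝ) + 1) ≤ f x := hx.2
    have : 0 < 1 / ((n : ℝ) + 1) := by positivity
    exact (this.trans_le h1).ne'
  · have h1 : (m : ℝ) ≤ n := by exact_mod_cast hmn
    have h2 : 1 / ((n : ℝ) + 1) ≤ 1 / ((m : ℝ) + 1) :=
      one_div_le_one_div_of_le (by positivity) (by linarith)
    exact h2.trans hx.2
  · have hx0 : 0 < f x := lt_of_le_of_ne (hf0 x) (Ne.symm (by rw [← hfs] at hx; exact hx))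
    obtain ⟨n, hn⟩ := exists_nat_one_div_lt hx0
    obtain ⟨m, hm⟩ := exists_nat_gt ‖x‖
    refine ⟨max m n, ?_⟩
    apply inter_mem
    · apply mem_of_superset (ball_mem_nhds x (ε := m - ‖x‖) (by linarith))
      intro y hy
      have h1 : ‖y‖ ≤ ‖x‖ + dist y x := by
        rw [dist_eq_norm]; have := norm_add_le x (y - x); simpa using this
      have h2 : dist y x < m - ‖x‖ := hy
      have h3 : (m : ℝ) ≤ (max m n : ℕ) := by exact_mod_cast le_max_left m n
      simp only [mem_closedBall, dist_zero_right]
      linarith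
    · have h1 : 1 / (((max m n : ℕ) : ℝ) + 1) < f x := lt_of_le_of_lt
        (one_div_le_one_div_of_le (by positivity) (by
          have : (n : ℝ) ≤ (max m n : ℕ) := by exact_mod_cast le_max_right m n
          linarith)) hn
      filter_upwards [hf.continuous.continuousAt.eventually (lt_mem_nhds h1)] with y hy using hy.le

/-- Choose smooth sections `β 0 < β 1 < ...` of `U`, with `β (k + 1)` above the `k`-th compact set
of an exhaustion, and sum smooth steps that rise from 0 to 1 between consecutive sections. Locally
only finitely many steps are nonzero, while at `β N` the first `N` steps are complete, so the sum is
unbounded on each fibre. -/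
theorem exists_smooth_fiberwise_monotone {U : Set (E × ℝ)} (hU : IsOpen U)
    (hne : ∀ ξ, ∃ v, (ξ, v) ∈ U) (hconv : ∀ ξ, OrdConnected {v | (ξ, v) ∈ U}) :
    ∃ g : E × ℝ → ℝ, ContDiffOn ℝ ∞ g U ∧
      (∀ ξ, MonotoneOn (fun v => g (ξ, v)) {v | (ξ, v) ∈ U}) ∧
      ∀ ξ (M : ℝ), ∃ v, (ξ, v) ∈ U ∧ M ≤ g (ξ, v) := by
  obtain ⟨K, hKc, hKU, hKm, hKx⟩ := exists_compact_exhaustion_of_isOpen hU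
  obtain ⟨b₀, hb₀, hb₀U⟩ := exists_smooth_section hU hne hconv
  have step : ∀ (k : ℕ) (b : {b : E → ℝ // ContDiff ℝ ∞ b ∧ ∀ ξ, (ξ, b ξ) ∈ U}),
      ∃ b' : {b : E → ℝ // ContDiff ℝ ∞ b ∧ ∀ ξ, (ξ, b ξ) ∈ U},
        (∀ ξ, b.1 ξ < b'.1 ξ) ∧ ∀ ξ η, (ξ, η) ∈ K k → η < b'.1 ξ := by
    intro k b
    obtain ⟨b', h1, h2, h3, h4⟩ := exists_smooth_section_above hU hconv (hKc k) (hKU k)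
      b.2.1.continuous b.2.2
    exact ⟨⟨b', h1, h2⟩, h3, h4⟩
  choose next hnext1 hnext2 using step
  let β : ℕ → {b : E → ℝ // ContDiff ℝ ∞ b ∧ ∀ ξ, (ξ, b ξ) ∈ U} :=
    fun k => Nat.rec ⟨b₀, hb₀, hb₀U⟩ next k
  have hβs : ∀ k, β (k + 1) = next k (β k) := fun k => rfl
  have hlt : ∀ k ξ, (β k).1 ξ < (β (k + 1)).1 ξ := fun k ξ => hnext1 k (β k) ξ
  have hmono : ∀ ξ, Monotone fun k => (β k).1 ξ :=
    fun ξ => monotone_nat_of_le_succ fun k => (hlt k ξ).le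
  have hK : ∀ k ξ η, (ξ, η) ∈ K k → η < (β (k + 1)).1 ξ := fun k ξ η h => hnext2 k (β k) ξ η h
  let T : ℕ → E × ℝ → ℝ := fun k p =>
    Real.smoothTransition ((p.2 - (β k).1 p.1) / ((β (k + 1)).1 p.1 - (β k).1 p.1))
  have hTs : ∀ k, ContDiff ℝ ∞ (T k) := by
    intro k
    apply Real.smoothTransition.contDiff.comp
    have h1 : ContDiff ℝ ∞ fun p : E × ℝ => (β k).1 p.1 := (β k).2.1.comp contDiff_fst
    have h2 : ContDiff ℝ ∞ fun p : E × ℝ => (β (k + 1)).1 p.1 := (β (k + 1)).2.1.comp contDiff_fst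
    exact (contDiff_snd.sub h1).div (h2.sub h1) fun p => (sub_pos.2 (hlt k p.1)).ne'
  have hT0 : ∀ k p, p.2 ≤ (β k).1 p.1 → T k p = 0 := fun k p h =>
    Real.smoothTransition.zero_of_nonpos
      (div_nonpos_of_nonpos_of_nonneg (sub_nonpos.2 h) (sub_pos.2 (hlt k p.1)).le)
  have hT1 : ∀ k p, (β (k + 1)).1 p.1 ≤ p.2 → T k p = 1 := fun k p h =>
    Real.smoothTransition.one_of_one_le
      ((one_le_div (sub_pos.2 (hlt k p.1))).2 (by linarith))
  have hTm : ∀ k ξ, Monotone fun v => T k (ξ, v) := by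
    intro k ξ v w hvw
    apply Real.smoothTransition.monotone
    have := sub_pos.2 (hlt k ξ)
    simp only
    gcongr
  have hTnn : ∀ k p, 0 ≤ T k p := fun k p => Real.smoothTransition.nonneg _
  have hfin : ∀ n, ∀ p ∈ K n, ∀ j ∉ Finset.range (n + 1), T j p = 0 := by
    intro n p hp j hj
    rw [Finset.mem_range, not_lt] at hj
    exact hT0 j p ((hK n p.1 p.2 hp).le.trans (hmono p.1 hj))
  refine ⟨fun p => ∑' k, T k p, ?_, ?_, ?_⟩
  · intro p hp
    obtain ⟨n, hn⟩ := hKx p hp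
    apply ContDiffAt.contDiffWithinAt
    have h1 : ContDiffAt ℝ ∞ (fun p => ∑ k ∈ Finset.range (n + 1), T k p) p :=
      (ContDiff.sum fun k _ => hTs k).contDiffAt
    apply h1.congr_of_eventuallyEq
    filter_upwards [hn] with q hq using tsum_eq_sum (hfin n q hq)
  · intro ξ v hv w hw hvw
    obtain ⟨n, hn⟩ := hKx _ hv
    obtain ⟨m, hm⟩ := hKx _ hw
    have h1 := hKm (le_max_left n m) (mem_of_mem_nhds hn)
    have h2 := hKm (le_max_right n m) (mem_of_mem_nhds hm)
    simp only
    rw [tsum_eq_sum (hfin _ _ h1), tsum_eq_sum (hfin _ _ h2)]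
    exact Finset.sum_le_sum fun k _ => hTm k ξ hvw
  · intro ξ M
    obtain ⟨N, hN⟩ := exists_nat_ge M
    have hp := (β N).2.2 ξ
    refine ⟨(β N).1 ξ, hp, hN.trans ?_⟩
    obtain ⟨n, hn⟩ := hKx _ hp
    have hs : Summable fun k => T k (ξ, (β N).1 ξ) :=
      summable_of_ne_finset_zero (hfin n _ (mem_of_mem_nhds hn))
    have h1 := hs.sum_le_tsum (Finset.range N) (fun k _ => hTnn k _)
    rw [Finset.sum_congr rfl (g := fun _ => (1 : ℝ)) (fun k hk =>
      hT1 k _ (hmono ξ (Nat.succ_le_of_lt (Finset.mem_range.1 hk))))] at h1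
    simpa using h1

theorem isInvertible_comp_inr_of_ne_zero {X : Type*} [NormedAddCommGroup X] [NormedSpace ℝ X]
    {L : X × ℝ →L[ℝ] ℝ} (hL : L (0, 1) ≠ 0) : (L ∘L .inr ℝ X ℝ).IsInvertible := by
  set k := L (0, 1) with hk
  refine ContinuousLinearMap.IsInvertible.of_inverse (g := k⁻¹ • ContinuousLinearMap.id ℝ ℝ) ?_ ?_
  · ext; simp [← hk, hL]
  · ext; simp [← hk, hL]

/-- An open subset of `E × ℝ` whose fibres over `E` are nonempty intervals is diffeomorphic to
`E × ℝ`. -/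
theorem exists_fiberwise_diffeo {U : Set (E × ℝ)} (hU : IsOpen U)
    (hne : ∀ ξ, ∃ v, (ξ, v) ∈ U) (hconv : ∀ ξ, OrdConnected {v | (ξ, v) ∈ U}) :
    ∃ f g : E × ℝ → E × ℝ, ContDiff ℝ ∞ f ∧ ContDiffOn ℝ ∞ g U ∧ (∀ x, f x ∈ U) ∧
      (∀ x, g (f x) = x) ∧ ∀ x ∈ U, f (g x) = x := by
  obtain ⟨g₁, hg₁, hm₁, hu₁⟩ := exists_smooth_fiberwise_monotone hU hne hconv
  let σ : E × ℝ → E × ℝ := fun p => (p.1, -p.2)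
  have hσ : ContDiff ℝ ∞ σ := by fun_prop
  have hσσ : ∀ p, σ (σ p) = p := fun p => by simp [σ]
  obtain ⟨g₂, hg₂, hm₂, hu₂⟩ := exists_smooth_fiberwise_monotone (U := σ ⁻¹' U)
    (hU.preimage hσ.continuous) (fun ξ => by
      obtain ⟨v, hv⟩ := hne ξ
      exact ⟨-v, by simpa [σ] using hv⟩)
    (fun ξ => ⟨fun x hx y hy z hz => (hconv ξ).out (x := -y) (y := -x) hy hx
      ⟨neg_le_neg hz.2, neg_le_neg hz.1⟩⟩)
  -- The term `g₁` pushes values to `+∞` at the upper ends, and the reflected `g₂` to `-∞` at the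
  -- lower ends. The term `p.2` gives fibre derivative at least 1, so `G` maps each fibre
  -- bijectively onto `ℝ`.
  let G : E × ℝ → ℝ := fun p => p.2 + g₁ p - g₂ (σ p)
  have hG : ContDiffOn ℝ ∞ G U := by
    apply (contDiffOn_snd.add hg₁).sub
    exact hg₂.comp hσ.contDiffOn fun p hp => by simpa [hσσ] using hp
  have hGm : ∀ ξ, MonotoneOn (fun v => G (ξ, v) - v) {v | (ξ, v) ∈ U} := by
    intro ξ v hv w hw hvw
    have h1 := hm₁ ξ hv hw hvw
    have h2 := hm₂ ξ (a := -w) (b := -v) (by simpa [σ] using hw) (by simpa [σ] using hv)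
      (neg_le_neg hvw)
    simp only [G, σ] at h1 h2 ⊢
    linarith
  have hGs : ∀ ξ, StrictMonoOn (fun v => G (ξ, v)) {v | (ξ, v) ∈ U} := by
    intro ξ v hv w hw hvw
    have := hGm ξ hv hw hvw.le
    simp only at this ⊢
    linarith
  have hsec : ∀ ξ : E, Continuous fun v : ℝ => (ξ, v) := fun ξ => by fun_prop
  have hfib : ∀ ξ, IsOpen {v | (ξ, v) ∈ U} := fun ξ => hU.preimage (hsec ξ)
  have hGd : ∀ p ∈ U, 0 < fderiv ℝ G p (0, 1) := by
    rintro ⟨ξ, v⟩ hp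
    have h1 : HasFDerivAt G (fderiv ℝ G (ξ, v)) (ξ, v) :=
      ((hG.contDiffAt (hU.mem_nhds hp)).differentiableAt (by simp)).hasFDerivAt
    have h2 : HasDerivAt (fun v : ℝ => (ξ, v)) ((0 : E), (1 : ℝ)) v :=
      (hasDerivAt_const v ξ).prodMk (hasDerivAt_id v)
    have h3 : HasDerivAt (fun v => G (ξ, v) - v) (fderiv ℝ G (ξ, v) (0, 1) - 1) v :=
      (h1.comp_hasDerivAt v h2).sub (hasDerivAt_id v)
    have h4 := (hGm ξ).derivWithin_nonneg (x := v)
    rw [derivWithin_of_mem_nhds ((hfib ξ).mem_nhds hp), h3.deriv] at h4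
    linarith
  have hsurj : ∀ ξ τ, ∃ v, (ξ, v) ∈ U ∧ G (ξ, v) = τ := by
    intro ξ τ
    obtain ⟨v₀, hv₀⟩ := hne ξ
    have hmax : ∀ v w, (ξ, v) ∈ U → (ξ, w) ∈ U → (ξ, max v w) ∈ U := by
      intro v w hv hw
      rcases max_cases v w with h | h <;> rw [h.1] <;> assumption
    have hmin : ∀ v w, (ξ, v) ∈ U → (ξ, w) ∈ U → (ξ, min v w) ∈ U := by
      intro v w hv hw
      rcases min_cases v w with h | h <;> rw [h.1] <;> assumption
    obtain ⟨v₁, hv₁, h₁⟩ := hu₁ ξ (τ - v₀ + g₂ (ξ, -v₀))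
    obtain ⟨v₂, hv₂, h₂⟩ := hu₂ ξ (-τ + v₀ + g₁ (ξ, v₀))
    have hv₂' : (ξ, -v₂) ∈ U := hv₂
    have hA := hmax v₁ v₀ hv₁ hv₀
    have hB := hmin (-v₂) v₀ hv₂' hv₀
    have a1 := hm₁ ξ hv₁ hA (le_max_left _ _)
    have a2 := hm₂ ξ (a := -(max v₁ v₀)) (b := -v₀) (by simpa [σ] using hA) (by simpa [σ] using hv₀)
      (neg_le_neg (le_max_right _ _))
    have b1 := hm₁ ξ hB hv₀ (min_le_right _ _)
    have b2 := hm₂ ξ (a := v₂) (b := -(min (-v₂) v₀)) hv₂ (by simpa [σ] using hB)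
      (by have := min_le_left (-v₂) v₀; linarith)
    have hup : τ ≤ G (ξ, max v₁ v₀) := by
      have := le_max_right v₁ v₀
      simp only [G, σ] at *
      linarith
    have hdn : G (ξ, min (-v₂) v₀) ≤ τ := by
      have := min_le_right (-v₂) v₀
      simp only [G, σ] at *
      linarith
    have hcont : ContinuousOn (fun v => G (ξ, v)) {v | (ξ, v) ∈ U} :=
      hG.continuousOn.comp (hsec ξ).continuousOn fun v hv => hv
    obtain ⟨v, hv, hvτ⟩ := (hconv ξ).isPreconnected.intermediate_value hB hA hcont ⟨hdn, hup⟩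
    exact ⟨v, hv, hvτ⟩
  choose φ hφU hφ using hsurj
  refine ⟨fun p => (p.1, φ p.1 p.2), fun p => (p.1, G p), ?_, contDiffOn_fst.prodMk hG,
    fun p => hφU _ _, fun p => by simp [hφ], fun p hp => ?_⟩
  · apply contDiff_fst.prodMk
    rw [contDiff_iff_contDiffAt]
    rintro ⟨ξ₀, τ₀⟩
    -- The fibre inverse `φ` is smooth by the implicit function theorem for `G (ξ, v) = τ` with
    -- parameter `(ξ, τ)`; injectivity on fibres identifies the local solution with `φ`.
    let Ψ : (E × ℝ) × ℝ → ℝ := fun q => G (q.1.1, q.2) - q.1.2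
    let q₀ : (E × ℝ) × ℝ := ((ξ₀, τ₀), φ ξ₀ τ₀)
    have hm : ContDiff ℝ ∞ fun q : (E × ℝ) × ℝ => (q.1.1, q.2) := by fun_prop
    have hG0 : ContDiffAt ℝ ∞ G (ξ₀, φ ξ₀ τ₀) := hG.contDiffAt (hU.mem_nhds (hφU _ _))
    have hΨ : ContDiffAt ℝ ∞ Ψ q₀ :=
      (ContDiffAt.comp q₀ hG0 hm.contDiffAt).sub (by fun_prop)
    have hΨd : fderiv ℝ Ψ q₀ (0, 1) ≠ 0 := by
      have h1 : HasDerivAt (fun v : ℝ => ((ξ₀, τ₀), v)) ((0 : E × ℝ), (1 : ℝ)) (φ ξ₀ τ₀) :=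
        (hasDerivAt_const _ _).prodMk (hasDerivAt_id _)
      have h2 : HasDerivAt (fun v : ℝ => (ξ₀, v)) ((0 : E), (1 : ℝ)) (φ ξ₀ τ₀) :=
        (hasDerivAt_const _ _).prodMk (hasDerivAt_id _)
      have h3 := (hΨ.differentiableAt (by simp)).hasFDerivAt.comp_hasDerivAt _ h1
      have h4 := ((hG0.differentiableAt (by simp)).hasFDerivAt.comp_hasDerivAt _ h2).sub_const τ₀
      have h5 := h3.unique h4
      rw [h5]
      exact (hGd _ (hφU _ _)).ne'
    have inv := isInvertible_comp_inr_of_ne_zero hΨd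
    have hne0 : (∞ : WithTop ℕ∞) ≠ 0 := by simp
    have himp := hΨ.contDiffAt_implicitFunction hne0 inv
    have hself := hΨ.implicitFunction_apply_self hne0 inv
    apply himp.congr_of_eventuallyEq
    have e1 := hΨ.eventually_apply_implicitFunction hne0 inv
    have e2 : ∀ᶠ x in 𝓝 q₀.1, (x.1, hΨ.implicitFunction hne0 inv x) ∈ U := by
      have hc : ContinuousAt (fun x : E × ℝ => (x.1, hΨ.implicitFunction hne0 inv x)) q₀.1 :=
        continuousAt_fst.prodMk himp.continuousAt
      apply hc.eventually
      simp only [hself]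
      exact hU.mem_nhds (hφU _ _)
    filter_upwards [e1, e2] with x hx1 hx2
    have h0 : Ψ q₀ = 0 := by simp [Ψ, q₀, hφ]
    rw [h0] at hx1
    have h6 : G (x.1, hΨ.implicitFunction hne0 inv x) = x.2 := by
      simpa [Ψ, sub_eq_zero] using hx1
    exact (hGs x.1).injOn (hφU _ _) hx2 (by simp only [hφ, h6])
  · have : φ p.1 (G p) = p.2 := (hGs p.1).injOn (hφU _ _) hp (by simp only [hφ])
    simp [this]

end FiberwiseDiffeomorphism

/-! ### Stereographic coordinates on rays from the origin -/

section RadialDomain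

open Set Filter Topology

/-- Forgetting the last coordinate, `ℝ³ → ℝ²`. -/
noncomputable def horizontal (p : E3) : EuclideanSpace ℝ (Fin 2) := !₂[p 0, p 1]

theorem contDiff_horizontal {n : WithTop ℕ∞} : ContDiff ℝ n horizontal := by
  rw [contDiff_euclidean]
  intro i
  fin_cases i
  · exact contDiff_piLp_apply (p := 2) (i := 0)
  · exact contDiff_piLp_apply (p := 2) (i := 1)

theorem norm_horizontal_sq (p : E3) : ‖horizontal p‖ ^ 2 = p 0 ^ 2 + p 1 ^ 2 := by
  simp [horizontal, EuclideanSpace.norm_sq_eq, Fin.sum_univ_two]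

theorem norm_sq_eq_coord (p : E3) : ‖p‖ ^ 2 = p 0 ^ 2 + p 1 ^ 2 + p 2 ^ 2 := by
  simp [EuclideanSpace.norm_sq_eq, Fin.sum_univ_three]

theorem coord_two_lt_norm {p : E3} (hp : 0 < p 0 ^ 2 + p 1 ^ 2 ∨ p 2 < 0) : p 2 < ‖p‖ := by
  have h := norm_sq_eq_coord p
  rcases hp with hp | hp
  · apply lt_of_pow_lt_pow_left₀ 2 (norm_nonneg _)
    rw [h]; linarith
  · exact hp.trans_le (norm_nonneg _)

/-- The point at parameter `t` on the ray whose direction has stereographic coordinate `ξ`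
(projecting from the north pole). -/
noncomputable def rayPoint (v : EuclideanSpace ℝ (Fin 2) × ℝ) : E3 :=
  v.2 • appendCoord (v.1, (‖v.1‖ ^ 2 - 1) / 2)

theorem rayPoint_zero (v : EuclideanSpace ℝ (Fin 2) × ℝ) : rayPoint v 0 = v.2 * v.1 0 := by
  simp [rayPoint, appendCoord_apply]

theorem rayPoint_one (v : EuclideanSpace ℝ (Fin 2) × ℝ) : rayPoint v 1 = v.2 * v.1 1 := by
  simp [rayPoint, appendCoord_apply]

theorem rayPoint_two (v : EuclideanSpace ℝ (Fin 2) × ℝ) :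
    rayPoint v 2 = v.2 * ((‖v.1‖ ^ 2 - 1) / 2) := by
  simp [rayPoint, appendCoord_apply]

theorem contDiff_rayPoint {n : WithTop ℕ∞} : ContDiff ℝ n rayPoint := by
  have h : ContDiff ℝ n fun v : EuclideanSpace ℝ (Fin 2) × ℝ => (v.1, (‖v.1‖ ^ 2 - 1) / 2) := by
    apply contDiff_fst.prodMk
    exact ((contDiff_fst.norm_sq ℝ).sub contDiff_const).div_const 2
  exact contDiff_snd.smul (appendCoord.contDiff.comp h)

theorem norm_rayPoint {v : EuclideanSpace ℝ (Fin 2) × ℝ} (hv : 0 < v.2) :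
    ‖rayPoint v‖ = v.2 * ((‖v.1‖ ^ 2 + 1) / 2) := by
  rw [← sq_eq_sq₀ (norm_nonneg _) (by positivity), norm_sq_eq_coord, rayPoint_zero, rayPoint_one,
    rayPoint_two, EuclideanSpace.norm_sq_eq, Fin.sum_univ_two]
  simp only [Real.norm_eq_abs, sq_abs]
  ring

/-- The inverse of `rayPoint`. -/
noncomputable def rayCoord (p : E3) : EuclideanSpace ℝ (Fin 2) × ℝ :=
  ((‖p‖ - p 2)⁻¹ • horizontal p, ‖p‖ - p 2)

theorem rayCoord_rayPoint {v : EuclideanSpace ℝ (Fin 2) × ℝ} (hv : 0 < v.2) :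
    rayCoord (rayPoint v) = v := by
  have h : ‖rayPoint v‖ - rayPoint v 2 = v.2 := by
    rw [norm_rayPoint hv, rayPoint_two]; ring
  ext i
  · simp only [rayCoord, h]
    fin_cases i <;> simp [horizontal, rayPoint_zero, rayPoint_one, hv.ne']
  · simp only [rayCoord, h]

theorem rayPoint_rayCoord {p : E3} (hp : p 2 < ‖p‖) : rayPoint (rayCoord p) = p := by
  have h : 0 < ‖p‖ - p 2 := sub_pos.2 hp
  have h2 : (‖p‖ - p 2)⁻¹ ^ 2 * (p 0 ^ 2 + p 1 ^ 2) * (‖p‖ - p 2) = ‖p‖ + p 2 := by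
    have := norm_sq_eq_coord p
    have h3 : p 0 ^ 2 + p 1 ^ 2 = (‖p‖ - p 2) * (‖p‖ + p 2) := by nlinarith
    rw [h3]; field_simp
  ext i
  fin_cases i
  · show rayPoint (rayCoord p) 0 = p 0
    rw [rayPoint_zero]; simp [rayCoord, horizontal, h.ne']
  · show rayPoint (rayCoord p) 1 = p 1
    rw [rayPoint_one]; simp [rayCoord, horizontal, h.ne']
  · show rayPoint (rayCoord p) 2 = p 2
    rw [rayPoint_two]
    simp only [rayCoord, norm_smul, mul_pow, norm_horizontal_sq, norm_inv, Real.norm_eq_abs,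
      abs_of_pos h]
    linear_combination h2 / 2

theorem contDiffAt_rayCoord {n : WithTop ℕ∞} {p : E3} (hp : p 2 < ‖p‖) :
    ContDiffAt ℝ n rayCoord p := by
  have h0 : p ≠ 0 := by
    rintro rfl
    simp at hp
  have h1 : ContDiffAt ℝ n (fun p : E3 => ‖p‖ - p 2) p :=
    (contDiffAt_norm ℝ h0).sub (contDiff_piLp_apply (p := 2) (i := 2)).contDiffAt
  exact ((h1.inv (sub_pos.2 hp).ne').smul contDiff_horizontal.contDiffAt).prodMk h1

/-- An open set that meets every ray from the origin in an interval, and meets exactly the rays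
whose stereographic coordinate lies in a disc, is diffeomorphic to the ball. -/
theorem areDiffeomorphic_ball_of_radial {Ω : Set E3} (hΩ : IsOpen Ω)
    (haxis : ∀ p ∈ Ω, p 2 < ‖p‖)
    (hray : ∀ ξ, OrdConnected {t : ℝ | 0 < t ∧ rayPoint (ξ, t) ∈ Ω})
    {L : ℝ} (hL : 0 < L) (hdisc : ∀ ξ, (∃ t : ℝ, 0 < t ∧ rayPoint (ξ, t) ∈ Ω) ↔ ‖ξ‖ < L) :
    AreDiffeomorphic (ball (0 : E3) 1) Ω := by
  -- Here `β` identifies the plane with the disc of directions, and `B` below identifies space with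
  -- the unit ball. What remains between them is an open set in plane times line with interval
  -- fibres.
  let β := OpenPartialHomeomorph.univBall (0 : EuclideanSpace ℝ (Fin 2)) L
  have hβt : β.target = ball 0 L := OpenPartialHomeomorph.univBall_target 0 hL
  have hβs : β.source = univ := OpenPartialHomeomorph.univBall_source 0 L
  have hβc : ContDiff ℝ ∞ β := OpenPartialHomeomorph.contDiff_univBall
  have hβc' : ContDiffOn ℝ ∞ β.symm (ball 0 L) := OpenPartialHomeomorph.contDiffOn_univBall_symm
  have hβm : ∀ ζ, ‖β ζ‖ < L := fun ζ => by
    have := β.map_source (x := ζ) (by rw [hβs]; trivial)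
    rw [hβt] at this
    simpa using this
  have hβl : ∀ ζ, β.symm (β ζ) = ζ := fun ζ => β.left_inv (by rw [hβs]; trivial)
  have hβr : ∀ ξ, ‖ξ‖ < L → β (β.symm ξ) = ξ := fun ξ h => β.right_inv (by rw [hβt]; simpa using h)
  let B := OpenPartialHomeomorph.univBall (0 : E3) 1
  have hBt : B.target = ball 0 1 := OpenPartialHomeomorph.univBall_target 0 one_pos
  have hBs : B.source = univ := OpenPartialHomeomorph.univBall_source 0 1
  have hBc : ContDiff ℝ ∞ B := OpenPartialHomeomorph.contDiff_univBall
  have hBc' : ContDiffOn ℝ ∞ B.symm (ball 0 1) := OpenPartialHomeomorph.contDiffOn_univBall_symm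
  let U : Set (EuclideanSpace ℝ (Fin 2) × ℝ) := {v | 0 < v.2 ∧ rayPoint (β v.1, v.2) ∈ Ω}
  have hmap : ContDiff ℝ ∞ fun v : EuclideanSpace ℝ (Fin 2) × ℝ => (β v.1, v.2) :=
    (hβc.comp contDiff_fst).prodMk contDiff_snd
  have hF : ContDiff ℝ ∞ fun v : EuclideanSpace ℝ (Fin 2) × ℝ => rayPoint (β v.1, v.2) :=
    contDiff_rayPoint.comp hmap
  have hU : IsOpen U := (isOpen_lt continuous_const continuous_snd).inter
    (hΩ.preimage hF.continuous)
  obtain ⟨f, g, hf, hg, hfU, hgf, hfg⟩ := exists_fiberwise_diffeo hU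
    (fun ζ => (hdisc (β ζ)).2 (hβm ζ)) (fun ζ => hray (β ζ))
  have hdir : ∀ p ∈ Ω, ‖(rayCoord p).1‖ < L := fun p hp =>
    (hdisc _).1 ⟨(rayCoord p).2, sub_pos.2 (haxis p hp), by
      rw [Prod.mk.eta, rayPoint_rayCoord (haxis p hp)]; exact hp⟩
  let split : E3 → EuclideanSpace ℝ (Fin 2) × ℝ := fun p => (horizontal p, p 2)
  have hsplit : ContDiff ℝ ∞ split :=
    contDiff_horizontal.prodMk (contDiff_piLp_apply (p := 2) (i := 2))
  have hs1 : ∀ v, split (appendCoord v) = v := fun v => by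
    rw [appendCoord_apply]
    ext i
    · fin_cases i <;> simp [split, horizontal]
    · simp [split]
  have hs2 : ∀ p, appendCoord (split p) = p := fun p => by
    rw [appendCoord_apply]
    ext i
    fin_cases i <;> simp [split, horizontal]
  let κ : E3 → EuclideanSpace ℝ (Fin 2) × ℝ := fun p => (β.symm (rayCoord p).1, (rayCoord p).2)
  have hκU : ∀ p ∈ Ω, κ p ∈ U := fun p hp => by
    refine ⟨sub_pos.2 (haxis p hp), ?_⟩
    simp only [κ, hβr _ (hdir p hp)]
    rw [Prod.mk.eta, rayPoint_rayCoord (haxis p hp)]; exact hp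
  have hrc : ContDiffOn ℝ ∞ rayCoord Ω := fun p hp =>
    (contDiffAt_rayCoord (haxis p hp)).contDiffWithinAt
  have hκ : ContDiffOn ℝ ∞ κ Ω := by
    apply ContDiffOn.prodMk
    · exact hβc'.comp (contDiff_fst.comp_contDiffOn hrc) fun p hp => by simpa using hdir p hp
    · exact contDiff_snd.comp_contDiffOn hrc
  refine ⟨fun q => rayPoint (β (f (split (B.symm q))).1, (f (split (B.symm q))).2),
    fun p => B (appendCoord (g (κ p))), ?_, ?_, ?_, ?_, ?_, ?_⟩
  · exact (hF.comp (hf.comp hsplit)).comp_contDiffOn hBc'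
  · exact (hBc.comp appendCoord.contDiff).comp_contDiffOn (hg.comp hκ hκU)
  · exact fun q _ => (hfU _).2
  · intro p _
    have := B.map_source (x := appendCoord (g (κ p))) (by rw [hBs]; trivial)
    rwa [hBt] at this
  · intro q hq
    have h1 : κ (rayPoint (β (f (split (B.symm q))).1, (f (split (B.symm q))).2)) =
        f (split (B.symm q)) := by
      simp only [κ, rayCoord_rayPoint (v := (β (f (split (B.symm q))).1, (f (split (B.symm q))).2))
        (hfU _).1, hβl]
    simp only [h1, hgf, hs2]
    exact B.right_inv (by rw [hBt]; exact hq)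
  · intro p hp
    have h1 : B.symm (B (appendCoord (g (κ p)))) = appendCoord (g (κ p)) :=
      B.left_inv (by rw [hBs]; trivial)
    simp only [h1, hs1, hfg _ (hκU p hp)]
    simp only [κ, hβr _ (hdir p hp)]
    rw [Prod.mk.eta, rayPoint_rayCoord (haxis p hp)]

end RadialDomain

/-! ### One-variable calculus for profiles of revolution -/

section Calculus

open Set Filter Topology

theorem hasDerivAt_posPart_sq (b s : ℝ) :
    HasDerivAt (fun s => (max (s - b) 0) ^ 2) (2 * max (s - b) 0) s := by
  have h2 : HasDerivAt (fun s : ℝ => (s - b) ^ 2) (2 * (s - b)) s := by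
    refine (((hasDerivAt_id s).sub_const b).pow 2).congr_deriv ?_
    simp
  rcases lt_trichotomy s b with h | h | h
  · rw [max_eq_right (by linarith), mul_zero]
    apply (hasDerivAt_const s (0 : ℝ)).congr_of_eventuallyEq
    filter_upwards [gt_mem_nhds h] with t ht
    rw [max_eq_right (by linarith)]; norm_num
  · subst h
    rw [sub_self, max_self, mul_zero]
    rw [sub_self, mul_zero] at h2
    have hl : HasDerivWithinAt (fun t => (max (t - s) 0) ^ 2) 0 (Iic s) s := by
      apply (hasDerivWithinAt_const s _ (0 : ℝ)).congr
      · intro t ht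
        rw [max_eq_right (sub_nonpos.2 ht)]; norm_num
      · simp
    have hr : HasDerivWithinAt (fun t => (max (t - s) 0) ^ 2) 0 (Ici s) s := by
      apply h2.hasDerivWithinAt.congr
      · intro t ht
        rw [max_eq_left (sub_nonneg.2 ht)]
      · simp
    have := hl.union hr
    rwa [Iic_union_Ici, hasDerivWithinAt_univ] at this
  · rw [max_eq_left (by linarith)]
    apply h2.congr_of_eventuallyEq
    filter_upwards [lt_mem_nhds h] with t ht
    rw [max_eq_left (by linarith)]

/-- A `C¹` function that vanishes up to `a / 2` and equals `s - a` from `3 a / 2` on. -/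
noncomputable def ramp (a s : ℝ) : ℝ :=
  ((max (s - a / 2) 0) ^ 2 - (max (s - 3 * a / 2) 0) ^ 2) / (2 * a)

noncomputable def rampDeriv (a s : ℝ) : ℝ := (max (s - a / 2) 0 - max (s - 3 * a / 2) 0) / a

theorem hasDerivAt_ramp (a s : ℝ) : HasDerivAt (ramp a) (rampDeriv a s) s := by
  have := ((hasDerivAt_posPart_sq (a / 2) s).sub (hasDerivAt_posPart_sq (3 * a / 2) s)).div_const
    (2 * a)
  refine this.congr_deriv ?_
  rw [← mul_sub, mul_div_mul_left _ _ two_ne_zero, rampDeriv]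

theorem continuous_rampDeriv (a : ℝ) : Continuous (rampDeriv a) := by
  unfold rampDeriv; fun_prop

theorem contDiff_ramp (a : ℝ) : ContDiff ℝ 1 (ramp a) := by
  rw [contDiff_one_iff_deriv]
  refine ⟨fun s => (hasDerivAt_ramp a s).differentiableAt, ?_⟩
  rw [show deriv (ramp a) = rampDeriv a from funext fun s => (hasDerivAt_ramp a s).deriv]
  exact continuous_rampDeriv a

theorem rampDeriv_nonneg {a : ℝ} (ha : 0 < a) (s : ℝ) : 0 ≤ rampDeriv a s := by
  apply div_nonneg _ ha.le
  rw [sub_nonneg]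
  exact max_le_max (by linarith) le_rfl

theorem rampDeriv_le_one {a : ℝ} (ha : 0 < a) (s : ℝ) : rampDeriv a s ≤ 1 := by
  rw [rampDeriv, div_le_one ha, sub_le_iff_le_add]
  apply max_le
  · have := le_max_left (s - 3 * a / 2) 0
    linarith
  · have := le_max_right (s - 3 * a / 2) 0
    linarith

theorem rampDeriv_of_le {a s : ℝ} (ha : 0 < a) (hs : s ≤ a / 2) : rampDeriv a s = 0 := by
  rw [rampDeriv, max_eq_right (by linarith), max_eq_right (by linarith)]; simp

theorem rampDeriv_of_ge {a s : ℝ} (ha : 0 < a) (hs : 3 * a / 2 ≤ s) : rampDeriv a s = 1 := by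
  rw [rampDeriv, max_eq_left (by linarith), max_eq_left (by linarith)]; field_simp; ring

theorem ramp_of_le {a s : ℝ} (ha : 0 < a) (hs : s ≤ a / 2) : ramp a s = 0 := by
  rw [ramp, max_eq_right (by linarith), max_eq_right (by linarith)]; simp

theorem ramp_of_ge {a s : ℝ} (ha : 0 < a) (hs : 3 * a / 2 ≤ s) : ramp a s = s - a := by
  rw [ramp, max_eq_left (by linarith), max_eq_left (by linarith)]; field_simp; ring

/-- A difference of squares: `ramp` is `rampDeriv` times the mean of two positive parts, each at
most `s`. -/
theorem ramp_le_mul_rampDeriv {a s : ℝ} (ha : 0 < a) (hs : 0 ≤ s) :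
    ramp a s ≤ s * rampDeriv a s := by
  have h : ramp a s = (max (s - a / 2) 0 + max (s - 3 * a / 2) 0) / 2 * rampDeriv a s := by
    rw [ramp, rampDeriv]; field_simp; ring
  rw [h]
  apply mul_le_mul_of_nonneg_right _ (rampDeriv_nonneg ha s)
  have h1 : max (s - a / 2) 0 ≤ s := max_le (by linarith) hs
  have h2 : max (s - 3 * a / 2) 0 ≤ s := max_le (by linarith) hs
  linarith

theorem ramp_monotone {a : ℝ} (ha : 0 < a) : Monotone (ramp a) :=
  monotone_of_deriv_nonneg (fun s => (hasDerivAt_ramp a s).differentiableAt) fun s => by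
    rw [(hasDerivAt_ramp a s).deriv]; exact rampDeriv_nonneg ha s

theorem ramp_nonneg {a : ℝ} (ha : 0 < a) (s : ℝ) : 0 ≤ ramp a s := by
  have h0 := ramp_of_le ha (s := min s (a / 2)) (min_le_right _ _)
  rw [← h0]
  exact ramp_monotone ha (min_le_left _ _)

theorem ramp_le {a s : ℝ} (ha : 0 < a) (hs : 0 ≤ s) : ramp a s ≤ s :=
  (ramp_le_mul_rampDeriv ha hs).trans (mul_le_of_le_one_right hs (rampDeriv_le_one ha s))

/-- The tangent of an angle in terms of its sine. -/
noncomputable def tanOfSin (x : ℝ) : ℝ := x / √(1 - x ^ 2)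

theorem hasDerivAt_tanOfSin {x : ℝ} (hx : x ^ 2 < 1) :
    HasDerivAt tanOfSin (1 / ((1 - x ^ 2) * √(1 - x ^ 2))) x := by
  have h0 : 0 < 1 - x ^ 2 := by linarith
  have h1 : HasDerivAt (fun x : ℝ => √(1 - x ^ 2)) (-(2 * x) / (2 * √(1 - x ^ 2))) x := by
    have h2 : HasDerivAt (fun x : ℝ => 1 - x ^ 2) (-(2 * x)) x :=
      (((hasDerivAt_id x).pow 2).const_sub 1).congr_deriv (by simp)
    exact h2.sqrt h0.ne'
  have hs := Real.sqrt_pos.2 h0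
  refine ((hasDerivAt_id x).div h1 hs.ne').congr_deriv ?_
  have hq := Real.sq_sqrt h0.le
  simp only [id]
  rw [hq]
  field_simp
  rw [hq]; ring

theorem strictMonoOn_tanOfSin : StrictMonoOn tanOfSin (Ioo (-1) 1) := by
  have hsq : ∀ x ∈ Ioo (-1 : ℝ) 1, x ^ 2 < 1 := fun x hx => by nlinarith [hx.1, hx.2]
  apply strictMonoOn_of_deriv_pos (convex_Ioo _ _)
  · exact fun x hx => (hasDerivAt_tanOfSin (hsq x hx)).continuousAt.continuousWithinAt
  · intro x hx
    rw [interior_Ioo] at hx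
    rw [(hasDerivAt_tanOfSin (hsq x hx)).deriv]
    have h0 : 0 < 1 - x ^ 2 := by linarith [hsq x hx]
    have := Real.sqrt_pos.2 h0
    positivity

/-- The derivative `(1 - x ^ 2) ^ (-3 / 2)` is below 2 for `|x| ≤ 1 / 2`. -/
theorem tanOfSin_sub_le {x y : ℝ} (hx : -(1 / 2) ≤ x) (hxy : x ≤ y) (hy : y ≤ 1 / 2) :
    tanOfSin y - tanOfSin x ≤ 2 * (y - x) := by
  have hsq : ∀ z ∈ Icc (-(1 / 2) : ℝ) (1 / 2), z ^ 2 ≤ 1 / 4 := fun z hz => by nlinarith [hz.1, hz.2]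
  have hm : AntitoneOn (fun z => tanOfSin z - 2 * z) (Icc (-(1 / 2) : ℝ) (1 / 2)) := by
    have hd : ∀ z ∈ Icc (-(1 / 2) : ℝ) (1 / 2), HasDerivAt (fun z => tanOfSin z - 2 * z)
        (1 / ((1 - z ^ 2) * √(1 - z ^ 2)) - 2) z := by
      intro z hz
      have h1 := hasDerivAt_tanOfSin (x := z) (by linarith [hsq z hz])
      have h2 := (hasDerivAt_id z).const_mul 2
      exact (h1.sub h2).congr_deriv (by ring)
    apply antitoneOn_of_deriv_nonpos (convex_Icc _ _)
    · exact fun z hz => (hd z hz).continuousAt.continuousWithinAt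
    · exact fun z hz => (hd z (interior_subset hz)).differentiableAt.differentiableWithinAt
    · intro z hz
      rw [(hd z (interior_subset hz)).deriv]
      have h1 := hsq z (interior_subset hz)
      have h2 : (3 / 4 : ℝ) ≤ √(1 - z ^ 2) := by
        apply Real.le_sqrt_of_sq_le; linarith
      have h3 : (1 / 2 : ℝ) ≤ (1 - z ^ 2) * √(1 - z ^ 2) := by nlinarith
      have h4 : 1 / ((1 - z ^ 2) * √(1 - z ^ 2)) ≤ 2 := by
        rw [div_le_iff₀ (by linarith)]; linarith
      linarith
  have := hm ⟨hx, hxy.trans hy⟩ ⟨hx.trans hxy, hy⟩ hxy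
  simp only at this
  linarith

/-- The rate of descent, with respect to `s = x² + y²`, of a surface of revolution whose unit normal
has horizontal part `m / s • (x, y)`. -/
noncomputable def descentRate (m s : ℝ) : ℝ := m / (2 * s * √(1 - m ^ 2 / s))

theorem descentRate_eq {m s : ℝ} (hs : 0 < s) :
    descentRate m s = tanOfSin (m / √s) / (2 * √s) := by
  have h := Real.sq_sqrt hs.le
  have h' := Real.sqrt_pos.2 hs
  rw [descentRate, tanOfSin, div_pow, h]
  rw [div_div, div_div]
  congr 1
  linear_combination -(2 * √(1 - m ^ 2 / s)) * h

theorem div_sqrt_mem_Ioo {m s : ℝ} (hs : 0 < s) (hm : m ^ 2 < s) : m / √s ∈ Ioo (-1 : ℝ) 1 := by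
  have h' := Real.sqrt_pos.2 hs
  have h1 : |m| < √s := Real.lt_sqrt_of_sq_lt (by rwa [sq_abs])
  rw [abs_lt] at h1
  constructor
  · rw [lt_div_iff₀ h']; linarith
  · rw [div_lt_iff₀ h']; linarith

theorem descentRate_lt {m m' s : ℝ} (hs : 0 < s) (hm : m ^ 2 < s) (hm' : m' ^ 2 < s) (h : m < m') :
    descentRate m s < descentRate m' s := by
  have h' := Real.sqrt_pos.2 hs
  rw [descentRate_eq hs, descentRate_eq hs]
  apply div_lt_div_of_pos_right _ (by positivity)
  exact strictMonoOn_tanOfSin (div_sqrt_mem_Ioo hs hm) (div_sqrt_mem_Ioo hs hm')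
    (div_lt_div_of_pos_right h h')

/-- The quotient `m / √s` is the sine of the angle of the normal with the vertical. For sines of
absolute value at most `1 / 2`, the tangent is 2-Lipschitz in the sine. -/
theorem descentRate_sub_le {m m' s : ℝ} (hs : 0 < s) (hm : 4 * m ^ 2 ≤ s) (hm' : 4 * m' ^ 2 ≤ s)
    (h : m ≤ m') : descentRate m' s - descentRate m s ≤ (m' - m) / s := by
  have h' := Real.sqrt_pos.2 hs
  have hsq := Real.sq_sqrt hs.le
  have key : ∀ m : ℝ, 4 * m ^ 2 ≤ s → -(1 / 2) ≤ m / √s ∧ m / √s ≤ 1 / 2 := by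
    intro m hm
    have h1 : |2 * m| ≤ √s := Real.le_sqrt_of_sq_le (by rw [sq_abs]; linarith)
    rw [abs_le] at h1
    constructor
    · rw [le_div_iff₀ h']; linarith
    · rw [div_le_iff₀ h']; linarith
  have h2 := tanOfSin_sub_le (key m hm).1 (div_le_div_of_nonneg_right h h'.le) (key m' hm').2
  rw [descentRate_eq hs, descentRate_eq hs, ← sub_div, div_le_iff₀ (by positivity)]
  calc _ ≤ _ := h2
    _ = (m' - m) / (√s ^ 2) * (2 * √s) := by field_simp
    _ = _ := by rw [hsq]

theorem contDiffAt_descentRate {m : ℝ → ℝ} (hm : ContDiff ℝ 1 m) {s : ℝ} (hs : 0 < s)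
    (hms : m s ^ 2 < s) : ContDiffAt ℝ 1 (fun s => descentRate (m s) s) s := by
  unfold descentRate
  have h0 : 0 < 1 - m s ^ 2 / s := by rw [sub_pos, div_lt_one hs]; exact hms
  have h1 : ContDiffAt ℝ 1 (fun s => 1 - m s ^ 2 / s) s :=
    contDiffAt_const.sub ((hm.contDiffAt.pow 2).div contDiffAt_id hs.ne')
  have h2 := Real.sqrt_pos.2 h0
  exact hm.contDiffAt.div ((contDiffAt_const.mul contDiffAt_id).mul (h1.sqrt h0.ne'))
    (by positivity)

theorem hasDerivAt_integral_of_continuousOn_Ioo {f : ℝ → ℝ} {l r b s : ℝ}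
    (hf : ContinuousOn f (Ioo l r)) (hb : b ∈ Ioo l r) (hs : s ∈ Ioo l r) :
    HasDerivAt (fun s => ∫ t in b..s, f t) (f s) s := by
  have hsub : uIcc b s ⊆ Ioo l r := (convex_Ioo l r).ordConnected.uIcc_subset hb hs
  apply intervalIntegral.integral_hasDerivAt_right
  · exact (hf.mono hsub).intervalIntegrable
  · exact hf.stronglyMeasurableAtFilter isOpen_Ioo s hs
  · exact hf.continuousAt (isOpen_Ioo.mem_nhds hs)

theorem eqOn_Ioo_of_hasDerivAt {f g d : ℝ → ℝ} {l r b : ℝ} (hb : b ∈ Ioo l r)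
    (hf : ∀ s ∈ Ioo l r, HasDerivAt f (d s) s) (hg : ∀ s ∈ Ioo l r, HasDerivAt g (d s) s)
    (h : f b = g b) : EqOn f g (Ioo l r) := by
  apply isOpen_Ioo.eqOn_of_deriv_eq isPreconnected_Ioo
    (fun s hs => (hf s hs).differentiableAt.differentiableWithinAt)
    (fun s hs => (hg s hs).differentiableAt.differentiableWithinAt) _ hb h
  exact fun s hs => by rw [(hf s hs).deriv, (hg s hs).deriv]

/-- The upper half of a catenoid rises away from the axis, so its slope function is `-c` and that of
the lower half is `c`. -/
theorem hasDerivAt_catenoid {c s : ℝ} (hc : 0 < c) (hs : c ^ 2 < s) :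
    HasDerivAt (fun s => c * Real.arcosh (√s / c)) (descentRate c s) s := by
  have hs0 : 0 < s := (by positivity : (0 : ℝ) < c ^ 2).trans hs
  have h' := Real.sqrt_pos.2 hs0
  have hsq := Real.sq_sqrt hs0.le
  have h1 : 1 < √s / c := by
    rw [one_lt_div hc]; exact Real.lt_sqrt_of_sq_lt hs
  have h2 := ((Real.hasDerivAt_arcosh h1).comp s
    (((hasDerivAt_id s).sqrt hs0.ne').div_const c)).const_mul c
  refine h2.congr_deriv ?_
  have h3 : 0 < s - c ^ 2 := by linarith
  have h4 : (√s / c) ^ 2 - 1 = (s - c ^ 2) / c ^ 2 := by rw [div_pow, hsq]; field_simp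
  have h5 : 1 - c ^ 2 / s = (s - c ^ 2) / s := by field_simp
  simp only [id]
  rw [descentRate, h4, h5, Real.sqrt_div h3.le, Real.sqrt_div h3.le, Real.sqrt_sq hc.le]
  have h6 := Real.sqrt_pos.2 h3
  field_simp
  rw [hsq]

theorem descentRate_neg (m s : ℝ) : descentRate (-m) s = -descentRate m s := by
  simp [descentRate, neg_div]

/-- The radial unit normal has horizontal part `(x, y) / R`, so the slope function of a sphere is `s
/ R`. -/
theorem hasDerivAt_sphere {R s : ℝ} (hR : 0 < R) (hs0 : 0 < s) (hs : s < R ^ 2) :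
    HasDerivAt (fun s => √(R ^ 2 - s)) (-descentRate (s / R) s) s := by
  have h1 : 0 < R ^ 2 - s := by linarith
  refine ((hasDerivAt_id s).const_sub (R ^ 2)).sqrt h1.ne' |>.congr_deriv ?_
  have h2 : 1 - (s / R) ^ 2 / s = (R ^ 2 - s) / R ^ 2 := by field_simp
  simp only [id]
  rw [descentRate, h2, Real.sqrt_div h1.le, Real.sqrt_sq hR.le]
  have := Real.sqrt_pos.2 h1
  field_simp

end Calculus

/-! ### Construction of the neck profile -/

section Profile

open Set Filter Topology

/-- The generating data of two spheres, of radius `R` about `(0, 0, h)` and of radius `1` about the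
origin, joined by a neck around the vertical axis. In terms of `s = x² + y²`, the outer surface near
the neck is the graph of `T`, the inner one the graph of `B`; the horizontal parts of their upward
unit normals are `mt s / s • (x, y)` and `mb s / s • (x, y)`. For `s ≤ a` the two graphs form a
catenoid with waist radius `c` and center height `z₀`; beyond `s₁` they are spheres. -/
structure NeckProfile where
  (c R h z₀ a s₁ : ℝ)
  (T B mt mb : ℝ → ℝ)
  c_pos : 0 < c
  c_sq_lt : c ^ 2 < a
  a_lt : a < s₁
  s₁_le : s₁ ≤ 1 / 16
  one_lt : 1 < R
  R_le : R ≤ 5 / 4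
  abs_h_lt : |h| < R - 1
  contDiff_mt : ContDiff ℝ 1 mt
  contDiff_mb : ContDiff ℝ 1 mb
  deriv_mt : ∀ s, |deriv mt s| ≤ 1
  deriv_mb : ∀ s, |deriv mb s| ≤ 1
  mb_pos : ∀ s, 0 < mb s
  mt_lt_mb : ∀ s, mt s < mb s
  le_mb : ∀ s, s ≤ mb s
  mt_le : ∀ s, 0 ≤ s → mt s ≤ s / R
  mt_sq_lt : ∀ s, c ^ 2 < s → s < R ^ 2 → mt s ^ 2 < s
  mb_sq_lt : ∀ s, c ^ 2 < s → s < 1 → mb s ^ 2 < s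
  mt_sq_eq : ∀ s ≤ a, mt s ^ 2 = c ^ 2
  mb_sq_eq : ∀ s ≤ a, mb s ^ 2 = c ^ 2
  mt_sq_le : ∀ s, a ≤ s → s ≤ s₁ → 4 * mt s ^ 2 ≤ s
  mb_sq_le : ∀ s, a ≤ s → s ≤ s₁ → 4 * mb s ^ 2 ≤ s
  -- This makes the upper profile concave in the distance to the axis, which is what keeps the trace
  -- of the domain on each ray an interval.
  mt_mono : MonotoneOn (fun s => mt s / √s) (Ioo (c ^ 2) (R ^ 2))
  hasDerivAt_T : ∀ s, c ^ 2 < s → s < R ^ 2 → HasDerivAt T (-descentRate (mt s) s) s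
  hasDerivAt_B : ∀ s, c ^ 2 < s → s < 1 → HasDerivAt B (-descentRate (mb s) s) s
  T_catenoid : ∀ s, c ^ 2 < s → s ≤ a → T s = z₀ + c * Real.arcosh (√s / c)
  B_catenoid : ∀ s, c ^ 2 < s → s ≤ a → B s = z₀ - c * Real.arcosh (√s / c)
  T_sphere : ∀ s, s₁ ≤ s → s < R ^ 2 → T s = h + √(R ^ 2 - s)
  B_sphere : ∀ s, s₁ ≤ s → s < 1 → B s = √(1 - s)

theorem exists_integral_profile {m : ℝ → ℝ} (hm : ContDiff ℝ 1 m) {l r b : ℝ} (hl : 0 ≤ l)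
    (hb : b ∈ Ioo l r) (hms : ∀ s ∈ Ioo l r, m s ^ 2 < s) (v : ℝ) :
    ∃ f : ℝ → ℝ, f b = v ∧ ∀ s ∈ Ioo l r, HasDerivAt f (-descentRate (m s) s) s := by
  have hc : ContinuousOn (fun s => -descentRate (m s) s) (Ioo l r) := fun s hs =>
    (contDiffAt_descentRate hm (hl.trans_lt hs.1) (hms s hs)).continuousAt.neg.continuousWithinAt
  exact ⟨fun s => v + ∫ t in b..s, -descentRate (m t) t, by simp,
    fun s hs => (hasDerivAt_integral_of_continuousOn_Ioo hc hb hs).const_add v⟩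

theorem monotoneOn_div_sqrt {m m' : ℝ → ℝ} {l r : ℝ} (hl : 0 ≤ l)
    (hm : ∀ s, HasDerivAt m (m' s) s) (h : ∀ s ∈ Ioo l r, m s ≤ 2 * s * m' s) :
    MonotoneOn (fun s => m s / √s) (Ioo l r) := by
  have hd : ∀ s ∈ Ioo l r, HasDerivAt (fun s => m s / √s)
      ((2 * s * m' s - m s) / (2 * s * √s)) s := by
    intro s hs
    have h0 : 0 < s := hl.trans_lt hs.1
    have h' := Real.sqrt_pos.2 h0
    have hsq := Real.sq_sqrt h0.le
    refine ((hm s).div ((hasDerivAt_id s).sqrt h0.ne') h'.ne').congr_deriv ?_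
    simp only [id]
    rw [hsq]
    field_simp
    rw [hsq]; ring
  apply monotoneOn_of_deriv_nonneg (convex_Ioo _ _)
  · exact fun s hs => (hd s hs).continuousAt.continuousWithinAt
  · exact fun s hs => (hd s (interior_subset hs)).differentiableAt.differentiableWithinAt
  · intro s hs
    have hs := interior_subset hs
    have h0 : 0 < s := hl.trans_lt hs.1
    rw [(hd s hs).deriv]
    exact div_nonneg (by linarith [h s hs]) (by positivity)

theorem sub_le_ramp {a : ℝ} (ha : 0 < a) (s : ℝ) : s - a ≤ ramp a s := by
  rcases le_total (3 * a / 2) s with h | h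
  · rw [ramp_of_ge ha h]
  · have hm : Monotone fun s => s - ramp a s := monotone_of_deriv_nonneg
      (fun s => ((hasDerivAt_id s).sub (hasDerivAt_ramp a s)).differentiableAt) fun s => by
        refine le_of_le_of_eq ?_ ((hasDerivAt_id s).sub (hasDerivAt_ramp a s)).deriv.symm
        rw [sub_nonneg]
        exact rampDeriv_le_one ha s
    have := hm h
    simp only [ramp_of_ge ha le_rfl] at this
    linarith

/-- The slope functions of a neck of waist radius `c` under a sphere of radius `R`: `mb` leaves the
catenoid for the unit sphere around `s = c`, and `mt` becomes that of the sphere of radius `R`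
around `s = σ`. -/
structure NeckSlopes (c σ κ R : ℝ) where
  (mt mb mt' mb' : ℝ → ℝ)
  hasDerivAt_mt : ∀ s, HasDerivAt mt (mt' s) s
  hasDerivAt_mb : ∀ s, HasDerivAt mb (mb' s) s
  contDiff_mt : ContDiff ℝ 1 mt
  contDiff_mb : ContDiff ℝ 1 mb
  mt'_mem : ∀ s, mt' s ∈ Icc (0 : ℝ) 1
  mb'_mem : ∀ s, mb' s ∈ Icc (0 : ℝ) 1
  mt_of_le : ∀ s ≤ c / 2, mt s = -c
  mb_of_le : ∀ s ≤ c / 2, mb s = c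
  mt_of_ge : ∀ s, 3 * σ / 2 ≤ s → mt s = s / R
  mb_of_ge : ∀ s, 3 * c / 2 ≤ s → mb s = s
  le_mb : ∀ s, c ≤ mb s
  mt_lt_mb : ∀ s, mt s < mb s
  self_le_mb : ∀ s, s ≤ mb s
  mt_le_div : ∀ s, 0 ≤ s → mt s ≤ s / R
  sub_le : ∀ s, 0 ≤ s → mb s - mt s ≤ 2 * c + κ * s
  sq_le : ∀ s, mt s ^ 2 ≤ mb s ^ 2
  four_sq_le : ∀ s, c / 4 ≤ s → s ≤ 1 / 4 → 4 * mb s ^ 2 ≤ s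
  mb_sq_lt : ∀ s, c ^ 2 < s → s < 1 → mb s ^ 2 < s
  mt_sq_lt : ∀ s, c ^ 2 < s → s < R ^ 2 → mt s ^ 2 < s
  mt_mono : MonotoneOn (fun s => mt s / √s) (Ioo (c ^ 2) (R ^ 2))

/-- Up to `3 * c / 2` the value is of order `c`, and its square is small against `s ≥ c / 4`; from
there on `m s = s ≤ 1 / 4`. -/
theorem four_sq_le_of_slope {m : ℝ → ℝ} {c : ℝ} (hc : 0 < c) (hc320 : c ≤ 1 / 320)
    (hmono : Monotone m) (hle : ∀ s ≤ c / 2, m s = c) (hge : ∀ s, 3 * c / 2 ≤ s → m s = s) {s : ℝ}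
    (hs1 : c / 4 ≤ s) (hs2 : s ≤ 1 / 4) : 4 * m s ^ 2 ≤ s := by
  rcases le_total s (c / 2) with h | h
  · rw [hle s h]; nlinarith
  · rcases le_total s (3 * c / 2) with h' | h'
    · have h3 : m s ≤ 3 * c / 2 := by
        rw [← hge (3 * c / 2) le_rfl]; exact hmono h'
      have h4 : c ≤ m s := by
        rw [← hle (c / 2) le_rfl]; exact hmono h
      have h5 : m s ^ 2 ≤ (3 * c / 2) ^ 2 := pow_le_pow_left₀ (by linarith) h3 2
      nlinarith
    · rw [hge s h']; nlinarith

/-- The choices are `mb = c + ramp c` and `mt = -c + ramp c - κ * ramp σ`. Beyond `3 * σ / 2` the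
latter equals `(1 - κ) * s - 2 * c + κ * σ`, which is `s / R` because `κ = 1 - 1 / R` and `κ * σ = 2
* c`. The condition `4 * c ≤ σ` lets the first ramp finish before the second begins. -/
theorem exists_neckSlopes {c σ κ R : ℝ} (hc : 0 < c) (hc320 : c ≤ 1 / 320) (hσc : 4 * c ≤ σ)
    (hσ32 : σ ≤ 1 / 32) (hR : 1 < R) (hκ : κ = 1 - 1 / R) (hκ0 : 0 ≤ κ) (hκ5 : κ ≤ 1 / 5)
    (hκσ : κ * σ = 2 * c) : Nonempty (NeckSlopes c σ κ R) := by
  have hσ0 : 0 < σ := by linarith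
  have hmb' : ∀ s, HasDerivAt (fun s => c + ramp c s) (rampDeriv c s) s :=
    fun s => (hasDerivAt_ramp c s).const_add c
  have hmt' : ∀ s, HasDerivAt (fun s => -c + ramp c s - κ * ramp σ s)
      (rampDeriv c s - κ * rampDeriv σ s) s := fun s =>
    ((hasDerivAt_ramp c s).const_add (-c)).sub ((hasDerivAt_ramp σ s).const_mul κ)
  obtain ⟨mb, hmb⟩ : ∃ m : ℝ → ℝ, m = fun s => c + ramp c s := ⟨_, rfl⟩
  obtain ⟨mt, hmt⟩ : ∃ m : ℝ → ℝ, m = fun s => -c + ramp c s - κ * ramp σ s := ⟨_, rfl⟩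
  rw [← hmb] at hmb'
  rw [← hmt] at hmt'
  have hmbC : ContDiff ℝ 1 mb := hmb ▸ contDiff_const.add (contDiff_ramp c)
  have hmtC : ContDiff ℝ 1 mt := hmt ▸ (contDiff_const.add (contDiff_ramp c)).sub
    (contDiff_const.mul (contDiff_ramp σ))
  have hmb : ∀ s, mb s = c + ramp c s := fun s => by rw [hmb]
  have hmt : ∀ s, mt s = -c + ramp c s - κ * ramp σ s := fun s => by rw [hmt]
  have hslope : ∀ s, 0 ≤ rampDeriv c s - κ * rampDeriv σ s := by
    intro s
    rcases le_total s (σ / 2) with h | h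
    · rw [rampDeriv_of_le hσ0 h, mul_zero, sub_zero]; exact rampDeriv_nonneg hc s
    · rw [rampDeriv_of_ge hc (by linarith)]
      have := mul_le_of_le_one_right hκ0 (rampDeriv_le_one hσ0 s)
      linarith
  have hslope1 : ∀ s, rampDeriv c s - κ * rampDeriv σ s ≤ 1 := fun s => by
    have h1 := rampDeriv_le_one hc s
    have h2 := mul_nonneg hκ0 (rampDeriv_nonneg hσ0 s)
    linarith
  have hmt_mono : Monotone mt := monotone_of_deriv_nonneg (fun s => (hmt' s).differentiableAt)
    fun s => by rw [(hmt' s).deriv]; exact hslope s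
  have hmb_mono : Monotone mb := monotone_of_deriv_nonneg (fun s => (hmb' s).differentiableAt)
    fun s => by rw [(hmb' s).deriv]; exact rampDeriv_nonneg hc s
  have hmt_cat : ∀ s ≤ c / 2, mt s = -c := fun s hs => by
    rw [hmt, ramp_of_le hc hs, ramp_of_le hσ0 (by linarith)]; ring
  have hmb_cat : ∀ s ≤ c / 2, mb s = c := fun s hs => by
    rw [hmb, ramp_of_le hc hs]; ring
  have hmt_ge : ∀ s, -c ≤ mt s := by
    intro s
    rw [← hmt_cat (min s (c / 2)) (min_le_right _ _)]
    exact hmt_mono (min_le_left _ _)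
  have hlt : ∀ s, mt s < mb s := fun s => by
    have := mul_nonneg hκ0 (ramp_nonneg hσ0 s)
    rw [hmt, hmb]; linarith
  have hmb_ge : ∀ s, c ≤ mb s := fun s => by
    have := ramp_nonneg hc s
    rw [hmb]; linarith
  have hmb_sph : ∀ s, 3 * c / 2 ≤ s → mb s = s := fun s hs => by
    rw [hmb, ramp_of_ge hc hs]; ring
  have hmt_sph : ∀ s, 3 * σ / 2 ≤ s → mt s = s / R := fun s hs => by
    have : κ * (s - σ) = κ * s - 2 * c := by rw [mul_sub, hκσ]
    rw [hmt, ramp_of_ge hc (by linarith), ramp_of_ge hσ0 hs, this, hκ]; ring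
  have hself : ∀ s, s ≤ mb s := fun s => by
    rw [hmb]; linarith [sub_le_ramp hc s]
  have hdiv : ∀ s, 0 ≤ s → mt s ≤ s / R := by
    intro s hs
    have h1 : s / R = s - κ * s := by rw [hκ]; ring
    rw [h1]
    rcases le_total s (3 * c / 2) with h | h
    · have h2 := ramp_monotone hc h
      rw [ramp_of_ge hc le_rfl] at h2
      have h3 := mul_le_mul_of_nonneg_right hκ5 hs
      rw [hmt, ramp_of_le hσ0 (by linarith)]
      linarith
    · have h2 := mul_le_mul_of_nonneg_left (sub_le_ramp hσ0 s) hκ0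
      rw [mul_sub, hκσ] at h2
      rw [hmt, ramp_of_ge hc h]
      linarith
  have hsq_le : ∀ s, mt s ^ 2 ≤ mb s ^ 2 := fun s => by
    rw [sq_le_sq, abs_of_pos (hc.trans_le (hmb_ge s)), abs_le]
    exact ⟨by linarith [hmt_ge s, hmb_ge s], (hlt s).le⟩
  have hmid : ∀ s, c / 4 ≤ s → s ≤ 1 / 4 → 4 * mb s ^ 2 ≤ s := fun s =>
    four_sq_le_of_slope hc hc320 hmb_mono hmb_cat hmb_sph
  have hc20 : 0 < c ^ 2 := by positivity
  have hmb_sq : ∀ s, c ^ 2 < s → s < 1 → mb s ^ 2 < s := by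
    intro s h1 h2
    have h0 := hc20.trans h1
    rcases le_total s (c / 4) with h | h
    · rw [hmb_cat s (by linarith)]; exact h1
    · rcases le_total s (1 / 4) with h' | h'
      · linarith [hmid s h h']
      · rw [hmb_sph s (by linarith)]; nlinarith
  have hmt_sq : ∀ s, c ^ 2 < s → s < R ^ 2 → mt s ^ 2 < s := by
    intro s h1 h2
    rcases lt_or_ge s 1 with h | h
    · exact (hsq_le s).trans_lt (hmb_sq s h1 h)
    · rw [hmt_sph s (by linarith), div_pow, div_lt_iff₀ (by positivity), pow_two s]
      exact mul_lt_mul_of_pos_left h2 (by linarith)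
  refine ⟨⟨mt, mb, _, _, hmt', hmb', hmtC, hmbC, fun s => ⟨hslope s, hslope1 s⟩,
    fun s => ⟨rampDeriv_nonneg hc s, rampDeriv_le_one hc s⟩, hmt_cat, hmb_cat, hmt_sph, hmb_sph,
    hmb_ge, hlt, hself, hdiv, ?_, hsq_le, hmid, hmb_sq, hmt_sq, monotoneOn_div_sqrt hc20.le hmt' ?_⟩⟩
  · intro s hs
    have := mul_le_mul_of_nonneg_left (ramp_le hσ0 hs) hκ0
    rw [hmt, hmb]; linarith
  -- This is `m ≤ 2 * s * m'`, the condition for `m / √s` to increase. Before `σ / 2` it comes from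
  -- `ramp_le_mul_rampDeriv`; afterwards the slope is at least `1 - κ ≥ 4 / 5` while `m ≤ s`.
  · intro s hs
    have hs0 : 0 < s := hc20.trans hs.1
    have h1 := mul_nonneg hκ0 (ramp_nonneg hσ0 s)
    rw [hmt]
    rcases le_total s (σ / 2) with h | h
    · rw [rampDeriv_of_le hσ0 h, mul_zero, sub_zero]
      have h2 := ramp_le_mul_rampDeriv hc hs0.le
      have h3 := mul_nonneg hs0.le (rampDeriv_nonneg hc s)
      linarith
    · rw [rampDeriv_of_ge hc (by linarith)]
      have h3 := ramp_le hc hs0.le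
      have h4 := mul_le_mul_of_nonneg_left (mul_le_of_le_one_right hκ0 (rampDeriv_le_one hσ0 s))
        hs0.le
      have h5 := mul_le_mul_of_nonneg_left hκ5 hs0.le
      linarith

/-- The vertical distance of the two graphs grows by at most `2 c log (s₁ / b) + κ s₁`. -/
theorem graph_gap_mem {c σ κ R b s₁ : ℝ} (S : NeckSlopes c σ κ R) (hκ0 : 0 ≤ κ)
    (hb0 : 0 < b) (hb : c / 4 ≤ b) (hc2 : c ^ 2 < b) (hR : 1 < R) (hbs : b ≤ s₁)
    (hs₁ : s₁ ≤ 1 / 4) {T B : ℝ → ℝ}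
    (hT : ∀ s, c ^ 2 < s → s < R ^ 2 → HasDerivAt T (-descentRate (S.mt s) s) s)
    (hB : ∀ s, c ^ 2 < s → s < 1 → HasDerivAt B (-descentRate (S.mb s) s) s) :
    T s₁ - B s₁ ∈ Icc (T b - B b) (T b - B b + (2 * c * Real.log (s₁ / b) + κ * s₁)) := by
  have hR2 : 1 < R ^ 2 := one_lt_pow₀ hR two_ne_zero
  have hd : ∀ s ∈ Icc b s₁, HasDerivAt (fun s => T s - B s)
      (descentRate (S.mb s) s - descentRate (S.mt s) s) s := by
    intro s hs
    have h1 : c ^ 2 < s := hc2.trans_le hs.1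
    exact ((hT s h1 (by linarith [hs.2])).sub (hB s h1 (by linarith [hs.2]))).congr_deriv (by ring)
  constructor
  · refine monotoneOn_of_deriv_nonneg (f := fun s => T s - B s) (convex_Icc b s₁)
      (fun s hs => (hd s hs).continuousAt.continuousWithinAt)
      (fun s hs => (hd s (interior_subset hs)).differentiableAt.differentiableWithinAt) ?_
      (left_mem_Icc.2 hbs) (right_mem_Icc.2 hbs) hbs
    intro s hs
    have hs := interior_subset hs
    rw [(hd s hs).deriv]
    have h1 : c ^ 2 < s := hc2.trans_le hs.1
    exact sub_nonneg.2 (descentRate_lt (hb0.trans_le hs.1) (S.mt_sq_lt s h1 (by linarith [hs.2]))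
      (S.mb_sq_lt s h1 (by linarith [hs.2])) (S.mt_lt_mb s)).le
  -- The gap grows at rate at most `(mb - mt) / s ≤ 2 * c / s + κ`, the derivative of `2 * c * log s
  -- + κ * s`.
  · have hd2 : ∀ s ∈ Icc b s₁, HasDerivAt (fun s => T s - B s - (2 * c * Real.log s + κ * s))
        (descentRate (S.mb s) s - descentRate (S.mt s) s - (2 * c * s⁻¹ + κ * 1)) s := by
      intro s hs
      exact (hd s hs).sub (((Real.hasDerivAt_log (hb0.trans_le hs.1).ne').const_mul (2 * c)).add
        ((hasDerivAt_id s).const_mul κ))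
    have key := antitoneOn_of_deriv_nonpos (f := fun s => T s - B s - (2 * c * Real.log s + κ * s))
      (convex_Icc b s₁) (fun s hs => (hd2 s hs).continuousAt.continuousWithinAt)
      (fun s hs => (hd2 s (interior_subset hs)).differentiableAt.differentiableWithinAt) (by
        intro s hs
        have hs := interior_subset hs
        have hs0 : 0 < s := hb0.trans_le hs.1
        rw [(hd2 s hs).deriv]
        have h1 := S.four_sq_le s (hb.trans hs.1) (hs.2.trans hs₁)
        have h2 := descentRate_sub_le hs0
          ((mul_le_mul_of_nonneg_left (S.sq_le s) (by norm_num)).trans h1) h1 (S.mt_lt_mb s).le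
        have h3 : (S.mb s - S.mt s) / s ≤ 2 * c * s⁻¹ + κ * 1 := by
          rw [div_le_iff₀ hs0, add_mul, mul_assoc, inv_mul_cancel₀ hs0.ne', mul_one, mul_one]
          exact S.sub_le s hs0.le
        linarith)
      (left_mem_Icc.2 hbs) (right_mem_Icc.2 hbs) hbs
    have h0 : 0 ≤ κ * b := mul_nonneg hκ0 hb0.le
    have h1 : Real.log (s₁ / b) = Real.log s₁ - Real.log b :=
      Real.log_div (hb0.trans_le hbs).ne' hb0.ne'
    simp only at key
    rw [h1]
    linarith

/-- Use `log x ≤ arcosh x ≤ log (2 * x)` at `x = √(c / 4) / c`, whose logarithm is `(ℓ - log 4) /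
2`. Hence the catenoid cut off at `s = c / 4` has height `c * ℓ` up to `2 * c`. -/
theorem arcosh_mem_of_log {c ℓ : ℝ} (hc : 0 < c) (hc4 : 4 * c ≤ 1) (hℓ : ℓ = Real.log (1 / c)) :
    2 * Real.arcosh (√(c / 4) / c) ∈ Icc (ℓ - 2) ℓ := by
  have hxb : √(c / 4) / c = √(1 / (4 * c)) := by
    rw [← Real.sqrt_sq hc.le, ← Real.sqrt_div (by positivity), Real.sqrt_sq hc.le]
    congr 1
    field_simp
  have hx1 : 1 ≤ √(c / 4) / c := by
    rw [hxb, Real.one_le_sqrt, le_div_iff₀ (by positivity)]; linarith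
  have hlog4 : Real.log 4 = 2 * Real.log 2 := by
    rw [show (4 : ℝ) = 2 ^ 2 by norm_num, Real.log_pow]; push_cast; ring
  have hlogx : Real.log (√(c / 4) / c) = (ℓ - Real.log 4) / 2 := by
    rw [hxb, Real.log_sqrt (by positivity), Real.log_div one_ne_zero (by positivity),
      Real.log_mul (by norm_num) hc.ne', hℓ, Real.log_div one_ne_zero hc.ne', Real.log_one]
    ring
  have h2 := Real.log_two_lt_d9
  constructor
  · have h1 : Real.log (√(c / 4) / c) ≤ Real.arcosh (√(c / 4) / c) := by
      apply Real.log_le_log (by positivity)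
      have := Real.sqrt_nonneg ((√(c / 4) / c) ^ 2 - 1)
      linarith
    rw [hlogx] at h1
    linarith
  · have h1 : Real.arcosh (√(c / 4) / c) ≤ Real.log (2 * (√(c / 4) / c)) := by
      apply Real.log_le_log (by positivity)
      have : √((√(c / 4) / c) ^ 2 - 1) ≤ √(c / 4) / c := by
        rw [Real.sqrt_le_left (by positivity)]; linarith
      linarith
    rw [Real.log_mul two_ne_zero (by positivity), hlogx] at h1
    linarith

/-- Near the axis the vertical gap of two concentric spheres is almost the difference of the radii;
this is the gap against which the neck is compared. -/
theorem sphere_gap_mem {δ s : ℝ} (hδ : 0 ≤ δ) (h0 : 0 ≤ s) (h1 : s ≤ 1 / 16) :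
    √((1 + δ) ^ 2 - s) - √(1 - s) ∈ Icc δ (δ * (1 + s)) := by
  have hp1 : 0 < 1 - s := by linarith
  have hsq := Real.sq_sqrt hp1.le
  constructor
  · have : δ + √(1 - s) ≤ √((1 + δ) ^ 2 - s) := by
      apply Real.le_sqrt_of_sq_le
      have h3 : √(1 - s) ≤ 1 := by rw [Real.sqrt_le_left one_pos.le]; linarith
      nlinarith
    linarith
  · have : √((1 + δ) ^ 2 - s) ≤ δ * (1 + s) + √(1 - s) := by
      rw [Real.sqrt_le_left (by positivity)]
      have h3 : 1 ≤ (1 + s) * √(1 - s) := by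
        have h4 : 1 / (1 + s) ≤ √(1 - s) := by
          apply Real.le_sqrt_of_sq_le
          rw [div_pow, div_le_iff₀ (by positivity)]
          have : 0 ≤ s * (1 - s - s ^ 2) := mul_nonneg h0 (by nlinarith)
          nlinarith
        rw [div_le_iff₀ (by positivity)] at h4
        linarith
      have h6 : 0 ≤ δ ^ 2 * (2 * s + s ^ 2) := by positivity
      have h7 := mul_le_mul_of_nonneg_left h3 hδ
      nlinarith
    linarith

/-- The scales of a neck with waist radius `c`, in terms of `ℓ = log (1 / c)`. -/
theorem neck_scales {c ℓ δ R σ κ : ℝ} (hc : 0 < c) (hℓ40 : 40 ≤ ℓ) (hcℓ : 8 * (c * ℓ) ≤ 1)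
    (hδ : δ = 2 * c * ℓ) (hR : R = 1 + δ) (hσ : σ = R / ℓ) (hκ : κ = 1 - 1 / R) :
    (c ≤ 1 / 320 ∧ 0 < δ ∧ R ≤ 5 / 4) ∧ (4 * c ≤ σ ∧ σ ≤ 1 / 32 ∧ σ * ℓ = R) ∧
      (0 ≤ κ ∧ κ ≤ 1 / 5 ∧ κ ≤ δ ∧ κ * σ = 2 * c) := by
  have hℓ0 : 0 < ℓ := by linarith
  have hδ0 : 0 < δ := by rw [hδ]; positivity
  have hR54 : R ≤ 5 / 4 := by rw [hR, hδ]; linarith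
  have hR0 : 0 < R := by linarith
  have hσℓ : σ * ℓ = R := by rw [hσ]; field_simp
  have hκR : κ * R = δ := by rw [hκ, sub_mul, one_div, inv_mul_cancel₀ hR0.ne', hR]; ring
  have hκ0 : 0 ≤ κ := by
    by_contra hcon
    have := mul_neg_of_neg_of_pos (not_le.1 hcon) hR0
    linarith
  refine ⟨⟨by nlinarith, hδ0, hR54⟩, ⟨?_, ?_, hσℓ⟩, hκ0, ?_, ?_, ?_⟩
  · rw [hσ, le_div_iff₀ hℓ0]; linarith
  · rw [hσ, div_le_iff₀ hℓ0]; linarith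
  · have : 4 / 5 ≤ 1 / R := by rw [le_div_iff₀ hR0]; linarith
    linarith
  · rw [← hκR]
    exact le_mul_of_one_le_right hκ0 (by linarith)
  · have : κ * σ * ℓ = 2 * c * ℓ := by rw [mul_assoc, hσℓ, hκR, hδ]
    exact mul_right_cancel₀ hℓ0.ne' this

/-- Graphs with the given slopes, on a common catenoid at `b`, the lower one on the unit sphere. -/
theorem exists_neck_graphs {c σ κ R b s₁ A : ℝ} (S : NeckSlopes c σ κ R) (hR : 1 < R)
    (hc2 : c ^ 2 < b) (hb : b < 1) :
    ∃ (T B : ℝ → ℝ) (z₀ : ℝ), T b = z₀ + A ∧ B b = z₀ - A ∧ B s₁ = √(1 - s₁) ∧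
      (∀ s, c ^ 2 < s → s < R ^ 2 → HasDerivAt T (-descentRate (S.mt s) s) s) ∧
      ∀ s, c ^ 2 < s → s < 1 → HasDerivAt B (-descentRate (S.mb s) s) s := by
  have hR2 : 1 < R ^ 2 := one_lt_pow₀ hR two_ne_zero
  obtain ⟨B, hBb, hB⟩ := exists_integral_profile S.contDiff_mb (sq_nonneg c)
    (show b ∈ Ioo (c ^ 2) 1 from ⟨hc2, hb⟩) (fun s hs => S.mb_sq_lt s hs.1 hs.2) 0
  obtain ⟨T, hTb, hT⟩ := exists_integral_profile S.contDiff_mt (sq_nonneg c)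
    (show b ∈ Ioo (c ^ 2) (R ^ 2) from ⟨hc2, hb.trans hR2⟩) (fun s hs => S.mt_sq_lt s hs.1 hs.2)
    (√(1 - s₁) - B s₁ + A + A)
  exact ⟨T, fun s => √(1 - s₁) - B s₁ + B s, √(1 - s₁) - B s₁ + A, hTb, by simp only [hBb]; ring, by ring,
    fun s h1 h2 => hT s ⟨h1, h2⟩, fun s h1 h2 => (hB s ⟨h1, h2⟩).const_add _⟩

theorem graph_eq_catenoid {c r d z₀ : ℝ} (hc : 0 < c) (hc4 : c < 1 / 4) {g m : ℝ → ℝ}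
    (hd : d = 1 ∨ d = -1) (hr : c / 2 ≤ r) (hm : ∀ s ≤ c / 2, m s = -(d * c))
    (hg : ∀ s, c ^ 2 < s → s < r → HasDerivAt g (-descentRate (m s) s) s)
    (hgb : g (c / 4) = z₀ + d * (c * Real.arcosh (√(c / 4) / c))) {s : ℝ} (h1 : c ^ 2 < s)
    (h2 : s < c / 2) : g s = z₀ + d * (c * Real.arcosh (√s / c)) := by
  refine eqOn_Ioo_of_hasDerivAt (l := c ^ 2) (r := c / 2) (b := c / 4)
    ⟨by nlinarith, by linarith⟩ (f := g)
    (g := fun s => z₀ + d * (c * Real.arcosh (√s / c))) (d := fun s => d * descentRate c s)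
    (fun t ht => (hg t ht.1 (ht.2.trans_le hr)).congr_deriv ?_)
    (fun t ht => ((hasDerivAt_catenoid hc ht.1).const_mul d).const_add z₀) hgb ⟨h1, h2⟩
  rw [hm t ht.2.le, descentRate_neg, neg_neg]
  rcases hd with h | h
  · rw [h, one_mul, one_mul]
  · rw [h, neg_one_mul, neg_one_mul, descentRate_neg]

theorem graph_eq_sphere {ρ l s₁ v : ℝ} (hρ : 0 < ρ) (hl : 0 ≤ l) (hls : l < s₁)
    (hsρ : s₁ < ρ ^ 2) {g m : ℝ → ℝ} (hm : ∀ s, l ≤ s → m s = s / ρ)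
    (hg : ∀ s, l < s → s < ρ ^ 2 → HasDerivAt g (-descentRate (m s) s) s)
    (hgs : g s₁ = v + √(ρ ^ 2 - s₁)) {s : ℝ} (h1 : s₁ ≤ s) (h2 : s < ρ ^ 2) :
    g s = v + √(ρ ^ 2 - s) :=
  eqOn_Ioo_of_hasDerivAt (l := l) (r := ρ ^ 2) (b := s₁) ⟨hls, hsρ⟩ (f := g)
    (g := fun s => v + √(ρ ^ 2 - s)) (d := fun s => -descentRate (s / ρ) s)
    (fun t ht => (hg t ht.1 ht.2).congr_deriv (by rw [hm t ht.1.le]))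
    (fun t ht => (hasDerivAt_sphere hρ (hl.trans_lt ht.1) ht.2).const_add v) hgs
    ⟨hls.trans_le h1, h2⟩

/-- The shift is the gap `D` of the graphs minus that of concentric spheres. Up to multiples of `c`,
`D` lies between `c * ℓ` and `3 * c * ℓ`, and the concentric gap is `δ = 2 * c * ℓ`. So the shift is
at most `c * ℓ` plus a multiple of `c`, which is below `2 * c * ℓ = R - 1` as `ℓ ≥ 40`. -/
theorem abs_center_lt {c ℓ δ R σ κ A D : ℝ} (hc : 0 < c) (hℓ40 : 40 ≤ ℓ) (hδ : δ = 2 * c * ℓ)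
    (hR : R = 1 + δ) (hR54 : R ≤ 5 / 4) (hσ0 : 0 < σ) (hσℓ : σ * ℓ = R) (hσ32 : σ ≤ 1 / 32)
    (hκδ : κ ≤ δ) (hA : 2 * A ∈ Icc (c * (ℓ - 2)) (c * ℓ))
    (hlog : Real.log (2 * σ / (c / 4)) ≤ ℓ)
    (hD : D ∈ Icc (2 * A) (2 * A + (2 * c * Real.log (2 * σ / (c / 4)) + κ * (2 * σ)))) :
    |D - (√(R ^ 2 - 2 * σ) - √(1 - 2 * σ))| < R - 1 := by
  have hδ0 : 0 < δ := by rw [hδ]; have : 0 < ℓ := by linarith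
                         positivity
  obtain ⟨h1, h2⟩ := sphere_gap_mem hδ0.le (s := 2 * σ) (by linarith) (by linarith)
  rw [← hR] at h1 h2
  have e3 : δ * (2 * σ) = 4 * c * R := by
    rw [hδ]
    calc 2 * c * ℓ * (2 * σ) = 4 * c * (σ * ℓ) := by ring
      _ = _ := by rw [hσℓ]
  have e4 : c * R ≤ c * (5 / 4) := mul_le_mul_of_nonneg_left hR54 hc.le
  have e5 : c * 40 ≤ c * ℓ := mul_le_mul_of_nonneg_left hℓ40 hc.le
  have e6 : κ * (2 * σ) ≤ δ * (2 * σ) := mul_le_mul_of_nonneg_right hκδ (by linarith)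
  have e7 : c * Real.log (2 * σ / (c / 4)) ≤ c * ℓ := mul_le_mul_of_nonneg_left hlog hc.le
  have hA1 := hA.1
  have hA2 := hA.2
  have hD1 := hD.1
  have hD2 := hD.2
  rw [abs_lt]
  constructor <;> linarith

/-- The neck profile exists with waist `c`, provided `log (1 / c)` is large. -/
theorem exists_neckProfile_of_log {c ℓ : ℝ} (hc : 0 < c) (hℓ : ℓ = Real.log (1 / c))
    (hℓ40 : 40 ≤ ℓ) (hcℓ : 8 * (c * ℓ) ≤ 1) :
    ∃ P : NeckProfile, P.R = 1 + 2 * c * ℓ ∧ P.s₁ = 2 * P.R / ℓ := by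
  obtain ⟨δ, hδ⟩ : ∃ δ, δ = 2 * c * ℓ := ⟨_, rfl⟩
  obtain ⟨R, hR⟩ : ∃ R, R = 1 + δ := ⟨_, rfl⟩
  obtain ⟨σ, hσ⟩ : ∃ σ, σ = R / ℓ := ⟨_, rfl⟩
  obtain ⟨κ, hκ⟩ : ∃ κ, κ = 1 - 1 / R := ⟨_, rfl⟩
  obtain ⟨⟨hc320, hδ0, hR54⟩, ⟨hσc, hσ32, hσℓ⟩, hκ0, hκ5, hκδ, hκσ⟩ :=
    neck_scales hc hℓ40 hcℓ hδ hR hσ hκ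
  have hR1 : 1 < R := by linarith
  have hR2 : 1 < R ^ 2 := one_lt_pow₀ hR1 two_ne_zero
  have hσ0 : 0 < σ := by linarith
  obtain ⟨S⟩ := exists_neckSlopes hc hc320 hσc hσ32 hR1 hκ hκ0 hκ5 hκσ
  have hc2 : c ^ 2 < c / 4 := by nlinarith
  obtain ⟨T, B, z₀, hTb, hBb, hBs, hT, hB⟩ := exists_neck_graphs S (s₁ := 2 * σ)
    (A := c * Real.arcosh (√(c / 4) / c)) hR1 hc2 (by linarith)
  have hD := graph_gap_mem S hκ0 (by linarith) le_rfl hc2 hR1 (show c / 4 ≤ 2 * σ by linarith)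
    (by linarith) hT hB
  rw [hTb, hBb, show ∀ A : ℝ, z₀ + A - (z₀ - A) = 2 * A from fun A => by ring] at hD
  obtain ⟨hA1, hA2⟩ := arcosh_mem_of_log hc (by linarith) hℓ
  have hlog : Real.log (2 * σ / (c / 4)) ≤ ℓ := by
    rw [hℓ]
    apply Real.log_le_log (by positivity)
    rw [div_le_div_iff₀ (by positivity) hc]
    nlinarith
  have hh := abs_center_lt hc hℓ40 hδ hR hR54 hσ0 hσℓ hσ32 hκδ
    ⟨by nlinarith, by nlinarith⟩ hlog hD
  -- The outer center is put where its sphere meets `T` at `s₁ = 2 * σ`; `B` already meets the unit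
  -- sphere there.
  refine ⟨⟨c, R, T (2 * σ) - √(R ^ 2 - 2 * σ), z₀, c / 4, 2 * σ, T, B, S.mt, S.mb, hc, hc2,
    by linarith, by linarith, hR1, hR54, ?_, S.contDiff_mt, S.contDiff_mb, ?_, ?_,
    fun s => hc.trans_le (S.le_mb s), S.mt_lt_mb, S.self_le_mb, S.mt_le_div, S.mt_sq_lt, S.mb_sq_lt, ?_, ?_, ?_, ?_,
    S.mt_mono, hT, hB, ?_, ?_, ?_, ?_⟩, hδ ▸ hR, by simp only [hσ]; ring⟩
  · rw [hBs] at hh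
    convert hh using 2
    ring
  · intro s
    rw [(S.hasDerivAt_mt s).deriv, abs_of_nonneg (S.mt'_mem s).1]; exact (S.mt'_mem s).2
  · intro s
    rw [(S.hasDerivAt_mb s).deriv, abs_of_nonneg (S.mb'_mem s).1]; exact (S.mb'_mem s).2
  · intro s hs
    rw [S.mt_of_le s (by linarith), neg_sq]
  · intro s hs
    rw [S.mb_of_le s (by linarith)]
  · intro s h1 h2
    exact (mul_le_mul_of_nonneg_left (S.sq_le s) (by norm_num)).trans
      (S.four_sq_le s h1 (by linarith))
  · exact fun s h1 h2 => S.four_sq_le s h1 (by linarith)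
  · intro s h1 h2
    have := graph_eq_catenoid hc (by linarith) (Or.inl rfl) (r := R ^ 2) (z₀ := z₀) (by linarith)
      (fun s hs => by rw [S.mt_of_le s hs, one_mul]) hT (by rw [hTb, one_mul]) h1 (by linarith)
    rwa [one_mul] at this
  · intro s h1 h2
    have := graph_eq_catenoid hc (by linarith) (Or.inr rfl) (r := 1) (z₀ := z₀) (by linarith)
      (fun s hs => by rw [S.mb_of_le s hs]; ring) hB (by rw [hBb]; ring) h1 (by linarith)
    rw [this]; ring
  · intro s h1 h2
    exact graph_eq_sphere (by linarith) (l := 3 * σ / 2) (by linarith) (by linarith) (by linarith)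
      S.mt_of_ge (fun s hs => hT s (by linarith)) (by ring) h1 h2
  · intro s h1 h2
    have := graph_eq_sphere one_pos (l := 3 * c / 2) (s₁ := 2 * σ) (v := 0) (by linarith)
      (by linarith) (by linarith) (fun s hs => by rw [S.mb_of_ge s hs, div_one])
      (fun s hs h => hB s (by linarith) (by simpa using h)) (by rw [hBs]; simp) h1 (by simpa using h2)
    simpa using this

/-- Take `c = exp (-ℓ)` with `ℓ` large: `R - 1 = 2 * ℓ * exp (-ℓ)` and `s₁ = 2 * R / ℓ ≤ 5 / ℓ` both
tend to 0. -/
theorem exists_neckProfile {η : ℝ} (hη : 0 < η) :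
    ∃ P : NeckProfile, P.R ≤ 1 + η ∧ P.s₁ ≤ η := by
  have h1 : Tendsto (fun ℓ : ℝ => Real.exp (-ℓ) * ℓ) atTop (𝓝 0) := by
    have := Real.tendsto_pow_mul_exp_neg_atTop_nhds_zero 1
    simpa [mul_comm] using this
  have h2 : Tendsto (fun ℓ : ℝ => 5 / ℓ) atTop (𝓝 0) := tendsto_const_nhds.div_atTop tendsto_id
  have h3 : (0 : ℝ) < min (1 / 8) (η / 2) := by positivity
  obtain ⟨ℓ, h40, hsmall, h5⟩ := ((eventually_ge_atTop (40 : ℝ)).and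
    ((h1.eventually (gt_mem_nhds h3)).and (h2.eventually (gt_mem_nhds hη)))).exists
  have h6 := hsmall.trans_le (min_le_left _ _)
  have h7 := hsmall.trans_le (min_le_right _ _)
  obtain ⟨P, hPR, hPs⟩ := exists_neckProfile_of_log (c := Real.exp (-ℓ)) (ℓ := ℓ) (Real.exp_pos _)
    (by rw [one_div, ← Real.exp_neg, neg_neg, Real.log_exp]) h40 (by linarith)
  refine ⟨P, by rw [hPR]; linarith, ?_⟩
  have := P.R_le
  rw [hPs]
  refine le_trans ?_ h5.le
  have : 0 < ℓ := by linarith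
  gcongr
  linarith

end Profile

/-! ### Mean curvature of spheres and radial graphs -/

section DefiningFunctions

open Set Filter Topology

/-- `F` is twice continuously differentiable at `q` and, if it vanishes there, `N q` is the unit
vector in the direction of its gradient. -/
def IsDefiningAt (F : E3 → ℝ) (N : E3 → E3) (q : E3) : Prop :=
  ContDiffAt ℝ 2 F q ∧
    (F q = 0 → ‖N q‖ = 1 ∧ ∃ k : ℝ, 0 < k ∧ HasFDerivAt F (k • innerSL ℝ (N q)) q)

theorem isOuterUnitNormal_of_isDefiningAt {Ω : Set E3} {p : E3} {F : E3 → ℝ} {N : E3 → E3}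
    (hF : ∀ᶠ q in 𝓝 p, IsDefiningAt F N q) (hΩ : ∀ᶠ x in 𝓝 p, x ∈ Ω ↔ F x < 0) (h0 : F p = 0) :
    IsOuterUnitNormal Ω p (N p) := by
  obtain ⟨hn, k, hk, hd⟩ := hF.self_of_nhds.2 h0
  exact isOuterUnitNormal_of_sublevel (hF.mono fun x hx => hx.1.continuousAt) h0 hk hn hd hΩ

theorem isOuterUnitNormal_of_mem_frontier {Ω : Set E3} {p : E3} {F : E3 → ℝ} {N : E3 → E3}
    (hF : ∀ᶠ q in 𝓝 p, IsDefiningAt F N q) (hΩ : ∀ᶠ x in 𝓝 p, x ∈ Ω ↔ F x < 0) :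
    ∀ᶠ q in 𝓝 p, q ∈ frontier Ω → IsOuterUnitNormal Ω q (N q) := by
  filter_upwards [eventually_eventually_nhds.2 hF, eventually_eventually_nhds.2 hΩ] with q h1 h2 hq
  exact isOuterUnitNormal_of_isDefiningAt h1 h2
    (eq_zero_of_mem_frontier_of_sublevel h1.self_of_nhds.1.continuousAt hq h2)

theorem isDefiningAt_sphere {R τ : ℝ} (hR : 0 < R) (hτ : |τ| = 1) (a q : E3) :
    IsDefiningAt (fun x => τ * (‖x - a‖ ^ 2 - R ^ 2)) (fun x => (τ / R) • (x - a)) q := by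
  constructor
  · exact contDiffAt_const.mul (((contDiffAt_id.sub contDiffAt_const).norm_sq ℝ).sub
      contDiffAt_const)
  · intro h
    have hτ0 : τ ≠ 0 := by rintro rfl; simp at hτ
    have h1 : ‖q - a‖ ^ 2 = R ^ 2 := by
      have := (mul_eq_zero.1 h).resolve_left hτ0
      linarith
    have h2 : ‖q - a‖ = R := by
      rwa [sq_eq_sq₀ (norm_nonneg _) hR.le] at h1
    refine ⟨?_, 2 * R, by positivity, ?_⟩
    · rw [norm_smul, h2, Real.norm_eq_abs, abs_div, hτ, abs_of_pos hR, one_div,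
        inv_mul_cancel₀ hR.ne']
    · have h3 := ((((hasFDerivAt_id q).sub_const a).norm_sq).sub_const (R ^ 2)).const_mul τ
      refine h3.congr_fderiv ?_
      ext v
      simp
      field_simp

theorem hasMeanCurvatureAt_of_sphere {Ω : Set E3} {R τ : ℝ} (hR : 0 < R) (hτ : |τ| = 1) {a p : E3}
    (hex : ∀ q ∈ frontier Ω, ∃ n, IsOuterUnitNormal Ω q n) (hp : ‖p - a‖ = R)
    (hΩ : ∀ᶠ x in 𝓝 p, x ∈ Ω ↔ τ * (‖x - a‖ ^ 2 - R ^ 2) < 0) :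
    HasMeanCurvatureAt Ω (τ / R) p := by
  have hA : HasFDerivAt (fun x => (τ / R) • (x - a)) ((τ / R) • ContinuousLinearMap.id ℝ E3) p :=
    ((hasFDerivAt_id p).sub_const a).const_smul (τ / R)
  have h := hasMeanCurvatureAt_of_local_normal hex (isOuterUnitNormal_of_mem_frontier
    (Eventually.of_forall (isDefiningAt_sphere hR hτ a)) hΩ) hA
  convert h using 1
  -- The linear field is of unit length only on the sphere, so the normal direction contributes: the
  -- trace `3 * τ / R` loses `τ / R`.
  rw [trace_eq_sum_coord]
  have h1 : inner ℝ ((τ / R) • (p - a)) ((τ / R) • (p - a)) = (1 : ℝ) := by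
    rw [real_inner_self_eq_norm_sq, norm_smul, hp, Real.norm_eq_abs, abs_div, hτ, abs_of_pos hR,
      one_div, inv_mul_cancel₀ hR.ne', one_pow]
  simp only [smul_apply, ContinuousLinearMap.coe_coe,
    ContinuousLinearMap.id_apply, inner_smul_left ((τ / R) • (p - a)), h1]
  simp

/-- The squared distance to the vertical axis. -/
def axisSq (q : E3) : ℝ := q 0 ^ 2 + q 1 ^ 2

theorem hasFDerivAt_axisSq (q : E3) : HasFDerivAt axisSq
    ((2 * q 0) • (EuclideanSpace.proj 0 : E3 →L[ℝ] ℝ) +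
      (2 * q 1) • (EuclideanSpace.proj 1 : E3 →L[ℝ] ℝ)) q := by
  have h : ∀ i : Fin 3, HasFDerivAt (fun q : E3 => q i ^ 2)
      ((2 * q i) • (EuclideanSpace.proj i : E3 →L[ℝ] ℝ)) q := fun i => by
    refine ((EuclideanSpace.proj i : E3 →L[ℝ] ℝ).hasFDerivAt.pow 2).congr_fderiv ?_
    ext v; simp
  exact (h 0).add (h 1)

theorem contDiff_axisSq : ContDiff ℝ ∞ axisSq := by
  have h : ∀ i : Fin 3, ContDiff ℝ ∞ (fun q : E3 => q i) := fun i =>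
    contDiff_piLp_apply (p := 2) (i := i)
  exact ((h 0).pow 2).add ((h 1).pow 2)

theorem continuous_axisSq : Continuous axisSq := contDiff_axisSq.continuous

theorem axisSq_nonneg (q : E3) : 0 ≤ axisSq q := by unfold axisSq; positivity

theorem norm_sq_eq_axisSq (q : E3) : ‖q‖ ^ 2 = axisSq q + q 2 ^ 2 := by
  rw [EuclideanSpace.norm_sq_eq, Fin.sum_univ_three]; simp [axisSq]

/-- The unit field normal to the radial graph with derivative `-descentRate m` and to its vertical
translates, scaled by `τ`. -/
noncomputable def graphNormal (τ : ℝ) (m : ℝ → ℝ) (q : E3) : E3 :=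
  τ • !₂[m (axisSq q) / axisSq q * q 0, m (axisSq q) / axisSq q * q 1,
    √(1 - m (axisSq q) ^ 2 / axisSq q)]

theorem norm_graphNormal {τ : ℝ} {m : ℝ → ℝ} {q : E3} (hτ : |τ| = 1) (hs : 0 < axisSq q)
    (hm : m (axisSq q) ^ 2 < axisSq q) : ‖graphNormal τ m q‖ = 1 := by
  have h0 : 0 ≤ 1 - m (axisSq q) ^ 2 / axisSq q := by
    rw [sub_nonneg, div_le_one hs]; exact hm.le
  rw [graphNormal, norm_smul, Real.norm_eq_abs, hτ, one_mul, ← sq_eq_sq₀ (norm_nonneg _) one_pos.le,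
    norm_sq_eq_axisSq]
  simp only [axisSq] at *
  simp
  rw [Real.sq_sqrt h0]
  field_simp
  ring

theorem hasFDerivAt_graph {τ l r : ℝ} {g m : ℝ → ℝ} {q : E3} (hl : 0 ≤ l)
    (hg : ∀ s ∈ Ioo l r, HasDerivAt g (-descentRate (m s) s) s)
    (hms : ∀ s ∈ Ioo l r, m s ^ 2 < s) (hq : axisSq q ∈ Ioo l r) :
    HasFDerivAt (fun x : E3 => τ * (x 2 - g (axisSq x)))
      ((1 / √(1 - m (axisSq q) ^ 2 / axisSq q)) • innerSL ℝ (graphNormal τ m q)) q := by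
  have hs : 0 < axisSq q := hl.trans_lt hq.1
  have h0 : 0 < 1 - m (axisSq q) ^ 2 / axisSq q := by
    rw [sub_pos, div_lt_one hs]; exact hms _ hq
  have h1 := Real.sqrt_pos.2 h0
  have h2 := (((EuclideanSpace.proj 2 : E3 →L[ℝ] ℝ).hasFDerivAt (x := q)).sub
    ((hg _ hq).comp_hasFDerivAt q (hasFDerivAt_axisSq q))).const_mul τ
  refine h2.congr_fderiv ?_
  ext v
  simp only [graphNormal, descentRate]
  set w := √(1 - m (axisSq q) ^ 2 / axisSq q)
  simp [PiLp.inner_apply, Fin.sum_univ_three]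
  field_simp
  ring

/-- The derivative of `g` is as smooth as `m`, so a `C¹` slope function yields a `C²` profile. -/
theorem contDiffAt_of_descentRate {l r : ℝ} {g m : ℝ → ℝ} (hl : 0 ≤ l) (hm : ContDiff ℝ 1 m)
    (hg : ∀ s ∈ Ioo l r, HasDerivAt g (-descentRate (m s) s) s)
    (hms : ∀ s ∈ Ioo l r, m s ^ 2 < s) {s : ℝ} (hs : s ∈ Ioo l r) : ContDiffAt ℝ 2 g s := by
  have h1 : ContDiffOn ℝ 1 (deriv g) (Ioo l r) := by
    apply ContDiffOn.congr (f := fun s => -descentRate (m s) s)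
    · exact fun s hs =>
        (contDiffAt_descentRate hm (hl.trans_lt hs.1) (hms s hs)).neg.contDiffWithinAt
    · exact fun s hs => (hg s hs).deriv
  have h2 : ContDiffOn ℝ (1 + 1) g (Ioo l r) :=
    (contDiffOn_succ_iff_deriv_of_isOpen isOpen_Ioo).2
      ⟨fun s hs => (hg s hs).differentiableAt.differentiableWithinAt, by simp, h1⟩
  rw [one_add_one_eq_two] at h2
  exact (h2 s hs).contDiffAt (isOpen_Ioo.mem_nhds hs)

theorem isDefiningAt_graph {τ l r : ℝ} {g m : ℝ → ℝ} {q : E3} (hτ : |τ| = 1) (hl : 0 ≤ l)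
    (hm : ContDiff ℝ 1 m) (hg : ∀ s ∈ Ioo l r, HasDerivAt g (-descentRate (m s) s) s)
    (hms : ∀ s ∈ Ioo l r, m s ^ 2 < s) (hq : axisSq q ∈ Ioo l r) :
    IsDefiningAt (fun x : E3 => τ * (x 2 - g (axisSq x))) (graphNormal τ m) q := by
  have hs : 0 < axisSq q := hl.trans_lt hq.1
  have h0 : 0 < 1 - m (axisSq q) ^ 2 / axisSq q := by
    rw [sub_pos, div_lt_one hs]; exact hms _ hq
  have h1 := Real.sqrt_pos.2 h0
  constructor
  · have h2 : ContDiffAt ℝ 2 (fun x : E3 => x 2) q :=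
      (contDiff_piLp_apply (p := 2) (i := 2)).contDiffAt
    have h3 : ContDiffAt ℝ 2 (fun x : E3 => g (axisSq x)) q :=
      (contDiffAt_of_descentRate hl hm hg hms hq).comp q
        (contDiff_axisSq.of_le (WithTop.coe_le_coe.2 le_top)).contDiffAt
    exact contDiffAt_const.mul (h2.sub h3)
  · exact fun _ => ⟨norm_graphNormal hτ hs (hms _ hq), _, by positivity,
      hasFDerivAt_graph hl hg hms hq⟩

theorem exists_hasFDerivAt_of_coord {f : E3 → E3} {p : E3} {L : Fin 3 → E3 →L[ℝ] ℝ}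
    (h : ∀ i, HasFDerivAt (fun q => f q i) (L i) p) :
    ∃ A : E3 →L[ℝ] E3, HasFDerivAt f A p ∧ ∀ v i, A v i = L i v := by
  refine ⟨(PiLp.continuousLinearEquiv 2 ℝ (fun _ : Fin 3 => ℝ)).symm.toContinuousLinearMap ∘L
    ContinuousLinearMap.pi L, ?_, fun v i => rfl⟩
  rw [← hasFDerivWithinAt_univ, hasFDerivWithinAt_euclidean]
  intro i
  rw [hasFDerivWithinAt_univ]
  exact h i

/-- Extend the unit normal independently of the height; then twice the mean curvature is its
divergence. Only the horizontal part `m s / s • (x, y)` contributes, and its divergence is `2 * (m /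
s) + 2 * s * (m / s)' = 2 * m'`. -/
theorem hasMeanCurvatureAt_of_graph {Ω : Set E3} {τ l r : ℝ} {g m : ℝ → ℝ} {p : E3} (hτ : |τ| = 1)
    (hl : 0 ≤ l) (hm : ContDiff ℝ 1 m)
    (hg : ∀ s ∈ Ioo l r, HasDerivAt g (-descentRate (m s) s) s)
    (hms : ∀ s ∈ Ioo l r, m s ^ 2 < s) (hp : axisSq p ∈ Ioo l r)
    (hex : ∀ q ∈ frontier Ω, ∃ n, IsOuterUnitNormal Ω q n)
    (hΩ : ∀ᶠ x in 𝓝 p, x ∈ Ω ↔ τ * (x 2 - g (axisSq x)) < 0) :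
    HasMeanCurvatureAt Ω (τ * deriv m (axisSq p)) p := by
  have hs : 0 < axisSq p := hl.trans_lt hp.1
  have hnear : ∀ᶠ q in 𝓝 p, axisSq q ∈ Ioo l r :=
    continuous_axisSq.continuousAt.eventually (isOpen_Ioo.mem_nhds hp)
  have h0 : 0 < 1 - m (axisSq p) ^ 2 / axisSq p := by
    rw [sub_pos, div_lt_one hs]; exact hms _ hp
  have hmd : HasDerivAt m (deriv m (axisSq p)) (axisSq p) :=
    (hm.differentiable one_ne_zero _).hasDerivAt
  obtain ⟨f', hf', hf⟩ : ∃ f' : ℝ, f' = (deriv m (axisSq p) * axisSq p - m (axisSq p)) /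
      axisSq p ^ 2 ∧ HasDerivAt (fun s => m s / s) f' (axisSq p) :=
    ⟨_, rfl, (hmd.div (hasDerivAt_id _) hs.ne').congr_deriv (by simp)⟩
  -- The value of `w'` is irrelevant: the vertical component does not depend on the height and adds
  -- nothing to the trace.
  obtain ⟨w', hw⟩ : ∃ w' : ℝ, HasDerivAt (fun s => √(1 - m s ^ 2 / s)) w' (axisSq p) :=
    ⟨_, (((hmd.pow 2).div (hasDerivAt_id _) hs.ne').const_sub 1).sqrt h0.ne'⟩
  have hf := hf.comp_hasFDerivAt p (hasFDerivAt_axisSq p)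
  have hw := hw.comp_hasFDerivAt p (hasFDerivAt_axisSq p)
  have hx := fun i : Fin 3 => (EuclideanSpace.proj i : E3 →L[ℝ] ℝ).hasFDerivAt (x := p)
  obtain ⟨A, hA, hAv⟩ := exists_hasFDerivAt_of_coord (f := graphNormal τ m) (p := p)
    (L := ![_, _, _]) (by
      intro i
      fin_cases i
      · exact (hf.mul (hx 0)).const_mul τ
      · exact (hf.mul (hx 1)).const_mul τ
      · exact hw.const_mul τ)
  have h := hasMeanCurvatureAt_of_local_normal hex (isOuterUnitNormal_of_mem_frontier
    (hnear.mono fun q hq => isDefiningAt_graph hτ hl hm hg hms hq) hΩ) hA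
  rw [inner_derivative_unit_field_eq_zero (hnear.mono fun q hq =>
    norm_graphNormal hτ (hl.trans_lt hq.1) (hms _ hq)) hA] at h
  convert h using 1
  rw [trace_eq_sum_coord]
  simp only [ContinuousLinearMap.coe_coe, hAv]
  simp [hf']
  have hsx : p 1 ^ 2 = axisSq p - p 0 ^ 2 := by unfold axisSq; ring
  field_simp
  ring_nf
  rw [hsx]
  ring

end DefiningFunctions

/-! ### The domain and its local descriptions -/

section Domain

open Set Filter Topology

theorem monotoneOn_Ioo_of_hasDerivAt {f f' : ℝ → ℝ} {l r : ℝ}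
    (h : ∀ s ∈ Ioo l r, HasDerivAt f (f' s) s) (h0 : ∀ s ∈ Ioo l r, 0 ≤ f' s) :
    MonotoneOn f (Ioo l r) := by
  refine monotoneOn_of_deriv_nonneg (convex_Ioo l r)
    (fun s hs => (h s hs).continuousAt.continuousWithinAt)
    (fun s hs => (h s (interior_subset hs)).differentiableAt.differentiableWithinAt) fun s hs => ?_
  rw [(h s (interior_subset hs)).deriv]
  exact h0 s (interior_subset hs)

theorem descentRate_le {m m' s : ℝ} (hs : 0 < s) (hm : m ^ 2 < s) (hm' : m' ^ 2 < s)
    (h : m ≤ m') : descentRate m s ≤ descentRate m' s := by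
  rcases h.eq_or_lt with rfl | h
  · exact le_rfl
  · exact (descentRate_lt hs hm hm' h).le

namespace NeckProfile

variable (P : NeckProfile)

theorem c_sq_pos : 0 < P.c ^ 2 := pow_pos P.c_pos 2

theorem a_le : P.a ≤ 1 / 16 := P.a_lt.le.trans P.s₁_le

theorem one_lt_R_sq : 1 < P.R ^ 2 := one_lt_pow₀ P.one_lt two_ne_zero

theorem descentRate_mb_nonneg {s : ℝ} (hs : P.c ^ 2 < s) : 0 ≤ descentRate (P.mb s) s := by
  have := P.mb_pos s
  have := P.c_sq_pos.trans hs
  unfold descentRate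
  positivity

theorem antitoneOn_B : AntitoneOn P.B (Ioo (P.c ^ 2) 1) := by
  have h := monotoneOn_Ioo_of_hasDerivAt (f := fun s => -P.B s)
    (fun s hs => (P.hasDerivAt_B s hs.1 hs.2).neg)
    (fun s hs => by rw [neg_neg]; exact P.descentRate_mb_nonneg hs.1)
  exact fun x hx y hy hxy => neg_le_neg_iff.1 (h hx hy hxy)

/-- By `s ≤ mb s` the lower graph descends at least as fast as the unit sphere, and the two agree at
`s₁`, so to the left of `s₁` the graph is above. With `T_le_sphere`, this shows that the neck only
cuts away from the shell. -/
theorem sphere_le_B {s : ℝ} (h1 : P.c ^ 2 < s) (h2 : s < 1) : √(1 - s) ≤ P.B s := by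
  rcases le_total P.s₁ s with hs | hs
  · exact (P.B_sphere s hs h2).ge
  have h := monotoneOn_Ioo_of_hasDerivAt (l := P.c ^ 2) (r := 1) (f := fun s => √(1 ^ 2 - s) - P.B s)
    (fun t ht => (hasDerivAt_sphere one_pos (P.c_sq_pos.trans ht.1) (by simpa using ht.2)).sub
      (P.hasDerivAt_B t ht.1 ht.2)) (fun t ht => by
      have h0 := P.c_sq_pos.trans ht.1
      have := descentRate_le (m := t / 1) h0 (by rw [div_one]; nlinarith [ht.2])
        (P.mb_sq_lt t ht.1 ht.2) (by rw [div_one]; exact P.le_mb t)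
      linarith)
  have hs1 : P.s₁ ∈ Ioo (P.c ^ 2) 1 := ⟨P.c_sq_lt.trans P.a_lt, by linarith [P.s₁_le]⟩
  have := h ⟨h1, h2⟩ hs1 hs
  simp only [P.B_sphere P.s₁ le_rfl hs1.2, one_pow, sub_self] at this
  linarith

theorem T_le_sphere {s : ℝ} (h1 : P.c ^ 2 < s) (h2 : s < P.R ^ 2) :
    P.T s ≤ P.h + √(P.R ^ 2 - s) := by
  rcases le_total P.s₁ s with hs | hs
  · exact (P.T_sphere s hs h2).le
  have hR : 0 < P.R := by linarith [P.one_lt]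
  have h := monotoneOn_Ioo_of_hasDerivAt (l := P.c ^ 2) (r := P.R ^ 2)
    (f := fun s => P.T s - √(P.R ^ 2 - s))
    (fun t ht => (P.hasDerivAt_T t ht.1 ht.2).sub
      (hasDerivAt_sphere hR (P.c_sq_pos.trans ht.1) ht.2)) (fun t ht => by
      have h0 := P.c_sq_pos.trans ht.1
      have := descentRate_le h0 (P.mt_sq_lt t ht.1 ht.2) (m' := t / P.R) (by
        rw [div_pow, div_lt_iff₀ (by positivity), pow_two t]
        exact mul_lt_mul_of_pos_left ht.2 h0) (P.mt_le t h0.le)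
      linarith)
  have hs1 : P.s₁ ∈ Ioo (P.c ^ 2) (P.R ^ 2) :=
    ⟨P.c_sq_lt.trans P.a_lt, by linarith [P.s₁_le, P.one_lt_R_sq]⟩
  have := h ⟨h1, h2⟩ hs1 hs
  simp only [P.T_sphere P.s₁ le_rfl hs1.2, add_sub_cancel_right] at this
  linarith

theorem one_lt_sqrt_div {s : ℝ} (h1 : P.c ^ 2 < s) : 1 < √s / P.c := by
  rw [one_lt_div P.c_pos]; exact Real.lt_sqrt_of_sq_lt h1

theorem monotoneOn_T_sub_B : MonotoneOn (fun s => P.T s - P.B s) (Ioo (P.c ^ 2) 1) := by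
  refine monotoneOn_Ioo_of_hasDerivAt
    (fun t ht => (P.hasDerivAt_T t ht.1 (ht.2.trans P.one_lt_R_sq)).sub
      (P.hasDerivAt_B t ht.1 ht.2)) (fun t ht => by
      have := descentRate_lt (P.c_sq_pos.trans ht.1)
        (P.mt_sq_lt t ht.1 (ht.2.trans P.one_lt_R_sq)) (P.mb_sq_lt t ht.1 ht.2) (P.mt_lt_mb t)
      linarith)

theorem B_lt_T {s : ℝ} (h1 : P.c ^ 2 < s) (h2 : s < 1) : P.B s < P.T s := by
  have hcat : ∀ s, P.c ^ 2 < s → s ≤ P.a → P.B s < P.T s := fun s h1 h2 => by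
    rw [P.T_catenoid s h1 h2, P.B_catenoid s h1 h2]
    have := mul_pos P.c_pos (Real.arcosh_pos (P.one_lt_sqrt_div h1))
    linarith
  rcases le_total s P.a with hs | hs
  · exact hcat s h1 hs
  have := P.monotoneOn_T_sub_B ⟨P.c_sq_lt, by linarith⟩ ⟨h1, h2⟩ hs
  have := hcat P.a P.c_sq_lt le_rfl
  simp only at *
  linarith

theorem half_lt_B {s : ℝ} (h1 : P.c ^ 2 < s) (h2 : s < 1 / 4) : 1 / 2 < P.B s := by
  refine lt_of_lt_of_le ?_ (P.sphere_le_B h1 (by linarith))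
  exact Real.lt_sqrt_of_sq_lt (by linarith)

theorem half_lt_z₀ : 1 / 2 < P.z₀ := by
  have h1 := P.half_lt_B P.c_sq_lt (by linarith [P.a_le])
  rw [P.B_catenoid P.a P.c_sq_lt le_rfl] at h1
  have := mul_pos P.c_pos (Real.arcosh_pos (P.one_lt_sqrt_div P.c_sq_lt))
  linarith

noncomputable def center : E3 := EuclideanSpace.single 2 P.h

theorem norm_center : ‖P.center‖ = |P.h| := by simp [center]

theorem norm_sub_center_sq (p : E3) : ‖p - P.center‖ ^ 2 = axisSq p + (p 2 - P.h) ^ 2 := by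
  rw [norm_sq_eq_axisSq]
  simp [center, axisSq]

/-- The open set between the two spheres with the neck removed. -/
def domain : Set E3 :=
  {p | 1 < ‖p‖ ∧ ‖p - P.center‖ < P.R ∧
    (0 < p 2 → axisSq p < 1 / 4 → P.c ^ 2 < axisSq p ∧ P.B (axisSq p) < p 2 ∧ p 2 < P.T (axisSq p))}

variable {P}

theorem one_lt_norm_iff {p : E3} : 1 < ‖p‖ ↔ 1 < axisSq p + p 2 ^ 2 := by
  rw [← norm_sq_eq_axisSq, one_lt_sq_iff₀ (norm_nonneg p)]

theorem norm_sub_center_lt_iff {p : E3} :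
    ‖p - P.center‖ < P.R ↔ axisSq p + (p 2 - P.h) ^ 2 < P.R ^ 2 := by
  rw [← norm_sub_center_sq, sq_lt_sq₀ (norm_nonneg _) (by linarith [P.one_lt])]

theorem abs_h_lt_quarter : -(1 / 4) < P.h ∧ P.h < 1 / 4 := by
  have h1 := abs_lt.1 (P.abs_h_lt)
  have h2 := P.R_le
  exact ⟨by linarith [h1.1], by linarith [h1.2]⟩

/-- Over the disc `s < 1 / 4`, points of height between 0 and `1 / 2` lie in the unit ball; beyond
`s₁` the two graphs are the spheres. Either way the neck condition adds nothing. -/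
theorem mem_domain_iff_of_low {p : E3} (hp : p 2 < 1 / 2 ∨ P.s₁ < axisSq p) :
    p ∈ P.domain ↔ 1 < ‖p‖ ∧ ‖p - P.center‖ < P.R := by
  refine ⟨fun h => ⟨h.1, h.2.1⟩, fun h => ⟨h.1, h.2, fun h0 hs => ?_⟩⟩
  rw [one_lt_norm_iff, norm_sub_center_lt_iff] at h
  rcases hp with hp | hp
  · exfalso
    nlinarith
  · have hc := P.c_sq_lt.trans (P.a_lt.trans hp)
    have hR := P.one_lt_R_sq
    refine ⟨hc, ?_, ?_⟩
    · rw [P.B_sphere _ hp.le (by linarith), Real.sqrt_lt' h0]; linarith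
    · rw [P.T_sphere _ hp.le (by linarith)]
      have : p 2 - P.h < √(P.R ^ 2 - axisSq p) := Real.lt_sqrt_of_sq_lt (by linarith)
      linarith

theorem mem_domain_iff_of_high {p : E3} (h0 : 0 < p 2) (hs : axisSq p < 1 / 4) :
    p ∈ P.domain ↔ P.c ^ 2 < axisSq p ∧ P.B (axisSq p) < p 2 ∧ p 2 < P.T (axisSq p) := by
  refine ⟨fun h => h.2.2 h0 hs, fun h => ⟨?_, ?_, fun _ _ => h⟩⟩
  · rw [one_lt_norm_iff]
    have := (Real.sqrt_lt' h0).1 ((P.sphere_le_B h.1 (by linarith)).trans_lt h.2.1)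
    linarith
  · have hR := P.one_lt_R_sq
    have hh := P.abs_h_lt_quarter
    rw [norm_sub_center_lt_iff]
    have h1 := h.2.2.trans_le (P.T_le_sphere h.1 (by linarith))
    have h2 := P.half_lt_B h.1 hs
    have h3 := (Real.lt_sqrt (x := p 2 - P.h) (by linarith [h.2.1])).1 (by linarith)
    linarith

theorem low_or_high (p : E3) : (p 2 < 1 / 2 ∨ P.s₁ < axisSq p) ∨ (0 < p 2 ∧ axisSq p < 1 / 4) := by
  by_contra! h
  have h1 := h.2 (by linarith [h.1.1])
  linarith [h.1.2, P.s₁_le]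

theorem continuous_coord (i : Fin 3) : Continuous (fun p : E3 => p i) :=
  (contDiff_piLp_apply (𝕜 := ℝ) (n := 0) (p := 2) (i := i)).continuous

theorem eventually_low {p : E3} (hp : p 2 < 1 / 2 ∨ P.s₁ < axisSq p) :
    ∀ᶠ q in 𝓝 p, q 2 < 1 / 2 ∨ P.s₁ < axisSq q := by
  rcases hp with h | h
  · exact ((continuous_coord 2).continuousAt.eventually (gt_mem_nhds h)).mono fun _ => Or.inl
  · exact (continuous_axisSq.continuousAt.eventually (lt_mem_nhds h)).mono fun _ => Or.inr

theorem eventually_high {p : E3} {r : ℝ} (h0 : 0 < p 2) (hs : axisSq p < r) :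
    ∀ᶠ q in 𝓝 p, 0 < q 2 ∧ axisSq q < r :=
  ((continuous_coord 2).continuousAt.eventually (lt_mem_nhds h0)).and
    (continuous_axisSq.continuousAt.eventually (gt_mem_nhds hs))

/-- A function whose sublevel set is `P.domain` away from the upper part of the neck. -/
theorem eventually_mem_domain_of_low {p : E3} (hp : p 2 < 1 / 2 ∨ P.s₁ < axisSq p) :
    ∀ᶠ q in 𝓝 p, q ∈ P.domain ↔ max (1 - ‖q‖) (‖q - P.center‖ - P.R) < 0 := by
  filter_upwards [eventually_low hp] with q hq
  rw [mem_domain_iff_of_low hq, max_lt_iff, sub_neg, sub_neg]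

theorem continuousAt_B {p : E3} (h1 : P.c ^ 2 < axisSq p) (h2 : axisSq p < 1) :
    ContinuousAt (fun q => P.B (axisSq q)) p :=
  ContinuousAt.comp (P.hasDerivAt_B _ h1 h2).continuousAt continuous_axisSq.continuousAt

theorem continuousAt_T {p : E3} (h1 : P.c ^ 2 < axisSq p) (h2 : axisSq p < P.R ^ 2) :
    ContinuousAt (fun q => P.T (axisSq q)) p :=
  ContinuousAt.comp (P.hasDerivAt_T _ h1 h2).continuousAt continuous_axisSq.continuousAt

theorem eventually_mem_domain_of_high {p : E3} (h0 : 0 < p 2) (h1 : P.c ^ 2 < axisSq p)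
    (hs : axisSq p < 1 / 4) :
    ∀ᶠ q in 𝓝 p, q ∈ P.domain ↔ max (P.B (axisSq q) - q 2) (q 2 - P.T (axisSq q)) < 0 := by
  filter_upwards [eventually_high h0 hs,
    continuous_axisSq.continuousAt.eventually (lt_mem_nhds h1)] with q hq hq1
  rw [mem_domain_iff_of_high hq.1 hq.2, max_lt_iff, sub_neg, sub_neg, and_iff_right hq1]

/-- Inverting `arcosh` merges both graphs into one smooth equation, which stays regular at the
waist, where each graph becomes vertical. -/
theorem eventually_mem_domain_of_neck {p : E3} (h0 : 0 < p 2) (hs : axisSq p < P.a) :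
    ∀ᶠ q in 𝓝 p, q ∈ P.domain ↔
      P.c ^ 2 * Real.cosh ((q 2 - P.z₀) / P.c) ^ 2 - axisSq q < 0 := by
  have hc := P.c_pos
  filter_upwards [eventually_high h0 hs] with q hq
  rw [mem_domain_iff_of_high hq.1 (by linarith [hq.2, P.a_le]), sub_neg, ← mul_pow]
  have hcosh := Real.one_le_cosh ((q 2 - P.z₀) / P.c)
  have hsq := axisSq_nonneg q
  constructor
  · rintro ⟨h1, h2, h3⟩
    rw [P.B_catenoid _ h1 hq.2.le] at h2
    rw [P.T_catenoid _ h1 hq.2.le] at h3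
    have h4 := P.one_lt_sqrt_div h1
    have h5 : |(q 2 - P.z₀) / P.c| < |Real.arcosh (√(axisSq q) / P.c)| := by
      rw [abs_of_pos (Real.arcosh_pos h4), abs_div, abs_of_pos hc, div_lt_iff₀ hc, abs_lt]
      constructor <;> linarith
    rw [← Real.cosh_lt_cosh, Real.cosh_arcosh h4.le, lt_div_iff₀ hc,
      Real.lt_sqrt (by positivity)] at h5
    rwa [mul_comm P.c]
  · intro h
    have h1 : P.c ^ 2 < axisSq q := by
      refine lt_of_le_of_lt ?_ h
      exact pow_le_pow_left₀ hc.le (le_mul_of_one_le_right hc.le hcosh) 2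
    refine ⟨h1, ?_⟩
    have h4 := P.one_lt_sqrt_div h1
    rw [mul_comm P.c, ← Real.lt_sqrt (by positivity), ← lt_div_iff₀ hc, ← Real.cosh_arcosh h4.le,
      Real.cosh_lt_cosh, abs_of_pos (Real.arcosh_pos h4), abs_div, abs_of_pos hc,
      div_lt_iff₀ hc, abs_lt] at h
    rw [P.B_catenoid _ h1 hq.2.le, P.T_catenoid _ h1 hq.2.le]
    constructor <;> linarith [h.1, h.2]

theorem isOpen_domain : IsOpen P.domain := by
  rw [isOpen_iff_mem_nhds]
  intro p hp
  rcases P.low_or_high p with h | h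
  · have h1 := eventually_mem_domain_of_low h
    have h2 : ContinuousAt (fun q => max (1 - ‖q‖) (‖q - P.center‖ - P.R)) p := by fun_prop
    filter_upwards [h1, h2.eventually (gt_mem_nhds (h1.self_of_nhds.1 hp))] with q hq hq'
    exact hq.2 hq'
  · have hc := ((mem_domain_iff_of_high h.1 h.2).1 hp).1
    have h1 := eventually_mem_domain_of_high h.1 hc h.2
    have hR := P.one_lt_R_sq
    have h2 : ContinuousAt (fun q => max (P.B (axisSq q) - q 2) (q 2 - P.T (axisSq q))) p :=
      ((continuousAt_B hc (by linarith)).sub (continuous_coord 2).continuousAt).max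
        ((continuous_coord 2).continuousAt.sub (continuousAt_T hc (by linarith)))
    filter_upwards [h1, h2.eventually (gt_mem_nhds (h1.self_of_nhds.1 hp))] with q hq hq'
    exact hq.2 hq'

theorem eventually_mem_domain_of_outer {p : E3} (hp : p 2 < 1 / 2 ∨ P.s₁ < axisSq p)
    (h : ‖p - P.center‖ = P.R) :
    ∀ᶠ q in 𝓝 p, q ∈ P.domain ↔ 1 * (‖q - P.center‖ ^ 2 - P.R ^ 2) < 0 := by
  have h1 : 1 < ‖p‖ := by
    have h2 := norm_sub_le p P.center
    rw [norm_center, h] at h2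
    linarith [P.abs_h_lt]
  filter_upwards [eventually_low hp, continuous_norm.continuousAt.eventually (lt_mem_nhds h1)]
    with q hq hq'
  rw [mem_domain_iff_of_low hq, one_mul, sub_neg, and_iff_right hq',
    sq_lt_sq₀ (norm_nonneg _) (by linarith [P.one_lt])]

theorem eventually_mem_domain_of_inner {p : E3} (hp : p 2 < 1 / 2 ∨ P.s₁ < axisSq p)
    (h : ‖p‖ = 1) : ∀ᶠ q in 𝓝 p, q ∈ P.domain ↔ -1 * (‖q - 0‖ ^ 2 - 1 ^ 2) < 0 := by
  have h1 : ‖p - P.center‖ < P.R := by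
    have h2 := norm_sub_le p P.center
    rw [norm_center, h] at h2
    linarith [P.abs_h_lt]
  have h2 : ContinuousAt (fun q => ‖q - P.center‖) p := by fun_prop
  filter_upwards [eventually_low hp, h2.eventually (gt_mem_nhds h1)] with q hq hq'
  rw [mem_domain_iff_of_low hq, and_iff_left hq', neg_one_mul, neg_lt_zero, sub_pos, sub_zero,
    sq_lt_sq₀ zero_le_one (norm_nonneg _)]

theorem eventually_mem_domain_of_top {p : E3} (h1 : P.c ^ 2 < axisSq p) (h2 : axisSq p < 1 / 4)
    (h : p 2 = P.T (axisSq p)) :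
    ∀ᶠ q in 𝓝 p, q ∈ P.domain ↔ 1 * (q 2 - P.T (axisSq q)) < 0 := by
  have hBT := P.B_lt_T h1 (by linarith)
  have hB := P.half_lt_B h1 h2
  have h3 : P.B (axisSq p) - p 2 < 0 := by linarith
  filter_upwards [eventually_mem_domain_of_high (by linarith) h1 h2, ((continuousAt_B h1
    (by linarith)).sub (continuous_coord 2).continuousAt).eventually (gt_mem_nhds h3)] with q hq hq'
  rw [hq, max_lt_iff, one_mul]
  exact and_iff_right hq'

theorem eventually_mem_domain_of_bottom {p : E3} (h1 : P.c ^ 2 < axisSq p)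
    (h2 : axisSq p < 1 / 4) (h : p 2 = P.B (axisSq p)) :
    ∀ᶠ q in 𝓝 p, q ∈ P.domain ↔ -1 * (q 2 - P.B (axisSq q)) < 0 := by
  have hBT := P.B_lt_T h1 (by linarith)
  have hB := P.half_lt_B h1 h2
  have hR := P.one_lt_R_sq
  have h3 : p 2 - P.T (axisSq p) < 0 := by linarith
  filter_upwards [eventually_mem_domain_of_high (by linarith) h1 h2, ((continuous_coord
    2).continuousAt.sub (continuousAt_T h1 (by linarith))).eventually (gt_mem_nhds h3)] with q hq hq'
  rw [hq, max_lt_iff, neg_one_mul, neg_sub]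
  exact and_iff_left hq'

theorem mem_frontier_domain_cases {p : E3} (hp : p ∈ frontier P.domain) :
    ((p 2 < 1 / 2 ∨ P.s₁ < axisSq p) ∧ (‖p‖ = 1 ∨ ‖p - P.center‖ = P.R)) ∨
    (P.c ^ 2 < axisSq p ∧ axisSq p ≤ P.s₁ ∧ (p 2 = P.T (axisSq p) ∨ p 2 = P.B (axisSq p))) ∨
    (axisSq p = P.c ^ 2 ∧ p 2 = P.z₀) := by
  have hmax : ∀ x y : ℝ, max x y = 0 → x = 0 ∨ y = 0 := fun x y h => by
    rcases max_choice x y with h' | h' <;> rw [h'] at h <;> simp [h]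
  by_cases hlow : p 2 < 1 / 2 ∨ P.s₁ < axisSq p
  · left
    refine ⟨hlow, ?_⟩
    have := eq_zero_of_mem_frontier_of_sublevel (by fun_prop) hp (eventually_mem_domain_of_low hlow)
    rcases hmax _ _ this with h | h
    · left; linarith
    · right; linarith
  · right
    have hs₁ := P.s₁_le
    have hR := P.one_lt_R_sq
    push Not at hlow
    have h0 : 0 < p 2 := by linarith
    rcases lt_or_ge (P.c ^ 2) (axisSq p) with hc | hc
    · left
      refine ⟨hc, hlow.2, ?_⟩
      have h2 : ContinuousAt (fun q => max (P.B (axisSq q) - q 2) (q 2 - P.T (axisSq q))) p :=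
        ((continuousAt_B hc (by linarith)).sub (continuous_coord 2).continuousAt).max
          ((continuous_coord 2).continuousAt.sub (continuousAt_T hc (by linarith)))
      have := eq_zero_of_mem_frontier_of_sublevel h2 hp
        (eventually_mem_domain_of_high h0 hc (by linarith))
      rcases hmax _ _ this with h | h
      · right; linarith
      · left; linarith
    -- Here `s ≤ c ^ 2`, while the catenoid equation gives `s = c ^ 2 * cosh ^ 2 ≥ c ^ 2`; so `cosh
    -- = 1`, and the point is on the waist circle.
    · right
      have hcont : Continuous fun q : E3 =>
          P.c ^ 2 * Real.cosh ((q 2 - P.z₀) / P.c) ^ 2 - axisSq q :=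
        (continuous_const.mul ((Real.continuous_cosh.comp
          (((continuous_coord 2).sub continuous_const).div_const _)).pow 2)).sub continuous_axisSq
      have h := eq_zero_of_mem_frontier_of_sublevel hcont.continuousAt hp
        (eventually_mem_domain_of_neck h0 (hc.trans_lt P.c_sq_lt))
      have hcs := P.c_sq_pos
      have hcosh := Real.one_le_cosh ((p 2 - P.z₀) / P.c)
      have h1 : 1 ≤ Real.cosh ((p 2 - P.z₀) / P.c) ^ 2 := one_le_pow₀ hcosh
      have h2 := le_mul_of_one_le_right hcs.le h1
      have h3 : Real.cosh ((p 2 - P.z₀) / P.c) ^ 2 = 1 := by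
        have : P.c ^ 2 * Real.cosh ((p 2 - P.z₀) / P.c) ^ 2 = P.c ^ 2 * 1 := by linarith
        exact mul_left_cancel₀ hcs.ne' this
      refine ⟨by rw [h3] at h; linarith, ?_⟩
      have h4 : Real.cosh ((p 2 - P.z₀) / P.c) = 1 := by nlinarith
      by_contra hne
      have h5 : (p 2 - P.z₀) / P.c ≠ 0 := div_ne_zero (sub_ne_zero.2 hne) P.c_pos.ne'
      exact (Real.one_lt_cosh.2 h5).ne' h4

end NeckProfile

end Domain

/-! ### Regularity and mean curvature of the boundary -/

section DomainBoundary

open Set Filter Topology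

theorem mem_frontier_of_isDefiningAt {Ω : Set E3} {p : E3} {F : E3 → ℝ} {N : E3 → E3}
    (hF : ∀ᶠ q in 𝓝 p, IsDefiningAt F N q) (hΩ : ∀ᶠ x in 𝓝 p, x ∈ Ω ↔ F x < 0) (h0 : F p = 0) :
    p ∈ frontier Ω :=
  ⟨(isOuterUnitNormal_of_isDefiningAt hF hΩ h0).mem_closure, fun h =>
    (hΩ.self_of_nhds.1 (interior_subset h)).ne h0⟩

namespace NeckProfile

variable {P : NeckProfile}

theorem eventually_isDefiningAt_T {p : E3} (h1 : P.c ^ 2 < axisSq p) (h2 : axisSq p < P.R ^ 2) :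
    ∀ᶠ q in 𝓝 p, IsDefiningAt (fun x => 1 * (x 2 - P.T (axisSq x))) (graphNormal 1 P.mt) q :=
  (continuous_axisSq.continuousAt.eventually (isOpen_Ioo.mem_nhds ⟨h1, h2⟩)).mono fun _ hq =>
    isDefiningAt_graph (by simp) P.c_sq_pos.le P.contDiff_mt
      (fun s hs => P.hasDerivAt_T s hs.1 hs.2) (fun s hs => P.mt_sq_lt s hs.1 hs.2) hq

theorem eventually_isDefiningAt_B {p : E3} (h1 : P.c ^ 2 < axisSq p) (h2 : axisSq p < 1) :
    ∀ᶠ q in 𝓝 p, IsDefiningAt (fun x => -1 * (x 2 - P.B (axisSq x))) (graphNormal (-1) P.mb) q :=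
  (continuous_axisSq.continuousAt.eventually (isOpen_Ioo.mem_nhds ⟨h1, h2⟩)).mono fun _ hq =>
    isDefiningAt_graph (by simp) P.c_sq_pos.le P.contDiff_mb
      (fun s hs => P.hasDerivAt_B s hs.1 hs.2) (fun s hs => P.mb_sq_lt s hs.1 hs.2) hq

theorem eventually_isDefiningAt_outer (p : E3) :
    ∀ᶠ q in 𝓝 p, IsDefiningAt (fun x => 1 * (‖x - P.center‖ ^ 2 - P.R ^ 2))
      (fun x => (1 / P.R) • (x - P.center)) q :=
  Eventually.of_forall fun q => isDefiningAt_sphere (by linarith [P.one_lt]) (by simp) _ q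

theorem eventually_isDefiningAt_inner (p : E3) :
    ∀ᶠ q in 𝓝 p, IsDefiningAt (fun x => -1 * (‖x - 0‖ ^ 2 - 1 ^ 2))
      (fun x => (-1 / 1 : ℝ) • (x - 0)) q :=
  Eventually.of_forall fun q => isDefiningAt_sphere one_pos (by simp) _ q

theorem contDiff_catenoid :
    ContDiff ℝ 2 (fun q : E3 => P.c ^ 2 * Real.cosh ((q 2 - P.z₀) / P.c) ^ 2 - axisSq q) := by
  have h : ContDiff ℝ 2 (fun q : E3 => q 2) := contDiff_piLp_apply (p := 2) (i := 2)
  exact (contDiff_const.mul ((Real.contDiff_cosh.comp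
    ((h.sub contDiff_const).div_const _)).pow 2)).sub
      (contDiff_axisSq.of_le (WithTop.coe_le_coe.2 le_top))

theorem hasFDerivAt_catenoid_waist {p : E3} (hz : p 2 = P.z₀) : HasFDerivAt
    (fun q : E3 => P.c ^ 2 * Real.cosh ((q 2 - P.z₀) / P.c) ^ 2 - axisSq q)
    ((2 * P.c) • innerSL ℝ (!₂[-(p 0 / P.c), -(p 1 / P.c), 0] : E3)) p := by
  have h1 : HasDerivAt (fun z => P.c ^ 2 * Real.cosh ((z - P.z₀) / P.c) ^ 2) 0 (p 2) := by
    refine ((((((hasDerivAt_id (p 2)).sub_const P.z₀).div_const P.c).cosh).pow 2).const_mul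
      (P.c ^ 2)).congr_deriv ?_
    simp [hz]
  refine ((h1.comp_hasFDerivAt p (EuclideanSpace.proj 2 : E3 →L[ℝ] ℝ).hasFDerivAt).sub
    (hasFDerivAt_axisSq p)).congr_fderiv ?_
  have := P.c_pos
  ext v
  simp [PiLp.inner_apply, Fin.sum_univ_three]
  field_simp
  ring

/-- Near each boundary point, the domain is a sublevel set of a function with nonzero gradient. -/
theorem exists_isDefiningAt {p : E3} (hp : p ∈ frontier P.domain) :
    ∃ (F : E3 → ℝ) (k : ℝ) (n : E3), ContDiffAt ℝ 2 F p ∧ 0 < k ∧ ‖n‖ = 1 ∧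
      HasFDerivAt F (k • innerSL ℝ n) p ∧ (∀ᶠ x in 𝓝 p, ContinuousAt F x) ∧
      ∀ᶠ x in 𝓝 p, x ∈ P.domain ↔ F x < 0 := by
  have key : ∀ {F : E3 → ℝ} {N : E3 → E3}, (∀ᶠ q in 𝓝 p, IsDefiningAt F N q) →
      (∀ᶠ x in 𝓝 p, x ∈ P.domain ↔ F x < 0) → ∃ (F : E3 → ℝ) (k : ℝ) (n : E3),
      ContDiffAt ℝ 2 F p ∧ 0 < k ∧ ‖n‖ = 1 ∧ HasFDerivAt F (k • innerSL ℝ n) p ∧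
      (∀ᶠ x in 𝓝 p, ContinuousAt F x) ∧ ∀ᶠ x in 𝓝 p, x ∈ P.domain ↔ F x < 0 := by
    intro F N hF hΩ
    have h1 := hF.self_of_nhds
    obtain ⟨hn, k, hk, hd⟩ := h1.2 (eq_zero_of_mem_frontier_of_sublevel h1.1.continuousAt hp hΩ)
    exact ⟨F, k, N p, h1.1, hk, hn, hd, hF.mono fun x hx => hx.1.continuousAt, hΩ⟩
  have hs₁ := P.s₁_le
  have hR := P.one_lt_R_sq
  rcases mem_frontier_domain_cases hp with ⟨hlow, h | h⟩ | ⟨h1, h2, h | h⟩ | ⟨h1, h2⟩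
  · exact key (eventually_isDefiningAt_inner p) (eventually_mem_domain_of_inner hlow h)
  · exact key (eventually_isDefiningAt_outer p) (eventually_mem_domain_of_outer hlow h)
  · exact key (eventually_isDefiningAt_T h1 (by linarith))
      (eventually_mem_domain_of_top h1 (by linarith) h)
  · exact key (eventually_isDefiningAt_B h1 (by linarith))
      (eventually_mem_domain_of_bottom h1 (by linarith) h)
  · refine ⟨_, 2 * P.c, !₂[-(p 0 / P.c), -(p 1 / P.c), 0], contDiff_catenoid.contDiffAt,
      by linarith [P.c_pos], ?_, hasFDerivAt_catenoid_waist h2,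
      Eventually.of_forall fun x => contDiff_catenoid.continuous.continuousAt,
      eventually_mem_domain_of_neck (by linarith [P.half_lt_z₀]) (h1.trans_lt P.c_sq_lt)⟩
    rw [← sq_eq_sq₀ (norm_nonneg _) one_pos.le, norm_sq_eq_axisSq]
    have hc := P.c_sq_pos
    simp only [axisSq] at *
    simp
    rw [div_pow, div_pow, ← add_div, h1, div_self hc.ne']

theorem hasC11Boundary_domain : HasC11Boundary P.domain := fun p hp => by
  obtain ⟨F, k, n, hF, hk, hn, hd, -, hΩ⟩ := exists_isDefiningAt hp
  exact exists_subgraph_chart hF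
    (eq_zero_of_mem_frontier_of_sublevel hF.continuousAt hp hΩ) hk hn hd hΩ

theorem exists_isOuterUnitNormal {p : E3} (hp : p ∈ frontier P.domain) :
    ∃ n, IsOuterUnitNormal P.domain p n := by
  obtain ⟨F, k, n, hF, hk, hn, hd, hc, hΩ⟩ := exists_isDefiningAt hp
  exact ⟨n, isOuterUnitNormal_of_sublevel hc
    (eq_zero_of_mem_frontier_of_sublevel hF.continuousAt hp hΩ) hk hn hd hΩ⟩

/-- The values are `-1` on the unit sphere, `1 / R` on the outer one, and `mt'` and `-mb'` on the
graphs. The waist is left out because the graph formula fails there and a circle is a null set. -/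
theorem exists_hasMeanCurvatureAt {p : E3} (hp : p ∈ frontier P.domain)
    (hw : ¬(axisSq p = P.c ^ 2 ∧ p 2 = P.z₀)) :
    ∃ H : ℝ, |H| ≤ 1 ∧ HasMeanCurvatureAt P.domain H p := by
  have hs₁ := P.s₁_le
  have hR := P.one_lt_R_sq
  have hR1 := P.one_lt
  have hex := fun q (hq : q ∈ frontier P.domain) => exists_isOuterUnitNormal hq
  rcases mem_frontier_domain_cases hp with ⟨hlow, h | h⟩ | ⟨h1, h2, h | h⟩ | h
  · exact ⟨-1 / 1, by simp, hasMeanCurvatureAt_of_sphere one_pos (by simp) hex (by simpa using h)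
      (eventually_mem_domain_of_inner hlow h)⟩
  · refine ⟨1 / P.R, ?_, hasMeanCurvatureAt_of_sphere (by linarith) (by simp) hex h
      (eventually_mem_domain_of_outer hlow h)⟩
    rw [abs_of_pos (by positivity), div_le_one (by linarith)]
    exact hR1.le
  · exact ⟨1 * deriv P.mt (axisSq p), by rw [one_mul]; exact P.deriv_mt _,
      hasMeanCurvatureAt_of_graph (r := P.R ^ 2) (by simp) P.c_sq_pos.le P.contDiff_mt
      (fun s hs => P.hasDerivAt_T s hs.1 hs.2) (fun s hs => P.mt_sq_lt s hs.1 hs.2)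
      ⟨h1, by linarith⟩ hex (eventually_mem_domain_of_top h1 (by linarith) h)⟩
  · exact ⟨-1 * deriv P.mb (axisSq p), by rw [neg_one_mul, abs_neg]; exact P.deriv_mb _,
      hasMeanCurvatureAt_of_graph (r := 1) (by simp) P.c_sq_pos.le P.contDiff_mb
      (fun s hs => P.hasDerivAt_B s hs.1 hs.2) (fun s hs => P.mb_sq_lt s hs.1 hs.2)
      ⟨h1, by linarith⟩ hex (eventually_mem_domain_of_bottom h1 (by linarith) h)⟩
  · exact absurd h hw

/-- A mean curvature function bounded by `1` exists as soon as the waist circle is a null set. -/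
theorem exists_meanCurvature
    (hw : (Measure.euclideanHausdorffMeasure 2 : Measure E3)
      {p : E3 | axisSq p = P.c ^ 2 ∧ p 2 = P.z₀} = 0) :
    ∃ H : E3 → ℝ, (∀ᵐ p ∂(surfaceMeasure P.domain), HasMeanCurvatureAt P.domain (H p) p) ∧
      eLpNorm H ⊤ (surfaceMeasure P.domain) ≤ 1 := by
  classical
  let H : E3 → ℝ := fun p =>
    if h : ∃ H : ℝ, |H| ≤ 1 ∧ HasMeanCurvatureAt P.domain H p then h.choose else 0
  refine ⟨H, ?_, ?_⟩
  · have h1 : ∀ᵐ p ∂(surfaceMeasure P.domain), p ∈ frontier P.domain :=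
      ae_restrict_mem isClosed_frontier.measurableSet
    have h2 : ∀ᵐ p ∂(surfaceMeasure P.domain), ¬(axisSq p = P.c ^ 2 ∧ p 2 = P.z₀) := by
      rw [ae_iff]
      simp only [not_not]
      exact Measure.absolutelyContinuous_of_le Measure.restrict_le_self hw
    filter_upwards [h1, h2] with p hp hp'
    have h := exists_hasMeanCurvatureAt hp hp'
    simp only [H, dif_pos h]
    exact h.choose_spec.2
  · rw [← ENNReal.ofReal_one]
    refine (eLpNorm_le_of_ae_bound (C := 1) (Eventually.of_forall fun p => ?_)).trans ?_
    · by_cases h : ∃ H : ℝ, |H| ≤ 1 ∧ HasMeanCurvatureAt P.domain H p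
      · simp only [H, dif_pos h]; exact h.choose_spec.1
      · simp [H, dif_neg h]
    · simp

end NeckProfile

end DomainBoundary

/-! ### Rays from the origin and the diffeomorphism with the ball -/

section DomainRays

open Set Filter Topology

theorem axisSq_rayPoint (ξ : EuclideanSpace ℝ (Fin 2)) (t : ℝ) :
    axisSq (rayPoint (ξ, t)) = (t * ‖ξ‖) ^ 2 := by
  rw [axisSq, rayPoint_zero, rayPoint_one, mul_pow t ‖ξ‖, EuclideanSpace.norm_sq_eq,
    Fin.sum_univ_two]
  simp only [Real.norm_eq_abs, sq_abs]
  ring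

namespace NeckProfile

variable {P : NeckProfile}

theorem c_sq_lt_axisSq {p : E3} (hp : p ∈ P.domain) (h0 : 0 < p 2) : P.c ^ 2 < axisSq p := by
  rcases lt_or_ge (axisSq p) (1 / 4) with h | h
  · exact (hp.2.2 h0 h).1
  · linarith [P.c_sq_lt, P.a_le]

theorem lt_T_of_mem_domain {p : E3} (hp : p ∈ P.domain) (h0 : 0 < p 2) :
    axisSq p < P.R ^ 2 ∧ p 2 < P.T (axisSq p) := by
  have h1 := norm_sub_center_lt_iff.1 hp.2.1
  have h2 : axisSq p < P.R ^ 2 := by nlinarith [sq_nonneg (p 2 - P.h)]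
  refine ⟨h2, ?_⟩
  rcases lt_or_ge (axisSq p) (1 / 4) with h | h
  · exact (hp.2.2 h0 h).2.2
  · rw [P.T_sphere _ (by linarith [P.s₁_le]) h2]
    have : p 2 - P.h < √(P.R ^ 2 - axisSq p) := Real.lt_sqrt_of_sq_lt (by linarith)
    linarith

/-- The outer profile is concave as a function of the distance to the axis. -/
theorem concaveOn_T_sq : ConcaveOn ℝ (Ioo P.c P.R) (fun ρ => P.T (ρ ^ 2)) := by
  have hR := P.one_lt
  have hc := P.c_pos
  have hsq : ∀ ρ ∈ Ioo P.c P.R, P.c ^ 2 < ρ ^ 2 ∧ ρ ^ 2 < P.R ^ 2 := fun ρ hρ =>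
    ⟨pow_lt_pow_left₀ hρ.1 hc.le two_ne_zero,
      pow_lt_pow_left₀ hρ.2 (hc.trans hρ.1).le two_ne_zero⟩
  have hd : ∀ ρ ∈ Ioo P.c P.R,
      HasDerivAt (fun ρ => P.T (ρ ^ 2)) (-tanOfSin (P.mt (ρ ^ 2) / √(ρ ^ 2))) ρ := by
    intro ρ hρ
    have h0 : 0 < ρ := hc.trans hρ.1
    have h1 : HasDerivAt (fun ρ : ℝ => ρ ^ 2) (2 * ρ) ρ := by
      refine ((hasDerivAt_id ρ).pow 2).congr_deriv ?_
      simp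
    refine ((P.hasDerivAt_T _ (hsq ρ hρ).1 (hsq ρ hρ).2).comp (h := fun ρ : ℝ => ρ ^ 2) ρ h1).congr_deriv ?_
    rw [descentRate_eq (by positivity), Real.sqrt_sq h0.le]
    field_simp
  refine AntitoneOn.concaveOn_of_deriv (convex_Ioo _ _)
    (fun ρ hρ => (hd ρ hρ).continuousAt.continuousWithinAt)
    (fun ρ hρ => (hd ρ (interior_subset hρ)).differentiableAt.differentiableWithinAt) ?_
  rw [interior_Ioo]
  intro x hx y hy hxy
  rw [(hd x hx).deriv, (hd y hy).deriv, neg_le_neg_iff]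
  have hx' := hsq x hx
  have hy' := hsq y hy
  exact strictMonoOn_tanOfSin.monotoneOn
    (div_sqrt_mem_Ioo (P.c_sq_pos.trans hx'.1) (P.mt_sq_lt _ hx'.1 hx'.2))
    (div_sqrt_mem_Ioo (P.c_sq_pos.trans hy'.1) (P.mt_sq_lt _ hy'.1 hy'.2))
    (P.mt_mono hx' hy' (pow_le_pow_left₀ (hc.trans hx.1).le hxy 2))

/-- Each condition persists between two points of a ray: the norm increases, the outer ball is
convex, on upward rays the height increases while `B` does not, and `T` is concave in the distance
to the axis, which is proportional to the parameter. -/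
theorem ordConnected_ray (ξ : EuclideanSpace ℝ (Fin 2)) :
    OrdConnected {t | 0 < t ∧ rayPoint (ξ, t) ∈ P.domain} := by
  rw [ordConnected_iff]
  rintro t₁ ⟨h1, hp1⟩ t₂ ⟨h2, hp2⟩ h12 t ⟨ht1, ht2⟩
  have h0 : 0 < t := h1.trans_le ht1
  refine ⟨h0, ?_, ?_, ?_⟩
  · refine hp1.1.trans_le ?_
    rw [norm_rayPoint h1, norm_rayPoint h0]
    exact mul_le_mul_of_nonneg_right ht1 (by positivity)
  · have hconv := convex_ball P.center P.R
    have hseg : rayPoint (ξ, t) ∈ segment ℝ (rayPoint (ξ, t₁)) (rayPoint (ξ, t₂)) := by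
      obtain ⟨α, β, hα, hβ, hαβ, h⟩ : t ∈ segment ℝ t₁ t₂ := by
        rw [segment_eq_Icc h12]; exact ⟨ht1, ht2⟩
      refine ⟨α, β, hα, hβ, hαβ, ?_⟩
      simp only [rayPoint, smul_smul, ← add_smul]
      rw [← h]; simp
    have := hconv.segment_subset (mem_ball_iff_norm.2 hp1.2.1) (mem_ball_iff_norm.2 hp2.2.1) hseg
    exact mem_ball_iff_norm.1 this
  · intro hz hs
    have hw : 0 < (‖ξ‖ ^ 2 - 1) / 2 := by
      rw [rayPoint_two] at hz
      exact pos_of_mul_pos_right hz h0.le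
    have hz1 : 0 < rayPoint (ξ, t₁) 2 := by rw [rayPoint_two]; exact mul_pos h1 hw
    have hz2 : 0 < rayPoint (ξ, t₂) 2 := by rw [rayPoint_two]; exact mul_pos h2 hw
    have hs1 : axisSq (rayPoint (ξ, t₁)) ≤ axisSq (rayPoint (ξ, t)) := by
      rw [axisSq_rayPoint, axisSq_rayPoint]
      gcongr
    obtain ⟨hc1, hB1, hT1⟩ := hp1.2.2 hz1 (hs1.trans_lt hs)
    obtain ⟨hR2, hT2⟩ := lt_T_of_mem_domain hp2 hz2
    have hc2 := c_sq_lt_axisSq hp2 hz2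
    have hR1 := (lt_T_of_mem_domain hp1 hz1).1
    refine ⟨hc1.trans_le hs1, ?_, ?_⟩
    · refine (P.antitoneOn_B ⟨hc1, by linarith⟩ ⟨hc1.trans_le hs1, by linarith⟩ hs1).trans_lt
        (hB1.trans_le ?_)
      rw [rayPoint_two, rayPoint_two]
      exact mul_le_mul_of_nonneg_right ht1 hw.le
    · rw [axisSq_rayPoint] at hc1 hc2 hR1 hR2 hT1 hT2 ⊢
      rw [rayPoint_two] at hT1 hT2 ⊢
      have hmem : ∀ τ, 0 < τ → P.c ^ 2 < (τ * ‖ξ‖) ^ 2 → (τ * ‖ξ‖) ^ 2 < P.R ^ 2 →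
          τ * ‖ξ‖ ∈ Ioo P.c P.R := fun τ hτ h h' =>
        ⟨lt_of_pow_lt_pow_left₀ 2 (by positivity) h,
          lt_of_pow_lt_pow_left₀ 2 (by linarith [P.one_lt]) h'⟩
      obtain ⟨α, β, hα, hβ, hαβ, h⟩ : t ∈ segment ℝ t₁ t₂ := by
        rw [segment_eq_Icc h12]; exact ⟨ht1, ht2⟩
      have hconc := P.concaveOn_T_sq.2 (hmem t₁ h1 hc1 hR1) (hmem t₂ h2 hc2 hR2) hα hβ hαβ
      simp only [smul_eq_mul] at hconc h
      have e : α * (t₁ * ‖ξ‖) + β * (t₂ * ‖ξ‖) = t * ‖ξ‖ := by rw [← h]; ring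
      rw [e] at hconc
      refine lt_of_lt_of_le ?_ hconc
      rw [← h]
      simp only at hT1 hT2 ⊢
      rcases hα.eq_or_lt with h | h
      · have hβ1 : β = 1 := by linarith
        rw [← h, hβ1]; simpa using hT2
      · have e1 := mul_lt_mul_of_pos_left hT1 h
        have e2 := mul_le_mul_of_nonneg_left hT2.le hβ
        linarith

theorem lt_norm_of_mem_domain {p : E3} (hp : p ∈ P.domain) : p 2 < ‖p‖ := by
  apply coord_two_lt_norm
  by_contra! h
  have hs : axisSq p = 0 := le_antisymm h.1 (axisSq_nonneg p)
  have h1 := one_lt_norm_iff.1 hp.1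
  have h0 : 0 < p 2 := lt_of_le_of_ne h.2 fun h0 => by rw [hs, ← h0] at h1; norm_num at h1
  have := c_sq_lt_axisSq hp h0
  rw [hs] at this
  linarith [P.c_sq_pos]

variable (P) in
/-- The directions, as the norm of their stereographic projection from the north pole, of rays that
meet the domain. -/
def directions : Set ℝ :=
  {ρ | 0 ≤ ρ ∧ ∃ t : ℝ, 0 < t ∧ rayPoint (EuclideanSpace.single 0 ρ, t) ∈ P.domain}

theorem rayPoint_mem_domain_congr {ξ ζ : EuclideanSpace ℝ (Fin 2)} (h : ‖ξ‖ = ‖ζ‖) {t : ℝ} :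
    rayPoint (ξ, t) ∈ P.domain ↔ rayPoint (ζ, t) ∈ P.domain := by
  simp only [domain, mem_ofPred_eq, one_lt_norm_iff, norm_sub_center_lt_iff, axisSq_rayPoint,
    rayPoint_two, h]

theorem norm_mem_directions_iff {ξ : EuclideanSpace ℝ (Fin 2)} :
    ‖ξ‖ ∈ P.directions ↔ ∃ t : ℝ, 0 < t ∧ rayPoint (ξ, t) ∈ P.domain := by
  rw [directions, mem_ofPred_eq, and_iff_right (norm_nonneg ξ)]
  refine exists_congr fun t => and_congr_right fun _ => rayPoint_mem_domain_congr ?_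
  simp

theorem exists_directions_gt {ρ : ℝ} (hρ : ρ ∈ P.directions) : ∃ ρ' ∈ P.directions, ρ < ρ' := by
  obtain ⟨h0, t, ht, hp⟩ := hρ
  have hc : Continuous fun ρ : ℝ => rayPoint (EuclideanSpace.single 0 ρ, t) :=
    (contDiff_rayPoint (n := 0)).continuous.comp
      ((Isometry.of_dist_eq fun x y => PiLp.dist_single_same 2 (fun _ : Fin 2 => ℝ) 0 x
        y).continuous.prodMk continuous_const)
  have h1 := (hc.continuousAt (x := ρ)).eventually (P.isOpen_domain.mem_nhds hp)
  have h2 : ∀ᶠ ρ' in 𝓝[>] ρ, rayPoint (EuclideanSpace.single 0 ρ', t) ∈ P.domain :=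
    h1.filter_mono nhdsWithin_le_nhds
  obtain ⟨ρ', h3, h4⟩ := (h2.and self_mem_nhdsWithin).exists
  exact ⟨ρ', ⟨h0.trans h4.le, t, ht, h3⟩, h4⟩

theorem norm_lt_of_mem_domain {p : E3} (hp : p ∈ P.domain) : ‖p‖ < 3 / 2 := by
  have h1 := norm_le_norm_sub_add p P.center
  rw [norm_center] at h1
  linarith [hp.2.1, P.abs_h_lt, P.R_le]

/-- An upward ray has to reach distance `c` from the axis before its norm reaches `3 / 2`, which
bounds its steepness. -/
theorem bddAbove_directions : BddAbove P.directions := by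
  refine ⟨3 / P.c, fun ρ hρ => ?_⟩
  obtain ⟨h0, t, ht, hp⟩ := hρ
  have hc := P.c_pos
  by_contra! h
  rw [div_lt_iff₀ hc] at h
  have hc1 : P.c < 1 := by
    have := P.c_sq_lt; have := P.a_le
    nlinarith
  have hρ1 : 3 < ρ := by nlinarith
  have h1 := norm_lt_of_mem_domain hp
  have h2 := c_sq_lt_axisSq hp (by
    rw [rayPoint_two]
    simp only [PiLp.norm_single, Real.norm_eq_abs, sq_abs]
    exact mul_pos ht (by nlinarith))
  rw [norm_rayPoint ht] at h1
  rw [axisSq_rayPoint] at h2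
  simp only [PiLp.norm_single, Real.norm_eq_abs, abs_of_nonneg h0] at h1 h2
  have h3 : P.c < t * ρ := lt_of_pow_lt_pow_left₀ 2 (by positivity) h2
  nlinarith

variable (P) in
theorem exists_shell_radius : ∃ ν : ℝ, 1 < ν ∧ ∀ p : E3, ‖p‖ = ν → ‖p - P.center‖ < P.R := by
  refine ⟨(1 + (P.R - |P.h|)) / 2, by linarith [P.abs_h_lt], fun p hp => ?_⟩
  have h1 := norm_sub_le p P.center
  rw [norm_center, hp] at h1
  linarith [P.abs_h_lt]

/-- A ray that enters the high part of the domain can be turned down along the lower graph. -/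
theorem exists_mem_domain_of_slope_lt {p : E3} {k : ℝ} (hk : 19 / 5 ≤ k) (h0 : 0 < p 2)
    (hr : √(axisSq p) < 9 / 20) (hpk : k * √(axisSq p) < p 2) (hp : p ∈ P.domain) :
    ∃ r : ℝ, 0 < r ∧ ∀ q : E3, axisSq q = r ^ 2 → q 2 = k * r → q ∈ P.domain := by
  have hsq := Real.sq_sqrt (axisSq_nonneg p)
  have hr0 := Real.sqrt_nonneg (axisSq p)
  obtain ⟨r₀, hr₀⟩ : ∃ r₀, r₀ = √(axisSq p) := ⟨_, rfl⟩
  rw [← hr₀] at hsq hr hr0 hpk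
  obtain ⟨hc, hB, hT⟩ := hp.2.2 h0 (by nlinarith)
  rw [← hsq] at hc hB hT
  have hs : ∀ r ∈ Icc r₀ (9 / 20), r₀ ^ 2 ≤ r ^ 2 ∧ r ^ 2 < 1 / 4 := fun r hr =>
    ⟨pow_le_pow_left₀ hr0 hr.1 2, by nlinarith [hr.1, hr.2]⟩
  have hgap : ∀ r ∈ Icc r₀ (9 / 20), P.B (r ^ 2) + (p 2 - P.B (r₀ ^ 2)) < P.T (r ^ 2) := by
    intro r hr
    have h1 := hs r hr
    have := P.monotoneOn_T_sub_B (a := r₀ ^ 2) (b := r ^ 2) ⟨hc, by linarith⟩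
      ⟨hc.trans_le h1.1, by linarith⟩ h1.1
    simp only at this
    linarith
  -- Move outward from `p` along the vertical translate of the lower graph; it stays below `T`
  -- because `T - B` increases. At radius `9 / 20` the line of slope `k` has height at least `171 /
  -- 100`, above `T ≤ 5 / 4 + h < 3 / 2`, so the two cross before.
  obtain ⟨r, hr', hzero⟩ : ∃ r ∈ Icc r₀ (9 / 20),
      P.B (r ^ 2) + (p 2 - P.B (r₀ ^ 2)) - k * r = 0 := by
    have hcont : ContinuousOn (fun r => P.B (r ^ 2) + (p 2 - P.B (r₀ ^ 2)) - k * r)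
        (Icc r₀ (9 / 20)) := by
      intro r hr
      have h1 := hs r hr
      have h2 : ContinuousAt (fun r : ℝ => P.B (r ^ 2)) r :=
        ContinuousAt.comp (f := fun r : ℝ => r ^ 2) (P.hasDerivAt_B _ (hc.trans_le h1.1)
          (by linarith)).continuousAt (by fun_prop)
      exact ((h2.add continuousAt_const).sub (by fun_prop)).continuousWithinAt
    refine intermediate_value_Icc' hr.le hcont ⟨?_, by linarith⟩
    have h1 := right_mem_Icc.2 hr.le
    have h2 := hgap _ h1
    have h3 := P.T_le_sphere (s := (9 / 20) ^ 2) (hc.trans_le (hs _ h1).1)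
      (by linarith [P.one_lt_R_sq])
    have h4 : √(P.R ^ 2 - (9 / 20) ^ 2) ≤ 5 / 4 := by
      rw [Real.sqrt_le_left (by norm_num)]
      nlinarith [P.R_le, P.one_lt]
    have h5 := P.abs_h_lt_quarter.2
    simp only
    linarith
  have h1 := hs r hr'
  have hcr := hc.trans_le h1.1
  have hr00 : 0 < r := by
    have := P.c_sq_pos
    have h3 := hr0.trans hr'.1
    exact lt_of_le_of_ne h3 fun h => by rw [← h] at hcr; nlinarith
  refine ⟨r, hr00, fun q hq hqz => ?_⟩
  rw [mem_domain_iff_of_high (by rw [hqz]; positivity) (by rw [hq]; exact h1.2), hq, hqz]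
  exact ⟨hcr, by linarith, by linarith [hgap r hr']⟩

/-- On the ray `ρ`, try the point of norm `ν` slightly above 1. If it lies outside the neck region
it is in the domain; otherwise the ray is steep, and `exists_mem_domain_of_slope_lt` carries
membership over from the steeper ray `ρ₀`. -/
theorem mem_directions_of_le {ρ ρ₀ : ℝ} (h0 : 0 ≤ ρ) (h : ρ < ρ₀) (hρ₀ : ρ₀ ∈ P.directions) :
    ρ ∈ P.directions := by
  obtain ⟨h00, t₀, ht₀, hp⟩ := hρ₀
  refine ⟨h0, ?_⟩
  obtain ⟨ν, hν, hνR⟩ := P.exists_shell_radius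
  obtain ⟨t, ht, htν⟩ : ∃ t : ℝ, 0 < t ∧ t * ((ρ ^ 2 + 1) / 2) = ν :=
    ⟨ν / ((ρ ^ 2 + 1) / 2), by positivity, by field_simp⟩
  have hn : ‖rayPoint (EuclideanSpace.single 0 ρ, t)‖ = ν := by
    rw [norm_rayPoint ht]; simpa using htν
  by_cases hlow : rayPoint (EuclideanSpace.single 0 ρ, t) 2 < 1 / 2 ∨
      P.s₁ < axisSq (rayPoint (EuclideanSpace.single 0 ρ, t))
  · exact ⟨t, ht, (mem_domain_iff_of_low hlow).2 ⟨hn ▸ hν, hνR _ hn⟩⟩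
  push Not at hlow
  have hn2 := one_lt_norm_iff.1 (hν.trans_eq hn.symm)
  rw [axisSq_rayPoint, rayPoint_two] at hlow hn2
  simp only [PiLp.norm_single, Real.norm_eq_abs, abs_of_nonneg h0] at hlow hn2
  have hs₁ := P.s₁_le
  have hρ1 : 1 < ρ := by
    by_contra! hcon
    nlinarith
  -- Norm above 1 and squared distance to the axis at most `1 / 16` force slope above `√15 > 19 /
  -- 5`.
  have hk : 19 / 5 ≤ (ρ ^ 2 - 1) / (2 * ρ) := by
    by_contra! hcon
    have e : t * ((ρ ^ 2 - 1) / 2) = (ρ ^ 2 - 1) / (2 * ρ) * (t * ρ) := by field_simp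
    have e0 : 0 ≤ (ρ ^ 2 - 1) / (2 * ρ) := div_nonneg (by nlinarith) (by linarith)
    rw [e, mul_pow] at hn2
    have e2 : ((ρ ^ 2 - 1) / (2 * ρ)) ^ 2 ≤ (19 / 5) ^ 2 := pow_le_pow_left₀ e0 hcon.le 2
    nlinarith [sq_nonneg (t * ρ)]
  have hkk : (ρ ^ 2 - 1) / (2 * ρ) < (ρ₀ ^ 2 - 1) / (2 * ρ₀) := by
    rw [div_lt_div_iff₀ (by linarith) (by linarith)]
    nlinarith [mul_pos (sub_pos.2 h) (show 0 < ρ * ρ₀ + 1 by positivity)]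
  have hz : rayPoint (EuclideanSpace.single 0 ρ₀, t₀) 2 = (ρ₀ ^ 2 - 1) / (2 * ρ₀) * (t₀ * ρ₀) := by
    have : ρ₀ ≠ 0 := by linarith
    rw [rayPoint_two]; simp; field_simp
  have hs : √(axisSq (rayPoint (EuclideanSpace.single 0 ρ₀, t₀))) = t₀ * ρ₀ := by
    rw [axisSq_rayPoint]; simp [abs_of_nonneg h00]
    rw [Real.sqrt_sq (by positivity)]
  have hr0 : 0 < t₀ * ρ₀ := mul_pos ht₀ (by linarith)
  -- Otherwise the height is at least `171 / 100`, above the top `h + R < 3 / 2` of the outer ball.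
  have hr : t₀ * ρ₀ < 9 / 20 := by
    by_contra! hcon
    have h1 := norm_sub_center_lt_iff.1 hp.2.1
    rw [hz] at h1
    have h2 := P.abs_h_lt_quarter.2
    have h3 : 19 / 5 * (9 / 20) ≤ (ρ₀ ^ 2 - 1) / (2 * ρ₀) * (t₀ * ρ₀) :=
      mul_le_mul (by linarith) hcon (by norm_num) (by linarith)
    have h4 := axisSq_nonneg (rayPoint (EuclideanSpace.single 0 ρ₀, t₀))
    have h5 : P.R ≤ (ρ₀ ^ 2 - 1) / (2 * ρ₀) * (t₀ * ρ₀) - P.h := by linarith [P.R_le]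
    have h6 := pow_le_pow_left₀ (by linarith [P.one_lt]) h5 2
    linarith
  obtain ⟨r, hr, hq⟩ := exists_mem_domain_of_slope_lt hk
    (by rw [hz]; exact mul_pos (by linarith) hr0) (by rw [hs]; exact hr)
    (by rw [hs, hz]; exact mul_lt_mul_of_pos_right hkk hr0) hp
  refine ⟨r / ρ, by positivity, hq _ ?_ ?_⟩
  · rw [axisSq_rayPoint]; simp [abs_of_nonneg h0]; field_simp
  · rw [rayPoint_two]; simp; field_simp

theorem one_mem_directions : (1 : ℝ) ∈ P.directions := by
  obtain ⟨ν, hν, hνR⟩ := P.exists_shell_radius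
  have hn : ‖rayPoint (EuclideanSpace.single 0 1, ν)‖ = ν := by
    rw [norm_rayPoint (by simp; linarith)]; simp
  exact ⟨one_pos.le, ν, by linarith, (mem_domain_iff_of_low
    (Or.inl (by rw [rayPoint_two]; simp))).2 ⟨hν.trans_eq hn.symm, hνR _ hn⟩⟩

/-- The set of directions is bounded, closed under decreasing and without greatest element, so it is
`[0, L)` with `L` its supremum. -/
theorem areDiffeomorphic_ball_domain : AreDiffeomorphic (ball 0 1) P.domain := by
  refine areDiffeomorphic_ball_of_radial (L := sSup P.directions) P.isOpen_domain
    (fun p => lt_norm_of_mem_domain) ordConnected_ray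
    (one_pos.trans_le (le_csSup bddAbove_directions one_mem_directions)) fun ξ => ?_
  rw [← norm_mem_directions_iff]
  constructor
  · intro h
    obtain ⟨ρ, hρ, hlt⟩ := exists_directions_gt h
    exact hlt.trans_le (le_csSup bddAbove_directions hρ)
  · intro h
    obtain ⟨ρ, hρ, hlt⟩ := exists_lt_of_lt_csSup ⟨1, one_mem_directions⟩ h
    exact mem_directions_of_le (norm_nonneg _) hlt hρ

end NeckProfile

theorem AreDiffeomorphic.isConnected {U V : Set E3} (h : AreDiffeomorphic U V)
    (hU : IsConnected U) : IsConnected V := by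
  obtain ⟨f, g, hf, -, hfm, hgm, hinv⟩ := h
  have : f '' U = V := Subset.antisymm hfm.image_subset fun v hv => ⟨g v, hgm hv, hinv.2 hv⟩
  rw [← this]
  exact hU.image f hf.continuousOn

end DomainRays

/-! ### Surface area and volume -/

section SurfaceArea

open Set Filter Topology
open scoped ENNReal MeasureTheory

/-- The part over the annulus `a < x² + y² < b` of the radial graph `z = g (x² + y²)`. -/
def radialGraph (g : ℝ → ℝ) (a b : ℝ) : Set E3 := {p | axisSq p ∈ Ioo a b ∧ p 2 = g (axisSq p)}

theorem radialGraph_eq_image (g : ℝ → ℝ) (a b : ℝ) :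
    radialGraph g a b = graphMap (fun y => g (‖y‖ ^ 2)) '' {y | ‖y‖ ^ 2 ∈ Ioo a b} := by
  have hax : ∀ (u : EuclideanSpace ℝ (Fin 2) → ℝ) y, axisSq (graphMap u y) = ‖y‖ ^ 2 := by
    intro u y
    rw [EuclideanSpace.norm_sq_eq, Fin.sum_univ_two]; simp [axisSq, graphMap]
  ext p
  constructor
  · rintro ⟨h1, h2⟩
    have h3 : ‖horizontal p‖ ^ 2 = axisSq p := norm_horizontal_sq p
    refine ⟨horizontal p, by rw [mem_ofPred_eq, h3]; exact h1, ?_⟩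
    ext i
    fin_cases i
    · simp [graphMap, horizontal]
    · simp [graphMap, horizontal]
    · simp [graphMap, h3, h2]
  · rintro ⟨y, hy, rfl⟩
    exact ⟨by rw [hax]; exact hy, by rw [hax]; simp [graphMap]⟩

theorem measurableSet_radialGraph {g : ℝ → ℝ} (hg : Continuous g) (a b : ℝ) :
    MeasurableSet (radialGraph g a b) :=
  (measurableSet_Ioo.preimage continuous_axisSq.measurable).inter
    (isClosed_eq (NeckProfile.continuous_coord 2) (hg.comp continuous_axisSq)).measurableSet

def levelCircle (r z : ℝ) : Set E3 := {p | axisSq p = r ∧ p 2 = z}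

theorem area_levelCircle (r z : ℝ) : (μHE[2] : Measure E3) (levelCircle r z) = 0 := by
  let f : ℝ → E3 := fun t => !₂[√r * Real.cos t, √r * Real.sin t, z]
  have hf : ContDiff ℝ 1 f := by
    rw [contDiff_euclidean]
    intro i
    fin_cases i
    · exact contDiff_const.mul Real.contDiff_cos
    · exact contDiff_const.mul Real.contDiff_sin
    · exact contDiff_const
  have hsub : levelCircle r z ⊆ range f := by
    rintro p ⟨h1, h2⟩
    have hr : 0 ≤ r := h1 ▸ axisSq_nonneg p
    let w : ℂ := ⟨p 0, p 1⟩
    have hw : ‖w‖ = √r := by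
      rw [← h1, Complex.norm_def, Complex.normSq_mk, axisSq]
      congr 1; ring
    refine ⟨Complex.arg w, ?_⟩
    ext i
    fin_cases i
    · simp [f, ← hw, w]
    · simp [f, ← hw, w]
    · simp [f, h2]
  have hdim : dimH (levelCircle r z) < ((2 : NNReal) : ℝ≥0∞) := by
    refine ((dimH_mono hsub).trans hf.dimH_range_le).trans_lt ?_
    rw [Module.finrank_self]
    norm_num
  have h := hausdorffMeasure_of_dimH_lt hdim
  rw [Measure.euclideanHausdorffMeasure_def, Measure.smul_apply]
  have h2 : ((2 : NNReal) : ℝ) = ((2 : ℕ) : ℝ) := by norm_num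
  rw [h2] at h
  rw [h, smul_zero]

theorem one_add_descentRate_sq {m s : ℝ} (hs : 0 < s) (hm : m ^ 2 < s) :
    1 + 4 * s * (-descentRate m s) ^ 2 = 1 / (1 - m ^ 2 / s) := by
  have h0 : 0 < s - m ^ 2 := sub_pos.2 hm
  have h1 : 1 - m ^ 2 / s = (s - m ^ 2) / s := by field_simp
  rw [descentRate, neg_sq, div_pow, mul_pow, h1, Real.sq_sqrt (by positivity)]
  field_simp
  ring

/-- The sine of the tilt is at most `1 / 2`, so the area density is at most `2 / √3 < 2`. -/
theorem area_graph_le_of_four_sq_le {g m : ℝ → ℝ} {a b : ℝ} (ha : 0 ≤ a) (hab : a ≤ b)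
    (hm : ContDiff ℝ 1 m) (hg : ∀ s ∈ Ioo a b, HasDerivAt g (-descentRate (m s) s) s)
    (h4 : ∀ s ∈ Ioo a b, 4 * m s ^ 2 ≤ s) :
    (μHE[2] : Measure E3) (radialGraph g a b) ≤ ENNReal.ofReal (2 * Real.pi * (b - a)) := by
  have hms : ∀ s ∈ Ioo a b, m s ^ 2 < s := fun s hs => by
    have := h4 s hs
    have : 0 < s := ha.trans_lt hs.1
    linarith
  rw [radialGraph_eq_image]
  refine (area_radial_graph_le (Q := fun s => 2 * s) (q := fun _ => 2) ha hab hg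
    (fun s hs => (contDiffAt_descentRate hm (ha.trans_lt hs.1)
      (hms s hs)).continuousAt.neg.continuousWithinAt) (by fun_prop)
    (fun s _ => ((hasDerivAt_id s).const_mul 2).congr_deriv (by simp)) fun s hs => ?_).trans
    (ENNReal.ofReal_le_ofReal (by linarith))
  have hs0 : 0 < s := ha.trans_lt hs.1
  rw [one_add_descentRate_sq hs0 (hms s hs), Real.sqrt_le_left two_pos.le]
  have h5 : m s ^ 2 / s ≤ 1 / 4 := by rw [div_le_iff₀ hs0]; linarith [h4 s hs]
  rw [div_le_iff₀ (by linarith)]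
  linarith

/-- The density `√(s / (s - c ^ 2))` blows up at the waist but is at most `√a / √(s - c ^ 2)`, with
integral `2 * √a * √(a - c ^ 2) ≤ 2 * a`. -/
theorem area_graph_le_of_sq_eq {g m : ℝ → ℝ} {a c : ℝ} (hc : 0 < c) (hca : c ^ 2 < a)
    (hm : ContDiff ℝ 1 m) (hg : ∀ s ∈ Ioo (c ^ 2) a, HasDerivAt g (-descentRate (m s) s) s)
    (hmc : ∀ s ∈ Ioo (c ^ 2) a, m s ^ 2 = c ^ 2) :
    (μHE[2] : Measure E3) (radialGraph g (c ^ 2) a) ≤ ENNReal.ofReal (2 * Real.pi * a) := by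
  have hc0 : 0 < c ^ 2 := pow_pos hc 2
  have ha : 0 < a := hc0.trans hca
  have hms : ∀ s ∈ Ioo (c ^ 2) a, m s ^ 2 < s := fun s hs => by rw [hmc s hs]; exact hs.1
  rw [radialGraph_eq_image]
  refine (area_radial_graph_le (Q := fun s => 2 * √a * √(s - c ^ 2))
    (q := fun s => √a / √(s - c ^ 2)) hc0.le hca.le hg
    (fun s hs => (contDiffAt_descentRate hm (hc0.trans hs.1)
      (hms s hs)).continuousAt.neg.continuousWithinAt) (by fun_prop)
    (fun s hs => ?_) fun s hs => ?_).trans (ENNReal.ofReal_le_ofReal ?_)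
  · have h1 : 0 < s - c ^ 2 := sub_pos.2 hs.1
    have h2 := Real.sqrt_pos.2 h1
    refine ((((hasDerivAt_id s).sub_const (c ^ 2)).sqrt h1.ne').const_mul (2 * √a)).congr_deriv ?_
    simp only [id]
    field_simp
  · have hs0 : 0 < s := hc0.trans hs.1
    have h1 : 0 < s - c ^ 2 := sub_pos.2 hs.1
    rw [one_add_descentRate_sq hs0 (hms s hs), hmc s hs, ← Real.sqrt_div ha.le]
    apply Real.sqrt_le_sqrt
    rw [div_le_div_iff₀ (by rw [sub_pos, div_lt_one hs0]; exact hs.1) h1]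
    have h2 : a * (1 - c ^ 2 / s) = a / s * (s - c ^ 2) := by field_simp
    rw [h2]
    apply mul_le_mul_of_nonneg_right _ h1.le
    rw [one_le_div hs0]; exact hs.2.le
  · rw [sub_self, Real.sqrt_zero, mul_zero, sub_zero]
    have h1 : √a * √(a - c ^ 2) ≤ √a * √a :=
      mul_le_mul_of_nonneg_left (Real.sqrt_le_sqrt (by linarith)) (Real.sqrt_nonneg _)
    rw [Real.mul_self_sqrt ha.le] at h1
    nlinarith [Real.pi_pos]

theorem area_neck_graph_le {g m : ℝ → ℝ} {a c r s₁ : ℝ} (hc : 0 < c) (hca : c ^ 2 < a)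
    (has : a < s₁) (hsr : s₁ < r) (hm : ContDiff ℝ 1 m)
    (hg : ∀ s, c ^ 2 < s → s < r → HasDerivAt g (-descentRate (m s) s) s)
    (hmc : ∀ s ≤ a, m s ^ 2 = c ^ 2) (h4 : ∀ s, a ≤ s → s ≤ s₁ → 4 * m s ^ 2 ≤ s) :
    (μHE[2] : Measure E3) {p | c ^ 2 < axisSq p ∧ axisSq p ≤ s₁ ∧ p 2 = g (axisSq p)} ≤
      ENNReal.ofReal (2 * Real.pi * s₁) := by
  have hc0 : 0 < c ^ 2 := pow_pos hc 2
  have hpi := Real.pi_pos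
  have hsub : {p : E3 | c ^ 2 < axisSq p ∧ axisSq p ≤ s₁ ∧ p 2 = g (axisSq p)} ⊆
      (radialGraph g (c ^ 2) a ∪ radialGraph g a s₁) ∪
        (levelCircle a (g a) ∪ levelCircle s₁ (g s₁)) := by
    rintro p ⟨h1, h2, h3⟩
    rcases lt_trichotomy (axisSq p) a with h | h | h
    · exact Or.inl (Or.inl ⟨⟨h1, h⟩, h3⟩)
    · exact Or.inr (Or.inl ⟨h, by rw [h3, h]⟩)
    · rcases h2.eq_or_lt with h' | h'
      · exact Or.inr (Or.inr ⟨h', by rw [h3, h']⟩)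
      · exact Or.inl (Or.inr ⟨⟨h, h'⟩, h3⟩)
  have hnull : (μHE[2] : Measure E3) (levelCircle a (g a) ∪ levelCircle s₁ (g s₁)) = 0 :=
    measure_union_null (area_levelCircle _ _) (area_levelCircle _ _)
  refine (measure_mono hsub).trans ((measure_union_le _ _).trans ?_)
  rw [hnull, add_zero]
  refine (measure_union_le _ _).trans ((add_le_add
    (area_graph_le_of_sq_eq hc hca hm (fun s hs => hg s hs.1 (by linarith [hs.2]))
      fun s hs => hmc s hs.2.le)
    (area_graph_le_of_four_sq_le (hc0.trans hca).le has.le hm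
      (fun s hs => hg s (hca.trans hs.1) (by linarith [hs.2]))
      fun s hs => h4 s hs.1.le hs.2.le)).trans ?_)
  rw [← ENNReal.ofReal_add (mul_nonneg (by positivity) (hc0.trans hca).le)
    (mul_nonneg (by positivity) (by linarith))]
  exact ENNReal.ofReal_le_ofReal (by linarith)

/-- The lower hemisphere of the sphere of radius `R` about `(0, 0, h)`, without its lowest point,
together with the zone `s₁ < x² + y²` of the upper hemisphere. -/
def truncatedSphere (R h s₁ : ℝ) : Set E3 :=
  radialGraph (fun s => h + -1 * √(R ^ 2 - s)) 0 (R ^ 2) ∪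
    radialGraph (fun s => h + 1 * √(R ^ 2 - s)) s₁ (R ^ 2)

theorem measurableSet_truncatedSphere (R h s₁ : ℝ) : MeasurableSet (truncatedSphere R h s₁) :=
  (measurableSet_radialGraph (by fun_prop) _ _).union (measurableSet_radialGraph (by fun_prop) _ _)

theorem area_truncatedSphere {R h s₁ : ℝ} (hR : 0 < R) (h0 : 0 ≤ s₁) (h1 : s₁ ≤ R ^ 2) :
    (μHE[2] : Measure E3) (truncatedSphere R h s₁) =
      ENNReal.ofReal (2 * Real.pi * R * (R + √(R ^ 2 - s₁))) := by
  have hpi := Real.pi_pos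
  rw [truncatedSphere, measure_union _ (measurableSet_radialGraph (by fun_prop) _ _),
    radialGraph_eq_image, radialGraph_eq_image,
    area_sphere_zone (h := h) (τ := -1) hR le_rfl (sq_nonneg R) (by norm_num) (fun _ _ => rfl),
    area_sphere_zone (h := h) (τ := 1) hR h0 h1 (by norm_num) (fun _ _ => rfl),
    ← ENNReal.ofReal_add (by positivity) (by positivity), sub_zero, Real.sqrt_sq hR.le, ← mul_add]
  rw [Set.disjoint_left]
  rintro p ⟨h2, h3⟩ ⟨-, h4⟩
  have := Real.sqrt_pos.2 (sub_pos.2 h2.2)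
  linarith

theorem axisSq_add_of_mem_truncatedSphere {R h s₁ : ℝ} {p : E3} (hp : p ∈ truncatedSphere R h s₁) :
    axisSq p + (p 2 - h) ^ 2 = R ^ 2 ∧ (p 2 < h ∨ s₁ < axisSq p) := by
  rcases hp with ⟨h1, h2⟩ | ⟨h1, h2⟩
  · have h3 := Real.sq_sqrt (sub_pos.2 h1.2).le
    have h4 := Real.sqrt_pos.2 (sub_pos.2 h1.2)
    refine ⟨?_, Or.inl (by linarith)⟩
    rw [h2, add_sub_cancel_left, mul_pow, h3]; ring
  · have h3 := Real.sq_sqrt (sub_pos.2 h1.2).le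
    refine ⟨?_, Or.inr h1.1⟩
    rw [h2, add_sub_cancel_left, mul_pow, h3]; ring

/-- The part of a sphere below height `1 / 2` or at distance at least `√s₁` from the axis is, up to
a circle and a point, a truncated sphere. -/
theorem area_sphere_low_le {R h s₁ : ℝ} (hR : 1 ≤ R) (hh : -(1 / 4) < h) (hs₁ : s₁ ≤ 1 / 16) :
    (μHE[2] : Measure E3) {p | (p 2 < 1 / 2 ∨ s₁ < axisSq p) ∧
      axisSq p + (p 2 - h) ^ 2 = R ^ 2} ≤ (μHE[2] : Measure E3) (truncatedSphere R h s₁) := by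
  have hsub : {p : E3 | (p 2 < 1 / 2 ∨ s₁ < axisSq p) ∧ axisSq p + (p 2 - h) ^ 2 = R ^ 2} ⊆
      truncatedSphere R h s₁ ∪ (levelCircle 0 (h - R) ∪ levelCircle (R ^ 2) h) := by
    rintro p ⟨h1, h2⟩
    have hs := axisSq_nonneg p
    have hR2 : 1 ≤ R ^ 2 := one_le_pow₀ hR
    have e : R ^ 2 - axisSq p = (p 2 - h) ^ 2 := by linarith
    rcases lt_trichotomy (p 2) h with h3 | h3 | h3
    · have hsq : √(R ^ 2 - axisSq p) = h - p 2 := by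
        rw [e, Real.sqrt_sq_eq_abs, abs_of_neg (by linarith)]; ring
      rcases hs.eq_or_lt with h4 | h4
      · right; left
        refine ⟨h4.symm, ?_⟩
        rw [← h4, sub_zero, Real.sqrt_sq (by linarith)] at hsq
        linarith
      · left; left
        refine ⟨⟨h4, by nlinarith [mul_pos (sub_pos.2 h3) (sub_pos.2 h3)]⟩, ?_⟩
        simp only [hsq]; ring
    · right; right
      exact ⟨by rw [h3, sub_self] at h2; linarith, h3⟩
    · have hsq : √(R ^ 2 - axisSq p) = p 2 - h := by
        rw [e, Real.sqrt_sq_eq_abs, abs_of_pos (by linarith)]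
      left; right
      refine ⟨⟨?_, by nlinarith [mul_pos (sub_pos.2 h3) (sub_pos.2 h3)]⟩, ?_⟩
      · rcases h1 with h1 | h1
        · by_contra! hcon
          nlinarith
        · exact h1
      · simp only [hsq]; ring
  refine (measure_mono hsub).trans ((measure_union_le _ _).trans ?_)
  rw [measure_union_null (area_levelCircle _ _) (area_levelCircle _ _), add_zero]

namespace NeckProfile

variable (P : NeckProfile)

theorem frontier_domain_subset : frontier P.domain ⊆
    (({p | (p 2 < 1 / 2 ∨ P.s₁ < axisSq p) ∧ axisSq p + (p 2 - 0) ^ 2 = 1 ^ 2} ∪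
      {p | (p 2 < 1 / 2 ∨ P.s₁ < axisSq p) ∧ axisSq p + (p 2 - P.h) ^ 2 = P.R ^ 2}) ∪
      ({p | P.c ^ 2 < axisSq p ∧ axisSq p ≤ P.s₁ ∧ p 2 = P.T (axisSq p)} ∪
      {p | P.c ^ 2 < axisSq p ∧ axisSq p ≤ P.s₁ ∧ p 2 = P.B (axisSq p)})) ∪
      levelCircle (P.c ^ 2) P.z₀ := by
  intro p hp
  rcases mem_frontier_domain_cases hp with ⟨hlow, h | h⟩ | ⟨h1, h2, h | h⟩ | h
  · refine Or.inl (Or.inl (Or.inl ⟨hlow, ?_⟩))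
    rw [sub_zero, ← norm_sq_eq_axisSq, h]
  · refine Or.inl (Or.inl (Or.inr ⟨hlow, ?_⟩))
    rw [← norm_sub_center_sq, h]
  · exact Or.inl (Or.inr (Or.inl ⟨h1, h2, h⟩))
  · exact Or.inl (Or.inr (Or.inr ⟨h1, h2, h⟩))
  · exact Or.inr h

theorem s₁_pos : 0 < P.s₁ := P.c_sq_pos.trans (P.c_sq_lt.trans P.a_lt)

theorem area_frontier_domain_le : (μHE[2] : Measure E3) (frontier P.domain) ≤
    ENNReal.ofReal (4 * Real.pi + 4 * Real.pi * P.R ^ 2 + 4 * Real.pi * P.s₁) := by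
  have hs₁ := P.s₁_le
  have hs0 := P.s₁_pos
  have hR := P.one_lt
  have hR2 := P.one_lt_R_sq
  have hpi := Real.pi_pos
  have e1 := (area_sphere_low_le (R := 1) (h := 0) le_rfl (by norm_num) hs₁).trans_eq
    (area_truncatedSphere one_pos hs0.le (by linarith))
  have e2 := (area_sphere_low_le hR.le P.abs_h_lt_quarter.1 hs₁).trans_eq
    (area_truncatedSphere (by linarith) hs0.le (by linarith))
  have e3 := area_neck_graph_le P.c_pos P.c_sq_lt P.a_lt (by linarith) P.contDiff_mt
    P.hasDerivAt_T P.mt_sq_eq P.mt_sq_le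
  have e4 := area_neck_graph_le P.c_pos P.c_sq_lt P.a_lt (by linarith) P.contDiff_mb
    P.hasDerivAt_B P.mb_sq_eq P.mb_sq_le
  refine (measure_mono P.frontier_domain_subset).trans ((measure_union_le _ _).trans ?_)
  rw [area_levelCircle, add_zero]
  refine (measure_union_le _ _).trans ((add_le_add ((measure_union_le _ _).trans (add_le_add e1 e2))
    ((measure_union_le _ _).trans (add_le_add e3 e4))).trans ?_)
  rw [← ENNReal.ofReal_add (by positivity) (by positivity),
    ← ENNReal.ofReal_add (by positivity) (by positivity),
    ← ENNReal.ofReal_add (by positivity) (by positivity)]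
  apply ENNReal.ofReal_le_ofReal
  have h1 : √(1 ^ 2 - P.s₁) ≤ 1 := by
    rw [Real.sqrt_le_left one_pos.le]; linarith
  have h2 : √(P.R ^ 2 - P.s₁) ≤ P.R := by
    rw [Real.sqrt_le_left (by linarith)]; linarith
  have h3 := mul_le_mul_of_nonneg_left h1 hpi.le
  have h4 := mul_le_mul_of_nonneg_left h2 (show 0 ≤ Real.pi * P.R by positivity)
  nlinarith

theorem truncatedSphere_subset_frontier_domain :
    truncatedSphere 1 0 P.s₁ ∪ truncatedSphere P.R P.h P.s₁ ⊆ frontier P.domain := by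
  have hh := P.abs_h_lt_quarter.2
  have hR := P.one_lt
  rintro p (hp | hp)
  · obtain ⟨h1, h2⟩ := axisSq_add_of_mem_truncatedSphere hp
    have h3 : ‖p‖ = 1 := by
      rw [sub_zero, ← norm_sq_eq_axisSq] at h1
      rwa [sq_eq_sq₀ (norm_nonneg _) one_pos.le] at h1
    have hlow : p 2 < 1 / 2 ∨ P.s₁ < axisSq p := h2.imp_left fun h => by linarith
    exact mem_frontier_of_isDefiningAt (eventually_isDefiningAt_inner p)
      (eventually_mem_domain_of_inner hlow h3) (by simp [h3])
  · obtain ⟨h1, h2⟩ := axisSq_add_of_mem_truncatedSphere hp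
    have h3 : ‖p - P.center‖ = P.R := by
      rw [← norm_sub_center_sq] at h1
      rwa [sq_eq_sq₀ (norm_nonneg _) (by linarith)] at h1
    have hlow : p 2 < 1 / 2 ∨ P.s₁ < axisSq p := h2.imp_left fun h => by linarith
    exact mem_frontier_of_isDefiningAt (eventually_isDefiningAt_outer p)
      (eventually_mem_domain_of_outer hlow h3) (by simp [h3])

theorem le_area_frontier_domain : ENNReal.ofReal (8 * Real.pi - 4 * Real.pi * P.s₁) ≤
    (μHE[2] : Measure E3) (frontier P.domain) := by
  have hs₁ := P.s₁_le
  have hs0 := P.s₁_pos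
  have hR := P.one_lt
  have hR2 := P.one_lt_R_sq
  have hpi := Real.pi_pos
  refine le_trans ?_ (measure_mono P.truncatedSphere_subset_frontier_domain)
  rw [measure_union _ (measurableSet_truncatedSphere _ _ _),
    area_truncatedSphere one_pos hs0.le (by linarith),
    area_truncatedSphere (by linarith) hs0.le (by linarith),
    ← ENNReal.ofReal_add (by positivity) (by positivity)]
  · apply ENNReal.ofReal_le_ofReal
    have h1 : 1 - P.s₁ ≤ √(1 ^ 2 - P.s₁) := by
      apply Real.le_sqrt_of_sq_le; nlinarith
    have h2 : 1 - P.s₁ ≤ √(P.R ^ 2 - P.s₁) := by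
      apply Real.le_sqrt_of_sq_le; nlinarith
    have h3 := mul_le_mul_of_nonneg_left h1 hpi.le
    have h4 : 1 * (1 + (1 - P.s₁)) ≤ P.R * (P.R + √(P.R ^ 2 - P.s₁)) :=
      mul_le_mul hR.le (by linarith) (by linarith) (by linarith)
    have h5 := mul_le_mul_of_nonneg_left h4 hpi.le
    nlinarith
  · rw [Set.disjoint_left]
    intro p hp hp'
    have h1 := (axisSq_add_of_mem_truncatedSphere hp).1
    have h2 := (axisSq_add_of_mem_truncatedSphere hp').1
    have h3 : ‖p‖ = 1 := by
      rw [sub_zero, ← norm_sq_eq_axisSq] at h1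
      rwa [sq_eq_sq₀ (norm_nonneg _) one_pos.le] at h1
    have h4 : ‖p - P.center‖ = P.R := by
      rw [← norm_sub_center_sq] at h2
      rwa [sq_eq_sq₀ (norm_nonneg _) (by linarith)] at h2
    have h5 := norm_sub_le p P.center
    rw [norm_center, h3, h4] at h5
    linarith [P.abs_h_lt]

theorem isBounded_domain : Bornology.IsBounded P.domain :=
  isBounded_ball.subset (t := ball P.center P.R) fun _ hp => mem_ball_iff_norm.2 hp.2.1

theorem volume_domain_le :
    volume P.domain ≤ ENNReal.ofReal (Real.pi * 4 / 3 * (P.R ^ 3 - 1)) := by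
  have hR := P.one_lt
  have hpi := Real.pi_pos
  have hsub : P.domain ⊆ ball P.center P.R \ closedBall 0 1 := fun p hp =>
    ⟨mem_ball_iff_norm.2 hp.2.1, fun h => by
      rw [mem_closedBall_zero_iff] at h
      exact h.not_gt hp.1⟩
  have hsub' : closedBall (0 : E3) 1 ⊆ ball P.center P.R := by
    intro p hp
    rw [mem_closedBall_zero_iff] at hp
    have h5 := norm_sub_le p P.center
    rw [norm_center] at h5
    rw [mem_ball_iff_norm]
    linarith [P.abs_h_lt]
  refine (measure_mono hsub).trans ?_
  rw [measure_sdiff hsub' measurableSet_closedBall.nullMeasurableSet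
    measure_closedBall_lt_top.ne, EuclideanSpace.volume_ball_fin_three,
    EuclideanSpace.volume_closedBall_fin_three, ← ENNReal.ofReal_pow (by linarith),
    ← ENNReal.ofReal_mul (by positivity), ← ENNReal.ofReal_pow one_pos.le,
    ← ENNReal.ofReal_mul (by positivity), ← ENNReal.ofReal_sub _ (by positivity)]
  exact ENNReal.ofReal_le_ofReal (by linarith)

end NeckProfile

end SurfaceArea

theorem theorem1 (ε : ℝ) (hε : 0 < ε) :
    ∃ Ω : Set E3,
      IsOpen Ω ∧ IsConnected Ω ∧ Bornology.IsBounded Ω ∧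
      AreDiffeomorphic (Metric.ball (0 : E3) 1) Ω ∧
      HasC11Boundary Ω ∧
      (∃ H : E3 → ℝ,
        (∀ᵐ p ∂(surfaceMeasure Ω), HasMeanCurvatureAt Ω (H p) p) ∧
        MeasureTheory.eLpNorm H ⊤ (surfaceMeasure Ω) ≤ 1) ∧
      surfaceMeasure Ω Set.univ ≠ ⊤ ∧
      |(surfaceMeasure Ω Set.univ).toReal - 8 * Real.pi| ≤ ε ∧
      MeasureTheory.volume Ω ≤ ENNReal.ofReal ε := by
  have hpi := Real.pi_pos
  -- The area differs from `8 * π` by at most `4 * π * (R ^ 2 - 1) + 4 * π * s₁ ≤ 16 * π * η`, and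
  -- the volume is at most `4 * π / 3 * (7 * η)`; the factor 20 covers both.
  obtain ⟨P, hPR, hPs⟩ := exists_neckProfile (η := min 1 (ε / (20 * Real.pi))) (by positivity)
  obtain ⟨η, hη⟩ : ∃ η, η = min 1 (ε / (20 * Real.pi)) := ⟨_, rfl⟩
  rw [← hη] at hPR hPs
  have hη0 : 0 < η := by rw [hη]; positivity
  have hη1 : η ≤ 1 := hη ▸ min_le_left _ _
  have hηε : 20 * Real.pi * η ≤ ε := by
    have : η ≤ ε / (20 * Real.pi) := hη ▸ min_le_right _ _
    rw [le_div_iff₀ (by positivity)] at this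
    linarith
  have hR := P.one_lt
  have hR2 : P.R ^ 2 ≤ 1 + 3 * η := by nlinarith
  have hR3 : P.R ^ 3 ≤ 1 + 7 * η := by
    have h1 : P.R ^ 3 ≤ (1 + 3 * η) * (1 + η) := by
      rw [pow_succ]; exact mul_le_mul hR2 hPR (by linarith) (by linarith)
    nlinarith
  have hup := P.area_frontier_domain_le
  have hlo := P.le_area_frontier_domain
  have hS : surfaceMeasure P.domain Set.univ = Measure.euclideanHausdorffMeasure 2
      (frontier P.domain) := by rw [surfaceMeasure, Measure.restrict_apply_univ]
  have hfin := (hup.trans_lt ENNReal.ofReal_lt_top).ne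
  have hdiff := P.areDiffeomorphic_ball_domain
  refine ⟨P.domain, P.isOpen_domain, hdiff.isConnected ((convex_ball 0 1).isConnected ⟨0, by simp⟩),
    P.isBounded_domain, hdiff, P.hasC11Boundary_domain,
    NeckProfile.exists_meanCurvature (area_levelCircle _ _), hS ▸ hfin, ?_, ?_⟩
  · rw [hS, abs_le]
    have h1 := (ENNReal.ofReal_le_iff_le_toReal hfin).1 hlo
    have h2 := ENNReal.toReal_le_of_le_ofReal (by have := P.s₁_pos; positivity) hup
    have h3 := mul_le_mul_of_nonneg_left hPs hpi.le
    have h4 := mul_le_mul_of_nonneg_left hR2 hpi.le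
    constructor <;> nlinarith
  · refine P.volume_domain_le.trans (ENNReal.ofReal_le_ofReal ?_)
    have h4 := mul_le_mul_of_nonneg_left hR3 hpi.le
    nlinarith
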